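/- A map is a triple $(X,R,L)$ where $X$ is a finite set of darts, $R$ is a permutation of $X$, $L$ is a fixed-point-free involution of $X$, and $\langle R,L\rangle$ is transitive on $X$. Its vertices, edges and faces are the orbits of $R$, $L$ and $RL$ ($L$ followed by $R$), the degree of a vertex is its number of darts, and its genus $g$ is given by $v-e+f=2(1-g)$. The empty map ($X=\varnothing$) is allowed; by convention it has one vertex, of degree $0$, no edge and one face, which is white. A sequenced face-bipartite map is a map whose faces are coloured white and black so that the two sides of every edge have opposite colours, with a root dart $r$ lying in a white face (no root if the map is empty), and with a finite sequence of distinct distinguished vertices other than the root vertex. For integers $g,e,w,b,n$ and a list $D$ of integers let $\mathcal F(g,e,w,b,n,D)$ be the set of isomorphism classes of sequenced face-bipartite maps of genus $g$ with $e$ edges, $w$ white faces, $b$ black faces, root vertex of degree $2n$, and list $D$ of half-degrees of the distinguished vertices. Theorem. Let $g,e,w,b,n\ge 0$ be integers with $n\ge 1$ or $e=0$, and let $D=(d_1,\dots,d_{|D|})$ be a list of positive integers. Then there is a bijection from $\mathcal F(g,e,w,b,n,D)$ onto the disjoint union $$\sum_{\substack{g_1+g_2=g,\ e_1+e_2=e-1\\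 w_1+b_2=b,\ w_2+b_1=w\\ n_1+n_2=n-1,\ D_1\subseteq D}}\mathcal F(g_1,e_1,w_1,b_1,n_1,D_1)\times\mathcal F(g_2,e_2,w_2,b_2,n_2,D-D_1)$$ $$+\sum_{p=1}^{n-2}\mathcal F(g-1,e-1,b,w,n-1-p,p.D)\times\{1,\dots,p\}+\sum_{p=n}^{e-1}\mathcal F(g,e-1,b,w,p,D)$$ $$+\sum_{j=1}^{|D|}\mathcal F(g,e-1,b,w,d_j+n-1,D-\{d_j\})+\Delta_{(g,e,w,b,n,D)=(0,0,1,0,0,[\,])}.$$ Here the indices $g_i,e_i,w_i,b_i,n_i$ are non-negative integers, sublists $D_1$ of $D$ are taken by position and $D-D_1$ is the complementary sublist, $p.D$ is $D$ with $p$ put in front, $D-\{d_j\}$ is $D$ without its $j$-th entry, and $\Delta_\varphi$ is the singleton of the empty map if $\varphi$ holds and is empty otherwise. Moreover the bijection is given by removing the root edge, i.e. by deleting $r$ and $L(r)$ from the cycles of $L$ and $RL$ (this splits the root vertex if the root edge is a loop and contracts the root edge if it is a link). The first term corresponds to a root edge that is a loop whose removal disconnects the map into maps $m_1$, rooted at $R(r)$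 and with colours exchanged, and $m_2$, rooted at $R(L(r))$ and with colours kept (either may be empty). In the next three terms the new map is rooted at $R(r)$ and its colours are exchanged: the second term corresponds to a loop whose removal does not disconnect the map, the new vertex containing $R(L(r))$ becoming the first distinguished vertex; the third to a link whose other end is not distinguished; the term with index $j$ of the fourth to a link whose other end is the $j$-th distinguished vertex, which is dropped from the sequence. All other distinguished vertices are kept, in order. The last term corresponds to the empty map. -/

import Mathlib

namespace FaceBipartite

/-- A combinatorial map: a finite set of darts with a permutation `R` and a fixed-point-free
involution `L` which together generate a transitive group. The empty set of darts is allowed. -/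
structure CombMap where
  Dart : Type
  finite_dart : Finite Dart
  R : Equiv.Perm Dart
  L : Equiv.Perm Dart
  L_invol : ∀ d, L (L d) = d
  L_ne : ∀ d, L d ≠ d
  transitive : ∀ x y : Dart, ∃ σ ∈ Subgroup.closure {R, L}, σ x = y

namespace CombMap

variable (m : CombMap)

/-- Vertices are the orbits of `R`. -/
abbrev Vertex : Type := Quotient (Equiv.Perm.SameCycle.setoid m.R)

/-- Edges are the orbits of `L`. -/
abbrev Edge : Type := Quotient (Equiv.Perm.SameCycle.setoid m.L)

/-- Faces are the orbits of `R * L` (`L` followed by `R`). -/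
abbrev Face : Type := Quotient (Equiv.Perm.SameCycle.setoid (m.R * m.L))

/-- The vertex containing a dart. -/
def vertex (d : m.Dart) : m.Vertex := Quotient.mk _ d

/-- The face containing a dart. -/
def face (d : m.Dart) : m.Face := Quotient.mk _ d

/-- The degree of a vertex is the number of darts it contains. -/
noncomputable def degree (v : m.Vertex) : ℕ := Nat.card {d : m.Dart // m.vertex d = v}

open Classical in
/-- The number of vertices; by convention the empty map has one vertex. -/
noncomputable def numVertices : ℕ := if IsEmpty m.Dart then 1 else Nat.card m.Vertex

/-- The number of edges. -/
noncomputable def numEdges : ℕ := Nat.card m.Edge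

open Classical in
/-- The number of faces; by convention the empty map has one face. -/
noncomputable def numFaces : ℕ := if IsEmpty m.Dart then 1 else Nat.card m.Face

/-- The map has genus `g`: Euler's formula `v - e + f = 2 (1 - g)`. -/
def HasGenus (g : ℤ) : Prop :=
  (m.numVertices : ℤ) - m.numEdges + m.numFaces = 2 * (1 - g)

end CombMap

/-- A sequenced rooted face-bipartite map: a map, a root dart (present unless the map is empty),
a colouring of the faces (`true` is white, `false` is black) in which the two sides of every edge
have opposite colours and the root lies in a white face, and a list of distinct
distinguished vertices other than the root vertex. -/
structure SeqMap extends CombMap where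
  root : Option Dart
  root_isSome : Nonempty Dart → root.isSome
  isWhite : toCombMap.Face → Bool
  isWhite_edge : ∀ d : Dart, isWhite (toCombMap.face (L d)) ≠ isWhite (toCombMap.face d)
  isWhite_root : ∀ r ∈ root, isWhite (toCombMap.face r) = true
  marked : List toCombMap.Vertex
  marked_nodup : marked.Nodup
  root_notMem_marked : ∀ r ∈ root, toCombMap.vertex r ∉ marked

namespace SeqMap

variable (m m' m'' : SeqMap)

/-- The degree of the root vertex; it is `0` for the empty map. -/
noncomputable def rootDegree : ℕ := (m.root.map fun r => m.degree (m.vertex r)).getD 0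

open Classical in
/-- The number of white faces; by convention the only face of the empty map is white. -/
noncomputable def numWhite : ℕ :=
  if IsEmpty m.Dart then 1 else Nat.card {f : m.Face // m.isWhite f = true}

/-- The number of black faces. -/
noncomputable def numBlack : ℕ := Nat.card {f : m.Face // m.isWhite f = false}

/-- `v'` and `v` are vertices that correspond to each other under a map `ι` of darts. -/
def VertexCorr {m' m : SeqMap} (ι : m'.Dart → m.Dart) (v' : m'.Vertex) (v : m.Vertex) : Prop :=
  ∃ d, m'.vertex d = v' ∧ m.vertex (ι d) = v

/-- `φ` is an isomorphism: it preserves `R`, `L`, the root, the colours and the sequence of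
distinguished vertices. -/
structure IsIso (φ : m.Dart ≃ m'.Dart) : Prop where
  map_R : ∀ d, φ (m.R d) = m'.R (φ d)
  map_L : ∀ d, φ (m.L d) = m'.L (φ d)
  map_root : m.root.map φ = m'.root
  map_isWhite : ∀ d, m'.isWhite (m'.face (φ d)) = m.isWhite (m.face d)
  map_marked : List.Forall₂ (VertexCorr φ) m.marked m'.marked

variable {m m' m''}

lemma IsIso.vertex_eq {φ : m.Dart ≃ m'.Dart} (h : IsIso m m' φ) {a b : m.Dart}
    (hab : m.vertex a = m.vertex b) : m'.vertex (φ a) = m'.vertex (φ b) := by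
  obtain ⟨k, hk⟩ : m.R.SameCycle a b := Quotient.exact hab
  refine Quotient.sound (s := Equiv.Perm.SameCycle.setoid m'.R) ⟨k, ?_⟩
  have hR : m'.R = φ.permCongr m.R := by
    ext x
    obtain ⟨y, rfl⟩ := φ.surjective x
    simp [h.map_R]
  have : m'.R ^ k = φ.permCongr (m.R ^ k) := by
    rw [hR]
    exact (map_zpow φ.permCongrHom m.R k).symm
  rw [this]
  simp [hk]

lemma IsIso.refl (m : SeqMap) : IsIso m m (Equiv.refl _) where
  map_R _ := rfl
  map_L _ := rfl
  map_root := by simp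
  map_isWhite _ := rfl
  map_marked := List.forall₂_same.2 fun v _ => by
    obtain ⟨d, hd⟩ := Quotient.exists_rep v
    exact ⟨d, hd, hd⟩

lemma IsIso.symm {φ : m.Dart ≃ m'.Dart} (h : IsIso m m' φ) : IsIso m' m φ.symm where
  map_R d := by rw [Equiv.symm_apply_eq, h.map_R, Equiv.apply_symm_apply]
  map_L d := by rw [Equiv.symm_apply_eq, h.map_L, Equiv.apply_symm_apply]
  map_root := by rw [← h.map_root]; cases m.root <;> simp
  map_isWhite d := by rw [← h.map_isWhite, Equiv.apply_symm_apply]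
  map_marked := by
    refine List.Forall₂.flip (h.map_marked.imp ?_)
    rintro v v' ⟨d, h1, h2⟩
    exact ⟨φ d, h2, by simpa using h1⟩

lemma IsIso.trans {φ : m.Dart ≃ m'.Dart} {ψ : m'.Dart ≃ m''.Dart} (h : IsIso m m' φ)
    (h' : IsIso m' m'' ψ) : IsIso m m'' (φ.trans ψ) where
  map_R d := by simp [h.map_R, h'.map_R]
  map_L d := by simp [h.map_L, h'.map_L]
  map_root := by rw [← h'.map_root, ← h.map_root]; cases m.root <;> simp
  map_isWhite d := by simp [h.map_isWhite, h'.map_isWhite]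
  map_marked := by
    have key : ∀ {l₁ : List m.Vertex} {l₂ : List m'.Vertex} {l₃ : List m''.Vertex},
        List.Forall₂ (VertexCorr φ) l₁ l₂ → List.Forall₂ (VertexCorr ψ) l₂ l₃ →
        List.Forall₂ (VertexCorr (φ.trans ψ)) l₁ l₃ := by
      intro l₁ l₂ l₃ h12
      induction h12 generalizing l₃ with
      | nil => intro h23; cases h23; exact .nil
      | cons hv _ ih =>
        intro h23
        cases h23 with
        | cons hv' ht' =>
          refine .cons ?_ (ih ht')
          obtain ⟨d, rfl, h2⟩ := hv
          obtain ⟨d', h3, rfl⟩ := hv'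
          exact ⟨d, rfl, h'.vertex_eq (h2.trans h3.symm)⟩
    exact key h.map_marked h'.map_marked

/-- Isomorphism of sequenced rooted face-bipartite maps. -/
instance setoid : Setoid SeqMap where
  r m m' := ∃ φ : m.Dart ≃ m'.Dart, IsIso m m' φ
  iseqv :=
    { refl := fun m => ⟨_, IsIso.refl m⟩
      symm := fun ⟨_, h⟩ => ⟨_, h.symm⟩
      trans := fun ⟨_, h⟩ ⟨_, h'⟩ => ⟨_, h.trans h'⟩ }

/-- The empty map. -/
def emptyMap : SeqMap where
  Dart := Empty
  finite_dart := inferInstance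
  R := 1
  L := 1
  L_invol := nofun
  L_ne := nofun
  transitive := nofun
  root := none
  root_isSome := fun ⟨d⟩ => d.elim
  isWhite := fun _ => true
  isWhite_edge := nofun
  isWhite_root := nofun
  marked := []
  marked_nodup := List.nodup_nil
  root_notMem_marked := nofun

end SeqMap

/-- The map `m` has genus `g`, `e` edges, `w` white faces, `b` black faces, root vertex of
degree `2 n`, and `D` is its list of half-degrees of the distinguished vertices. -/
def HasParams (g e w b n : ℤ) (D : List ℕ) (m : SeqMap) : Prop :=
  m.HasGenus g ∧ (m.numEdges : ℤ) = e ∧ (m.numWhite : ℤ) = w ∧ (m.numBlack : ℤ) = b ∧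
    (m.rootDegree : ℤ) = 2 * n ∧ m.marked.map m.degree = D.map (2 * ·)

/-- The set `F(g, e, w, b, n, D)` of sequenced face-bipartite maps, up to isomorphism. The
arguments are integers, so that nothing is truncated; the set is empty when one of them is
not the parameter of any map. -/
def F (g e w b n : ℤ) (D : List ℕ) : Type 1 :=
  Quotient (SeqMap.setoid.comap (Subtype.val : {m // HasParams g e w b n D m} → SeqMap))

/-- `m` is a representative of the isomorphism class `x`. -/
def Represents {g e w b n : ℤ} {D : List ℕ} (m : SeqMap) (x : F g e w b n D) : Prop :=
  ∃ h : HasParams g e w b n D m, x = Quotient.mk _ ⟨m, h⟩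

/-- The sublist of `l` formed by the entries whose position (counted from `0`) is in `S`. -/
def pick {α : Type*} (S : Finset ℕ) (l : List α) : List α :=
  (l.zipIdx.filter fun a => a.2 ∈ S).map Prod.fst

/-- The indices of the sum over pairs of maps. Sublists of `D` are taken by position. -/
structure SplitIndex (g e w b n : ℕ) (D : List ℕ) where
  (g₁ g₂ e₁ e₂ w₁ w₂ b₁ b₂ n₁ n₂ : ℕ)
  S : Finset ℕ
  g_eq : g₁ + g₂ = g
  e_eq : (e₁ + e₂ : ℤ) = e - 1
  b_eq : w₁ + b₂ = b
  w_eq : w₂ + b₁ = w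
  n_eq : (n₁ + n₂ : ℤ) = n - 1
  S_subset : S ⊆ Finset.range D.length

namespace SplitIndex

variable {g e w b n : ℕ} {D : List ℕ} (i : SplitIndex g e w b n D)

/-- The sublist `D₁` of `D`. -/
def D₁ : List ℕ := pick i.S D

/-- The complementary sublist `D - D₁`. -/
def D₂ : List ℕ := pick (Finset.range D.length \ i.S) D

end SplitIndex

/-- The set that contains only the empty map if `P` holds, and is empty otherwise. -/
def Delta (P : Prop) : Type 1 := {m : SeqMap // m = SeqMap.emptyMap ∧ P}

open Classical in
/-- The map `m'` is embedded by `ι` in what is left of `m` when the edge `{r, L r}` is removed by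
deleting `r` and `L r` from the cycles of `L` and of `R * L`. (This splits the vertex containing
`r` and `L r` if the edge is a loop, and contracts the edge if it is a link.) All colours are
exchanged if `swap` is `true`, and kept if it is `false`. -/
structure EmbedsInRemoval (m m' : SeqMap) (r : m.Dart) (ι : m'.Dart → m.Dart) (swap : Bool) :
    Prop where
  injective : Function.Injective ι
  map_L : ∀ d, ι (m'.L d) = m.L (ι d)
  map_R : ∀ d, ι (m'.R d) =
    if m.R (ι d) = r ∨ m.R (ι d) = m.L r then m.R (m.L (m.R (ι d))) else m.R (ι d)
  map_isWhite : ∀ d, m'.isWhite (m'.face d) = xor swap (m.isWhite (m.face (ι d)))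

/-- The edge of `r` is a loop. -/
def IsLoop (m : SeqMap) (r : m.Dart) : Prop := m.vertex r = m.vertex (m.L r)

open Classical in
/-- The root edge of `m` is a loop whose removal, splitting the root vertex, disconnects `m` into
`m₁` and `m₂`, rooted at `R r` and `R (L r)` (or empty), where `r` is the root of `m`. The colours
of `m₁` are exchanged. The distinguished vertices in `m₁` are those with position in `S`. -/
def LoopSplits (m m₁ m₂ : SeqMap) (S : Finset ℕ) : Prop :=
  ∃ r ∈ m.root, IsLoop m r ∧ ∃ (ι₁ : m₁.Dart → m.Dart) (ι₂ : m₂.Dart → m.Dart),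
    EmbedsInRemoval m m₁ r ι₁ true ∧ EmbedsInRemoval m m₂ r ι₂ false ∧
    Disjoint (Set.range ι₁) (Set.range ι₂) ∧
    Set.range ι₁ ∪ Set.range ι₂ = {r, m.L r}ᶜ ∧
    m₁.root.map ι₁ = (if m.R r = m.L r then none else some (m.R r)) ∧
    m₂.root.map ι₂ = (if m.R (m.L r) = r then none else some (m.R (m.L r))) ∧
    List.Forall₂ (SeqMap.VertexCorr ι₁) m₁.marked (pick S m.marked) ∧
    List.Forall₂ (SeqMap.VertexCorr ι₂) m₂.marked
      (pick (Finset.range m.marked.length \ S) m.marked)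

/-- The root edge of `m` is a loop whose removal, splitting the root vertex, gives the connected
map `m'`, rooted at `R r`, with all colours exchanged. The vertex containing `R (L r)`
is put in front of the sequence of distinguished vertices. -/
def LoopReduces (m m' : SeqMap) : Prop :=
  ∃ r ∈ m.root, IsLoop m r ∧ ∃ ι : m'.Dart → m.Dart,
    EmbedsInRemoval m m' r ι true ∧ Set.range ι = {r, m.L r}ᶜ ∧
    m'.root.map ι = some (m.R r) ∧
    ∃ s l, m'.marked = s :: l ∧ (∃ d, m'.vertex d = s ∧ ι d = m.R (m.L r)) ∧
      List.Forall₂ (SeqMap.VertexCorr ι) l m.marked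

/-- The root edge of `m` is a link, and contracting it gives the map `m'`, rooted at `R r`, with
all colours exchanged and with the distinguished vertices of `m` that are in the list `l`. -/
def LinkReduces (m m' : SeqMap) (l : List m.Vertex) : Prop :=
  ∃ r ∈ m.root, ¬ IsLoop m r ∧ ∃ ι : m'.Dart → m.Dart,
    EmbedsInRemoval m m' r ι true ∧ Set.range ι = {r, m.L r}ᶜ ∧
    m'.root.map ι = some (m.R r) ∧
    List.Forall₂ (SeqMap.VertexCorr ι) m'.marked l

/-- The vertex at the far end of the root edge of `m` is `v`. -/
def IsFarEnd (m : SeqMap) (v : m.Vertex) : Prop := ∃ r ∈ m.root, m.vertex (m.L r) = v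

end FaceBipartite

open FaceBipartite

/-! Everything rests on one local operation. Deleting the darts `r` and `L r` of the root edge from
the cycles of `L` and `R * L` leaves a coloured structure that may be disconnected (`PreMap`), with
two optional darts: `a`, the dart `R r` unless this is `L r`, and `b`, the dart `R (L r)` unless
this is `r`. Conversely, these data give back the map. The predicate `Ins` expresses this relation;
`exists_removal` and `exists_ins` provide the two directions, and `Ins.source_unique` and
`Ins.target_unique` show that neither loses information.

Faces only get longer by an insertion (`Ins.face_iff`), except that an absent `a` or `b` produces a
face of degree one, which accounts for the conventional face of an empty part. Vertices that contain
neither `a` nor `b` do not change (`Ins.freeAt_iff`). If `a` and `b` lie in one cycle of `R`, that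
cycle is cut in two and the new edge is a link (`Ins.link`); otherwise their cycles are merged and
it is a loop (`Ins.loop`). Colours alternate around a vertex, so `a` is black and `b` is white in
the big map: a part rooted at `a` must exchange colours, a part rooted at `b` keeps them.

This gives the cases of `exists_decomposition`. If `b` cannot be reached from `a`, there are two
components (`Glues`). If it can be reached but lies at another vertex, that vertex becomes the first
distinguished one (`Splits`); in the inverse direction `b` is any of its `p` black darts, whence the
factor `{1, …, p}`. The factor makes sense on isomorphism classes because rooted maps have no
automorphisms (`SeqMap.IsIso.eq_id`). If `a` and `b` share a vertex, the edge is contracted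
(`Contracts`), and `b` is the dart `2 n - 1` steps after `a` (`Contracts.eq_pow`), so that no choice
is left once the root degree is given.

The parameters follow by counting darts, vertices and coloured faces. That the two parts of a
separating loop have natural numbers as genera is proved by induction on the number of edges
(`exists_genus`). The bijection comes from the relation `Removes` between classes and elements of
the disjoint union, which is total and single-valued in both directions. -/

namespace FaceBipartite
open Equiv

/-! ### Cycles of permutations and counting of their classes -/

section Cycles

variable {α β γ : Type*}

lemma sameCycle_invariant {P : Perm α} {g : α → γ} (h : ∀ x, g (P x) = g x) {x y : α}
    (hxy : P.SameCycle x y) : g x = g y := by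
  have h' : ∀ x, g (P⁻¹ x) = g x := fun x => by rw [← h (P⁻¹ x)]; simp
  obtain ⟨k, rfl⟩ := hxy
  induction k generalizing x with
  | zero => simp
  | succ i ih => rw [zpow_add_one, Perm.mul_apply, ← ih, h]
  | pred i ih => rw [zpow_sub_one, Perm.mul_apply, ← ih, h']

lemma sameCycle_map {P : Perm α} {Q : Perm β} {f : α → β}
    (h : ∀ x, Q.SameCycle (f x) (f (P x))) {x y : α} (hxy : P.SameCycle x y) :
    Q.SameCycle (f x) (f y) :=
  Quotient.exact (sameCycle_invariant (P := P)
    (g := fun x => Quotient.mk (Perm.SameCycle.setoid Q) (f x))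
    (fun x => Quotient.sound (h x).symm) hxy)

/-- The function that sends a left element to its `P`-cycle and a right element to `none` is
constant along the steps of the sum. -/
lemma sameCycle_sumCongr_inl {P : Perm α} {Q : Perm β} {x y : α} :
    (Perm.sumCongr P Q).SameCycle (.inl x) (.inl y) ↔ P.SameCycle x y := by
  constructor
  · intro h
    have := sameCycle_invariant (P := Perm.sumCongr P Q)
      (g := Sum.elim (fun x => some (Quotient.mk (Perm.SameCycle.setoid P) x)) fun _ => none)
      (by
        rintro (x | x)
        · simpa using Quotient.sound (s := Perm.SameCycle.setoid P)
            (Perm.sameCycle_apply_left.2 (Perm.SameCycle.refl P x))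
        · simp) h
    exact Quotient.exact (Option.some.inj this)
  · exact sameCycle_map fun x => ⟨1, by simp⟩

lemma sameCycle_sumCongr_inr {P : Perm α} {Q : Perm β} {x y : β} :
    (Perm.sumCongr P Q).SameCycle (.inr x) (.inr y) ↔ Q.SameCycle x y := by
  constructor
  · intro h
    have := sameCycle_invariant (P := Perm.sumCongr P Q)
      (g := Sum.elim (fun _ => none) (fun x => some (Quotient.mk (Perm.SameCycle.setoid Q) x)))
      (by
        rintro (x | x)
        · simp
        · simpa using Quotient.sound (s := Perm.SameCycle.setoid Q)
            (Perm.sameCycle_apply_left.2 (Perm.SameCycle.refl Q x))) h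
    exact Quotient.exact (Option.some.inj this)
  · exact sameCycle_map fun x => ⟨1, by simp⟩

lemma not_sameCycle_sumCongr {P : Perm α} {Q : Perm β} {x : α} {y : β} :
    ¬ (Perm.sumCongr P Q).SameCycle (.inl x) (.inr y) := by
  intro h
  have := sameCycle_invariant (P := Perm.sumCongr P Q) (g := Sum.isLeft)
    (by rintro (x | x) <;> simp) h
  simp at this

/-- The cycle of `x` under `P`. -/
def orb (P : Perm α) (x : α) : Set α := {y | P.SameCycle x y}

lemma mem_orb {P : Perm α} {x y : α} : y ∈ orb P x ↔ P.SameCycle x y := Iff.rfl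

lemma ncard_orb [Finite α] (P : Perm α) (x : α) :
    (orb P x).ncard = Function.minimalPeriod P x := by
  classical
  have := Fintype.ofFinite α
  have h := MulAction.minimalPeriod_eq_card P x
  rw [← Nat.card_eq_fintype_card] at h
  have h' : orb P x = MulAction.orbit (Subgroup.zpowers P) x := by
    ext y
    rw [MulAction.mem_orbit_iff]
    constructor
    · rintro ⟨k, rfl⟩
      exact ⟨⟨P ^ k, k, rfl⟩, rfl⟩
    · rintro ⟨⟨_, k, rfl⟩, rfl⟩
      exact ⟨k, rfl⟩
  rw [h', ← Nat.card_coe_set_eq, ← h]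
  rfl

lemma ncard_orb_pos [Finite α] (P : Perm α) (x : α) : 0 < (orb P x).ncard :=
  (Set.ncard_pos (Set.toFinite _)).2 ⟨x, Perm.SameCycle.refl P x⟩

lemma pow_injOn [Finite α] {P : Perm α} {x : α} {i j : ℕ} (hi : i < (orb P x).ncard)
    (hj : j < (orb P x).ncard) (h : (P ^ i) x = (P ^ j) x) : i = j := by
  rw [ncard_orb] at hi hj
  refine Function.iterate_injOn_Iio_minimalPeriod (f := P) (x := x) hi hj ?_
  simpa [Perm.iterate_eq_pow] using h

lemma ncard_orb_eq_of_pow [Finite α] {P : Perm α} {x : α} {k : ℕ} (hk : 0 < k)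
    (h : (P ^ k) x = x) (h' : ∀ i, 0 < i → i < k → (P ^ i) x ≠ x) : (orb P x).ncard = k := by
  rw [ncard_orb]
  have hp : Function.IsPeriodicPt P k x := by
    rw [Function.IsPeriodicPt, Function.IsFixedPt, Perm.iterate_eq_pow, h]
  refine le_antisymm (hp.minimalPeriod_le hk) (not_lt.1 fun hlt => ?_)
  refine h' _ (hp.minimalPeriod_pos hk) hlt ?_
  rw [← Perm.iterate_eq_pow, Function.iterate_minimalPeriod]

lemma pow_ncard_orb [Finite α] {P : Perm α} {x : α} : (P ^ (orb P x).ncard) x = x := by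
  rw [ncard_orb, ← Perm.iterate_eq_pow, Function.iterate_minimalPeriod]

/-- A colour that changes at each step of a permutation. -/
lemma col_pow {P : Perm α} {c : α → Bool} (h : ∀ x, c (P x) = !c x) (k : ℕ) (x : α) :
    c ((P ^ k) x) = (c x ^^ decide (Odd k)) := by
  induction k with
  | zero => simp
  | succ k ih =>
    rw [pow_succ', Perm.mul_apply, h, ih]
    by_cases hk : Odd k <;> simp [hk, Nat.odd_add_one]

lemma even_ncard_orb [Finite α] {P : Perm α} {c : α → Bool} (h : ∀ x, c (P x) = !c x) (x : α) :
    Even (orb P x).ncard := by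
  have := col_pow h (orb P x).ncard x
  rw [pow_ncard_orb] at this
  rw [← Nat.not_odd_iff_even]
  intro ho
  simp [ho] at this

/-- `P` itself exchanges the two colour classes of a cycle. This is why a vertex of degree `2 p`
offers `p` black darts. -/
lemma ncard_orb_col [Finite α] {P : Perm α} {c : α → Bool} (h : ∀ x, c (P x) = !c x) (x : α)
    (e : Bool) : 2 * {y | P.SameCycle x y ∧ c y = e}.ncard = (orb P x).ncard := by
  have h1 : P '' {y | P.SameCycle x y ∧ c y = e} = {y | P.SameCycle x y ∧ c y = !e} := by
    ext z
    obtain ⟨y, rfl⟩ := P.surjective z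
    simp [h, Perm.sameCycle_apply_right]
  have h2 : orb P x = {y | P.SameCycle x y ∧ c y = e} ∪ {y | P.SameCycle x y ∧ c y = !e} := by
    ext z
    simp only [mem_orb, Set.mem_union, Set.mem_ofPred_eq]
    cases c z <;> cases e <;> simp
  rw [h2, Set.ncard_union_eq _ (Set.toFinite _) (Set.toFinite _), ← h1,
    Set.ncard_image_of_injective _ P.injective, two_mul]
  rw [Set.disjoint_left]
  rintro z ⟨_, hz⟩ ⟨_, hz'⟩
  rw [hz] at hz'
  cases e <;> simp at hz'

/-- By finiteness `P⁻¹ x` is reached from `x` by a non-negative power of `P`. -/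
lemma closed_inv [Finite α] {P : Perm α} {p : α → Prop} (h : ∀ x, p x → p (P x)) {x : α}
    (hx : p x) : p (P⁻¹ x) := by
  obtain ⟨k, hk⟩ := Perm.SameCycle.exists_nat_pow_eq
    (show P.SameCycle x (P⁻¹ x) from ⟨-1, by simp⟩)
  rw [← hk]
  clear hk
  induction k with
  | zero => exact hx
  | succ k ih => rw [pow_succ', Perm.mul_apply]; exact h _ ih

lemma closed_closure [Finite α] {R L : Perm α} {p : α → Prop} (hR : ∀ x, p x → p (R x))
    (hL : ∀ x, p x → p (L x)) {σ : Perm α} (hσ : σ ∈ Subgroup.closure {R, L}) {x : α}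
    (hx : p x) : p (σ x) := by
  induction hσ using Subgroup.closure_induction_left generalizing x with
  | one => exact hx
  | mul_left τ hτ σ _ ih =>
    rcases hτ with rfl | rfl
    · exact hR _ (ih hx)
    · exact hL _ (ih hx)
  | inv_mul_cancel τ hτ σ _ ih =>
    rcases hτ with rfl | rfl
    · exact closed_inv hR (ih hx)
    · exact closed_inv hL (ih hx)

/-- Counting classes along a map of permuted sets. -/
lemma card_classes_congr {Q : Perm α} {P : Perm β} (ι : β → α)
    (p : Quotient (Perm.SameCycle.setoid Q) → Prop)
    (p' : Quotient (Perm.SameCycle.setoid P) → Prop)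
    (hι : ∀ y z, p' (Quotient.mk _ y) → p' (Quotient.mk _ z) →
      (P.SameCycle y z ↔ Q.SameCycle (ι y) (ι z)))
    (hp : ∀ y, p' (Quotient.mk _ y) → p (Quotient.mk _ (ι y)))
    (cover : ∀ x, p (Quotient.mk _ x) → ∃ y, Q.SameCycle x (ι y) ∧ p' (Quotient.mk _ y)) :
    Nat.card {q // p q} = Nat.card {q // p' q} := by
  symm
  have key : ∀ q : {q // p' q}, ∃ x : {q // p q}, ∃ y, Quotient.mk _ y = q.1 ∧
      Quotient.mk _ (ι y) = x.1 := by
    rintro ⟨q, hq⟩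
    obtain ⟨y, rfl⟩ := Quotient.exists_rep q
    exact ⟨⟨_, hp y hq⟩, y, rfl, rfl⟩
  choose f hf using key
  refine Nat.card_congr (Equiv.ofBijective f ⟨?_, ?_⟩)
  · intro q q' h
    obtain ⟨y, h1, h2⟩ := hf q
    obtain ⟨y', h1', h2'⟩ := hf q'
    rw [← h, ← h2] at h2'
    apply Subtype.ext
    rw [← h1, ← h1']
    exact Quotient.sound ((hι y y' (h1 ▸ q.2) (h1' ▸ q'.2)).2 (Quotient.exact h2'.symm))
  · rintro ⟨x, hx⟩
    obtain ⟨x, rfl⟩ := Quotient.exists_rep x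
    obtain ⟨y, hy, hy'⟩ := cover x hx
    refine ⟨⟨_, hy'⟩, Subtype.ext ?_⟩
    obtain ⟨z, hz, hz'⟩ := hf ⟨_, hy'⟩
    rw [← hz']
    refine Quotient.sound (Perm.SameCycle.trans ?_ hy.symm)
    exact (hι z y (hz ▸ hy') hy').1 (Quotient.exact hz)

/-- No cycle meets both summands, so the classes fall into those with a left and those with a right
representative. The existential predicates avoid a choice of maps between the quotients. -/
lemma card_classes_sum [Finite α] [Finite β] {P : Perm α} {Q : Perm β}
    (p : Quotient (Perm.SameCycle.setoid (Perm.sumCongr P Q)) → Prop) :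
    Nat.card {q // p q} =
      Nat.card {q : Quotient (Perm.SameCycle.setoid P) //
        ∃ x, Quotient.mk _ x = q ∧ p (Quotient.mk _ (.inl x))} +
      Nat.card {q : Quotient (Perm.SameCycle.setoid Q) //
        ∃ x, Quotient.mk _ x = q ∧ p (Quotient.mk _ (.inr x))} := by
  have hl : ∀ {x y}, Quotient.mk (Perm.SameCycle.setoid P) x = Quotient.mk _ y →
      Quotient.mk (Perm.SameCycle.setoid (Perm.sumCongr P Q)) (.inl x) = Quotient.mk _ (.inl y) :=
    fun h => Quotient.sound (sameCycle_sumCongr_inl.2 (Quotient.exact h))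
  have hr : ∀ {x y}, Quotient.mk (Perm.SameCycle.setoid Q) x = Quotient.mk _ y →
      Quotient.mk (Perm.SameCycle.setoid (Perm.sumCongr P Q)) (.inr x) = Quotient.mk _ (.inr y) :=
    fun h => Quotient.sound (sameCycle_sumCongr_inr.2 (Quotient.exact h))
  have h1 : Nat.card {q // p q} = Nat.card {q : {q // p q} // ∃ x, Quotient.mk _ (.inl x) = q.1} +
      Nat.card {q : {q // p q} // ¬ ∃ x, Quotient.mk _ (.inl x) = q.1} := by
    classical
    rw [← Nat.card_sum]
    exact Nat.card_congr (Equiv.sumCompl _).symm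
  rw [h1]
  congr 1
  · rw [Nat.card_congr (Equiv.subtypeSubtypeEquivSubtypeInter p
      (fun q => ∃ x, Quotient.mk _ (.inl x) = q))]
    refine card_classes_congr Sum.inl _ _ (fun y z _ _ => sameCycle_sumCongr_inl.symm) ?_ ?_
    · rintro y ⟨x, hx, h⟩
      exact ⟨hl hx ▸ h, y, rfl⟩
    · rintro x ⟨h, y, hy⟩
      exact ⟨y, (Quotient.exact hy).symm, y, rfl, hy ▸ h⟩
  · rw [Nat.card_congr (Equiv.subtypeSubtypeEquivSubtypeInter p
      (fun q => ¬ ∃ x, Quotient.mk _ (.inl x) = q))]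
    refine card_classes_congr Sum.inr _ _ (fun y z _ _ => sameCycle_sumCongr_inr.symm) ?_ ?_
    · rintro y ⟨x, hx, h⟩
      refine ⟨hr hx ▸ h, ?_⟩
      rintro ⟨z, hz⟩
      exact not_sameCycle_sumCongr (Quotient.exact hz)
    · rintro (x | x) ⟨h, h'⟩
      · exact absurd ⟨x, rfl⟩ h'
      · exact ⟨x, Perm.SameCycle.refl _ _, x, rfl, h⟩

/-- Meant for the two ends of an edge: setting them aside costs one vertex for a loop and two for a
link. -/
lemma card_ne_ne [Finite α] (u v : α) [Decidable (u = v)] :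
    Nat.card α = Nat.card {x // x ≠ u ∧ x ≠ v} + if u = v then 1 else 2 := by
  classical
  have h : Nat.card {x : α // x ≠ u ∧ x ≠ v} = ({u, v}ᶜ : Set α).ncard := by
    rw [← Nat.card_coe_set_eq]
    exact Nat.card_congr (Equiv.subtypeEquivRight fun x => by simp)
  rw [h, ← Set.ncard_add_ncard_compl ({u, v} : Set α), add_comm]
  congr 1
  split_ifs with huv
  · subst huv; simp
  · exact Set.ncard_pair huv

lemma card_ne [Finite α] {p : α → Prop} {u : α} (hu : p u) :
    Nat.card {x // p x} = Nat.card {x // p x ∧ x ≠ u} + 1 := by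
  have h1 : Nat.card {x // p x} = {x | p x}.ncard := Nat.card_coe_set_eq _
  have h2 : Nat.card {x // p x ∧ x ≠ u} = ({x | p x} \ {u}).ncard := Nat.card_coe_set_eq _
  rw [h1, h2, Set.ncard_sdiff_singleton_add_one (by exact hu) (Set.toFinite _)]

end Cycles

/-! ### Complementary sublists by position -/

section Pick

variable {α β : Type*}

/-- The entries of `l` whose position, counted from `k`, is in `S`. -/
def pickFrom (k : ℕ) (S : Finset ℕ) (l : List α) : List α :=
  ((l.zipIdx k).filter fun a => a.2 ∈ S).map Prod.fst

@[simp] lemma pickFrom_nil (k : ℕ) (S : Finset ℕ) : pickFrom k S ([] : List α) = [] := rfl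

lemma pickFrom_cons (k : ℕ) (S : Finset ℕ) (x : α) (l : List α) :
    pickFrom k S (x :: l) = if k ∈ S then x :: pickFrom (k + 1) S l else pickFrom (k + 1) S l := by
  by_cases h : k ∈ S <;> simp [pickFrom, List.zipIdx_cons, h]

lemma map_pickFrom (f : α → β) (k : ℕ) (S : Finset ℕ) (l : List α) :
    (pickFrom k S l).map f = pickFrom k S (l.map f) := by
  induction l generalizing k with
  | nil => rfl
  | cons x l ih => simp only [List.map_cons, pickFrom_cons]; split_ifs <;> simp [ih]

lemma map_pick (f : α → β) (S : Finset ℕ) (l : List α) :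
    (pick S l).map f = pick S (l.map f) := map_pickFrom f 0 S l

lemma mem_pick {S : Finset ℕ} {l : List α} {x : α} :
    x ∈ pick S l ↔ ∃ i ∈ S, l[i]? = some x := by
  simp only [pick, List.mem_map, List.mem_filter, List.mem_zipIdx_iff_getElem?, decide_eq_true_eq]
  constructor
  · rintro ⟨⟨a, i⟩, ⟨h, hi⟩, rfl⟩
    exact ⟨i, hi, h⟩
  · rintro ⟨i, hi, h⟩
    exact ⟨(x, i), ⟨h, hi⟩, rfl⟩

/-- The sets `S` and `T` stay fixed while the starting position `k` moves, so they are required to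
be complementary only on the positions from `k` up to `N`; this makes the induction go through. -/
lemma pickFrom_perm {S T : Finset ℕ} {k N : ℕ} {l : List α} (hl : k + l.length = N)
    (hT : ∀ i, k ≤ i → i < N → (i ∈ T ↔ i ∉ S)) :
    (pickFrom k S l ++ pickFrom k T l).Perm l := by
  induction l generalizing k with
  | nil => simp
  | cons x l ih =>
    have ih := ih (k := k + 1) (by simp at hl; omega) fun i h => hT i (by omega)
    have hk := hT k le_rfl (by simp at hl; omega)
    by_cases h : k ∈ S
    · simpa [pickFrom_cons, h, hk] using ih
    · simp only [pickFrom_cons, h, hk.2 h, if_true, if_false]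
      exact List.perm_middle.trans (ih.cons x)

lemma pick_perm {S : Finset ℕ} {l : List α} :
    (pick S l ++ pick (Finset.range l.length \ S) l).Perm l :=
  pickFrom_perm (N := l.length) (by simp) fun i _ h => by simp [h]

lemma forall₂_of_pickFrom {rel : α → β → Prop} {S T : Finset ℕ} {k N : ℕ} {l : List α}
    {l' : List β} (hl : k + l.length = N) (hl' : k + l'.length = N)
    (hT : ∀ i, k ≤ i → i < N → (i ∈ T ↔ i ∉ S))
    (hS : List.Forall₂ rel (pickFrom k S l) (pickFrom k S l'))
    (hT' : List.Forall₂ rel (pickFrom k T l) (pickFrom k T l')) : List.Forall₂ rel l l' := by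
  induction l generalizing k l' with
  | nil =>
    have : l' = [] := List.eq_nil_of_length_eq_zero (by simp at hl; omega)
    subst this; exact .nil
  | cons x l ih =>
    cases l' with
    | nil => simp at hl hl'; omega
    | cons x' l' =>
      have ih := @ih (k + 1) l' (by simp at hl; omega) (by simp at hl'; omega)
        fun i h => hT i (by omega)
      have hk := hT k le_rfl (by simp at hl; omega)
      by_cases h : k ∈ S
      · simp only [pickFrom_cons, h, if_true, hk, not_true, if_false] at hS hT'
        rw [List.forall₂_cons] at hS
        exact .cons hS.1 (ih hS.2 hT')
      · simp only [pickFrom_cons, h, if_false, hk.2 h, if_true] at hS hT'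
        rw [List.forall₂_cons] at hT'
        exact .cons hT'.1 (ih hS hT'.2)

lemma forall₂_of_pick {rel : α → β → Prop} {S : Finset ℕ} {l : List α} {l' : List β}
    (hl : l.length = l'.length) (hS : List.Forall₂ rel (pick S l) (pick S l'))
    (hT : List.Forall₂ rel (pick (Finset.range l.length \ S) l)
      (pick (Finset.range l'.length \ S) l')) : List.Forall₂ rel l l' :=
  forall₂_of_pickFrom (N := l.length) (T := Finset.range l.length \ S) (by omega) (by omega) (fun i _ h => by simp [h]) hS
    (by rw [← hl] at hT; exact hT)

/-- Two lists can be interleaved along a prescribed pattern. The list `D` only provides the shape of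
the result. -/
lemma exists_pickFrom {S T : Finset ℕ} {k N : ℕ} {D : List β} (hD : k + D.length = N)
    (hT : ∀ i, k ≤ i → i < N → (i ∈ T ↔ i ∉ S)) {l₁ l₂ : List α}
    (h₁ : l₁.length = (pickFrom k S D).length) (h₂ : l₂.length = (pickFrom k T D).length) :
    ∃ l : List α, l.length = D.length ∧ pickFrom k S l = l₁ ∧ pickFrom k T l = l₂ := by
  induction D generalizing k l₁ l₂ with
  | nil =>
    rw [pickFrom_nil] at h₁ h₂
    exact ⟨[], rfl, (List.eq_nil_of_length_eq_zero h₁).symm, (List.eq_nil_of_length_eq_zero h₂).symm⟩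
  | cons d D ih =>
    have ih := @ih (k + 1) (by simp at hD; omega) fun i h => hT i (by omega)
    have hk := hT k le_rfl (by simp at hD; omega)
    by_cases h : k ∈ S
    · simp only [pickFrom_cons, h, if_true, hk, not_true, if_false] at h₁ h₂
      cases l₁ with
      | nil => simp at h₁
      | cons x l₁ =>
        obtain ⟨l, hl, h1, h2⟩ := ih (by simpa using h₁) h₂
        exact ⟨x :: l, by simp [hl], by simp [pickFrom_cons, h, h1],
          by simp [pickFrom_cons, hk, h, h2]⟩
    · simp only [pickFrom_cons, h, if_false, hk.2 h, if_true] at h₁ h₂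
      cases l₂ with
      | nil => simp at h₂
      | cons x l₂ =>
        obtain ⟨l, hl, h1, h2⟩ := ih h₁ (by simpa using h₂)
        exact ⟨x :: l, by simp [hl], by simp [pickFrom_cons, h, h1],
          by simp [pickFrom_cons, hk, h, h2]⟩

lemma exists_pick {S : Finset ℕ} {D : List β} {l₁ l₂ : List α}
    (h₁ : l₁.length = (pick S D).length)
    (h₂ : l₂.length = (pick (Finset.range D.length \ S) D).length) :
    ∃ l : List α, l.length = D.length ∧ pick S l = l₁ ∧
      pick (Finset.range l.length \ S) l = l₂ := by
  obtain ⟨l, hl, h⟩ := exists_pickFrom (S := S) (T := Finset.range D.length \ S)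
    (N := D.length) (k := 0) (D := D) (by simp) (fun i _ h => by simp [h]) h₁ h₂
  refine ⟨l, hl, ?_⟩
  rw [hl]
  exact h

lemma exists_forall₂ {rel : α → β → Prop} {l : List β} (h : ∀ y ∈ l, ∃ x, rel x y) :
    ∃ l', List.Forall₂ rel l' l := by
  induction l with
  | nil => exact ⟨[], .nil⟩
  | cons y l ih =>
    obtain ⟨x, hx⟩ := h y (by simp)
    obtain ⟨l', hl'⟩ := ih fun y hy => h y (by simp [hy])
    exact ⟨x :: l', .cons hx hl'⟩

lemma forall₂_trans {γ : Type*} {rel : α → β → Prop} {rel' : β → γ → Prop} {rel'' : α → γ → Prop}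
    (h : ∀ a b c, rel a b → rel' b c → rel'' a c) {l₁ : List α} {l₂ : List β} {l₃ : List γ}
    (h₁ : List.Forall₂ rel l₁ l₂) (h₂ : List.Forall₂ rel' l₂ l₃) : List.Forall₂ rel'' l₁ l₃ := by
  induction h₁ generalizing l₃ with
  | nil => cases h₂; exact .nil
  | cons hx _ ih =>
    cases h₂ with
    | cons hy ht => exact .cons (h _ _ _ hx hy) (ih ht)

lemma forall₂_exists_left {rel : α → β → Prop} {l : List α} {l' : List β}
    (h : List.Forall₂ rel l l') {y : β} (hy : y ∈ l') : ∃ x ∈ l, rel x y := by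
  induction h with
  | nil => simp at hy
  | cons hx _ ih =>
    rcases List.mem_cons.1 hy with rfl | hy
    · exact ⟨_, by simp, hx⟩
    · obtain ⟨x, hx, h⟩ := ih hy
      exact ⟨x, by simp [hx], h⟩

lemma forall₂_exists_right {rel : α → β → Prop} {l : List α} {l' : List β}
    (h : List.Forall₂ rel l l') {x : α} (hx : x ∈ l) : ∃ y ∈ l', rel x y :=
  forall₂_exists_left (rel := fun y x => rel x y) h.flip hx

end Pick

end FaceBipartite

/-! ### Colours of darts, insertion of an edge and its effect on faces -/

namespace FaceBipartite
open Equiv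

namespace CombMap

instance (m : CombMap) : Finite m.Dart := m.finite_dart

variable {m : CombMap}

lemma vertex_eq {a b : m.Dart} : m.vertex a = m.vertex b ↔ m.R.SameCycle a b :=
  ⟨fun h => Quotient.exact h, fun h => Quotient.sound h⟩

lemma face_eq {a b : m.Dart} : m.face a = m.face b ↔ (m.R * m.L).SameCycle a b :=
  ⟨fun h => Quotient.exact h, fun h => Quotient.sound h⟩

lemma exists_vertex (v : m.Vertex) : ∃ d, m.vertex d = v := Quotient.exists_rep v

lemma degree_vertex (d : m.Dart) : m.degree (m.vertex d) = (orb m.R d).ncard := by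
  rw [degree, ← Nat.card_coe_set_eq]
  exact Nat.card_congr (Equiv.subtypeEquivRight fun x => by
    rw [vertex_eq, mem_orb, Perm.sameCycle_comm])

/-- A property that holds for one dart and is preserved by `R` and `L` holds for all darts. -/
lemma dart_induction {p : m.Dart → Prop} {x : m.Dart} (hx : p x) (hR : ∀ d, p d → p (m.R d))
    (hL : ∀ d, p d → p (m.L d)) (y : m.Dart) : p y := by
  obtain ⟨σ, hσ, rfl⟩ := m.transitive x y
  exact closed_closure hR hL hσ hx

end CombMap

namespace SeqMap

variable (m : SeqMap)

/-- The colour of the face that contains a dart. -/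
def col (d : m.Dart) : Bool := m.isWhite (m.face d)

lemma col_L (d : m.Dart) : m.col (m.L d) = !m.col d := by
  have := m.isWhite_edge d
  unfold col
  cases h : m.isWhite (m.face (m.L d)) <;> cases h' : m.isWhite (m.face d) <;> simp_all

/-- `R d` is the image of `L d` under `R * L`, so both lie in one face. Colours therefore alternate
around each vertex, which is the source of all parity statements below. -/
lemma col_R (d : m.Dart) : m.col (m.R d) = !m.col d := by
  rw [← m.col_L d]
  have : m.face (m.R d) = m.face (m.L d) := by
    rw [CombMap.face_eq, Perm.sameCycle_comm]
    exact ⟨1, by simp [m.L_invol]⟩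
  simp [col, this]

lemma col_root {r : m.Dart} (hr : m.root = some r) : m.col r = true := m.isWhite_root r hr

lemma col_of_face_eq {d d' : m.Dart} (h : m.face d = m.face d') : m.col d = m.col d' :=
  congrArg m.isWhite h

lemma exists_root [h : Nonempty m.Dart] : ∃ r, m.root = some r :=
  Option.isSome_iff_exists.1 (m.root_isSome h)

lemma isEmpty_of_root (h : m.root = none) : IsEmpty m.Dart := by
  by_contra h'
  have := m.root_isSome (not_isEmpty_iff.1 h')
  simp [h] at this

/-- Each edge has exactly one white dart, and `L` matches white darts with black ones. -/
lemma two_mul_numEdges : 2 * m.numEdges = Nat.card m.Dart := by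
  have h1 : m.numEdges = {d | m.col d = true}.ncard := by
    rw [CombMap.numEdges, ← Nat.card_coe_set_eq]
    refine (Nat.card_congr (Equiv.ofBijective
      (fun d : {d | m.col d = true} => (Quotient.mk _ d.1 : m.Edge)) ⟨?_, ?_⟩)).symm
    · rintro ⟨d, hd⟩ ⟨d', hd'⟩ h
      have h := sameCycle_invariant (P := m.L) (g := fun x => s(x, m.L x))
        (fun x => by rw [m.L_invol, Sym2.eq_swap]) (Quotient.exact h)
      rcases Sym2.eq_iff.1 h with h | h
      · exact Subtype.ext h.1
      · have h1 : d = m.L d' := h.1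
        have hd : m.col d = true := hd
        have hd' : m.col d' = true := hd'
        rw [h1, m.col_L, hd'] at hd
        simp at hd
    · intro q
      obtain ⟨d, rfl⟩ := Quotient.exists_rep q
      cases hd : m.col d with
      | true => exact ⟨⟨d, hd⟩, rfl⟩
      | false =>
        exact ⟨⟨m.L d, by simp [m.col_L, hd]⟩,
          Quotient.sound (s := Perm.SameCycle.setoid m.L)
            (Perm.sameCycle_apply_left.2 (Perm.SameCycle.refl _ _))⟩
  have h2 : m.L '' {d | m.col d = true} = {d | m.col d = true}ᶜ := by
    ext x
    obtain ⟨y, rfl⟩ := m.L.surjective x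
    simp [m.col_L]
  rw [← Set.ncard_add_ncard_compl {d | m.col d = true}, ← h2,
    Set.ncard_image_of_injective _ m.L.injective, ← h1, two_mul]

lemma numEdges_eq_zero : m.numEdges = 0 ↔ IsEmpty m.Dart := by
  have h := m.two_mul_numEdges
  rw [← Finite.card_eq_zero_iff]
  omega

lemma numFaces_eq : m.numFaces = m.numWhite + m.numBlack := by
  unfold CombMap.numFaces numWhite numBlack
  split_ifs with h
  · have : IsEmpty {f : m.Face // m.isWhite f = false} :=
      ⟨fun f => by obtain ⟨d, _⟩ := Quotient.exists_rep f.1; exact h.elim d⟩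
    simp
  · have h1 : Nat.card {f : m.Face // m.isWhite f = true} =
        {f : m.Face | m.isWhite f = true}.ncard := Nat.card_coe_set_eq _
    have h2 : Nat.card {f : m.Face // m.isWhite f = false} =
        {f : m.Face | m.isWhite f = true}ᶜ.ncard := by
      rw [← Nat.card_coe_set_eq]
      exact Nat.card_congr (Equiv.subtypeEquivRight fun f => by simp)
    rw [h1, h2, Set.ncard_add_ncard_compl]

lemma even_degree (v : m.Vertex) : Even (m.degree v) := by
  obtain ⟨d, rfl⟩ := m.exists_vertex v
  rw [CombMap.degree_vertex]
  exact even_ncard_orb m.col_R d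

lemma degree_pos (v : m.Vertex) : 0 < m.degree v := by
  obtain ⟨d, rfl⟩ := m.exists_vertex v
  rw [CombMap.degree_vertex]
  exact ncard_orb_pos _ d

/-- The number of vertices other than the root vertex. -/
noncomputable def numNonRoot : ℕ :=
  Nat.card {v : m.Vertex // ∃ d, m.vertex d = v ∧ ∀ r ∈ m.root, ¬ m.R.SameCycle r d}

/-- The conventional vertex of the empty map plays the role of its root vertex, so later counts need
not treat empty parts separately. -/
lemma numVertices_eq : m.numVertices = m.numNonRoot + 1 := by
  unfold CombMap.numVertices numNonRoot
  split_ifs with h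
  · have : IsEmpty {v : m.Vertex // ∃ d, m.vertex d = v ∧ ∀ r ∈ m.root, ¬ m.R.SameCycle r d} :=
      ⟨fun f => by obtain ⟨d, _⟩ := Quotient.exists_rep f.1; exact h.elim d⟩
    simp
  · rw [not_isEmpty_iff] at h
    obtain ⟨r, hr⟩ := m.exists_root
    have h1 := card_ne (p := fun _ : m.Vertex => True) (u := m.vertex r) trivial
    rw [Nat.card_congr (Equiv.subtypeUnivEquiv fun _ => trivial)] at h1
    rw [h1]
    congr 1
    refine Nat.card_congr (Equiv.subtypeEquivRight fun v => ?_)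
    obtain ⟨d, rfl⟩ := m.exists_vertex v
    simp only [hr, Option.mem_some_iff, forall_eq', true_and]
    constructor
    · exact fun h => ⟨d, rfl, fun h' => h (CombMap.vertex_eq.2 h').symm⟩
    · rintro ⟨d', h, h'⟩ h''
      exact h' (CombMap.vertex_eq.1 (h.trans h'').symm)

end SeqMap

/-- A map that need not be connected, with two-coloured darts instead of faces. -/
structure PreMap where
  Dart : Type
  finite_dart : Finite Dart
  R : Perm Dart
  L : Perm Dart
  col : Dart → Bool
  L_invol : ∀ d, L (L d) = d
  col_R : ∀ d, col (R d) = !col d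
  col_L : ∀ d, col (L d) = !col d

instance (P : PreMap) : Finite P.Dart := P.finite_dart

/-- The map underlying `m`, with colours exchanged if `sw` is `true`. -/
abbrev SeqMap.pre (m : SeqMap) (sw : Bool) : PreMap where
  Dart := m.Dart
  finite_dart := m.finite_dart
  R := m.R
  L := m.L
  col d := xor sw (m.col d)
  L_invol := m.L_invol
  col_R d := by simp [m.col_R]
  col_L d := by simp [m.col_L]

namespace PreMap

/-- The disjoint union of two maps. -/
abbrev sum (P Q : PreMap) : PreMap where
  Dart := P.Dart ⊕ Q.Dart
  finite_dart := inferInstance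
  R := Perm.sumCongr P.R Q.R
  L := Perm.sumCongr P.L Q.L
  col := Sum.elim P.col Q.col
  L_invol := by rintro (d | d) <;> simp [L_invol]
  col_R := by rintro (d | d) <;> simp [col_R]
  col_L := by rintro (d | d) <;> simp [col_L]

/-- The number of faces of colour `x`. -/
noncomputable def numColFaces (P : PreMap) (x : Bool) : ℕ :=
  Nat.card {q : Quotient (Perm.SameCycle.setoid (P.R * P.L)) //
    ∃ y, Quotient.mk _ y = q ∧ P.col y = x}

lemma col_face (P : PreMap) {y z : P.Dart} (h : (P.R * P.L).SameCycle y z) : P.col y = P.col z :=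
  sameCycle_invariant (P := P.R * P.L) (g := P.col) (fun d => by simp [P.col_R, P.col_L]) h

lemma numColFaces_sum (P Q : PreMap) (x : Bool) :
    (P.sum Q).numColFaces x = P.numColFaces x + Q.numColFaces x := by
  have h : (P.sum Q).R * (P.sum Q).L = Perm.sumCongr (P.R * P.L) (Q.R * Q.L) :=
    Perm.sumCongr_mul _ _ _ _
  have hc := @col_face (P.sum Q)
  unfold numColFaces
  rw [h] at hc ⊢
  rw [card_classes_sum]
  congr 1
  · refine Nat.card_congr (Equiv.subtypeEquivRight fun q => exists_congr fun y =>
      and_congr_right fun _ => ⟨?_, fun hy => ⟨_, rfl, hy⟩⟩)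
    rintro ⟨z, hz, h'⟩
    exact (hc (Quotient.exact hz)).symm.trans h'
  · refine Nat.card_congr (Equiv.subtypeEquivRight fun q => exists_congr fun y =>
      and_congr_right fun _ => ⟨?_, fun hy => ⟨_, rfl, hy⟩⟩)
    rintro ⟨z, hz, h'⟩
    exact (hc (Quotient.exact hz)).symm.trans h'

lemma numColFaces_pre (m : SeqMap) (sw x : Bool) :
    (m.pre sw).numColFaces x = Nat.card {f : m.Face // m.isWhite f = xor sw x} := by
  refine Nat.card_congr (Equiv.subtypeEquivRight fun q => ?_)
  obtain ⟨d, rfl⟩ := Quotient.exists_rep q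
  constructor
  · rintro ⟨y, h, h'⟩
    rw [← h]
    change (sw ^^ m.col y) = x at h'
    change m.col y = _
    rw [← h']
    simp
  · intro h
    refine ⟨d, rfl, ?_⟩
    change m.col d = _ at h
    simp [h]

end PreMap

/-- The union of the cycles of the elements of `o`. -/
def orbs {α : Type*} (P : Perm α) (o : Option α) : Set α := {y | ∃ x ∈ o, P.SameCycle x y}

@[simp] lemma orbs_none {α : Type*} (P : Perm α) : orbs P none = ∅ := by simp [orbs]

@[simp] lemma orbs_some {α : Type*} (P : Perm α) (x : α) : orbs P (some x) = orb P x := by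
  simp [orbs, orb]

lemma SeqMap.rootDegree_eq (m : SeqMap) : m.rootDegree = (orbs m.R m.root).ncard := by
  unfold SeqMap.rootDegree
  cases m.root with
  | none => simp
  | some r => simp [CombMap.degree_vertex]

/-- The map `m` arises from `P` by insertion of the edge `{r, L r}`, the dart `r` being put before
`b` and `L r` before `a` in the cycles of `R * L`. -/
structure Ins (m : SeqMap) (P : PreMap) (r : m.Dart) (a b : Option P.Dart)
    (ι : P.Dart → m.Dart) : Prop where
  inj : Function.Injective ι
  ne_r : ∀ y, ι y ≠ r
  ne_s : ∀ y, ι y ≠ m.L r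
  cover : ∀ x, x = r ∨ x = m.L r ∨ ∃ y, ι y = x
  map_L : ∀ y, m.L (ι y) = ι (P.L y)
  col_r : m.col r = true
  map_col : ∀ y, m.col (ι y) = P.col y
  R_r : m.R r = a.elim (m.L r) ι
  R_s : m.R (m.L r) = b.elim r ι
  R_a : ∀ y, a = some (P.R y) → m.R (ι y) = m.L r
  R_b : ∀ y, b = some (P.R y) → m.R (ι y) = r
  R_ι : ∀ y, a ≠ some (P.R y) → b ≠ some (P.R y) → m.R (ι y) = ι (P.R y)

/-- The vertex `v` is not an end of the edge of `r`. -/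
def FreeAt (m : SeqMap) (r : m.Dart) (v : m.Vertex) : Prop :=
  v ≠ m.vertex r ∧ v ≠ m.vertex (m.L r)

namespace Ins

variable {m : SeqMap} {P : PreMap} {r : m.Dart} {a b : Option P.Dart} {ι : P.Dart → m.Dart}
  (h : Ins m P r a b ι)
include h

lemma step (y : P.Dart) : (a = some (P.R y) ∧ m.R (ι y) = m.L r) ∨
    (b = some (P.R y) ∧ m.R (ι y) = r) ∨
    (a ≠ some (P.R y) ∧ b ≠ some (P.R y) ∧ m.R (ι y) = ι (P.R y)) := by
  by_cases ha : a = some (P.R y)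
  · exact .inl ⟨ha, h.R_a y ha⟩
  by_cases hb : b = some (P.R y)
  · exact .inr (.inl ⟨hb, h.R_b y hb⟩)
  exact .inr (.inr ⟨ha, hb, h.R_ι y ha hb⟩)

/-- The darts of `m` are those of `P` and the two darts of the new edge. -/
noncomputable def equiv : P.Dart ⊕ Bool ≃ m.Dart :=
  Equiv.ofBijective (Sum.elim ι fun x => if x = true then r else m.L r) (by
    constructor
    · rintro (x | x) (y | y) hxy
      · exact congrArg _ (h.inj hxy)
      · cases y
        · exact absurd hxy (h.ne_s x)
        · exact absurd hxy (h.ne_r x)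
      · cases x
        · exact absurd hxy.symm (h.ne_s y)
        · exact absurd hxy.symm (h.ne_r y)
      · have := m.L_ne r
        cases x <;> cases y <;> simp_all [eq_comm]
    · intro x
      rcases h.cover x with rfl | rfl | ⟨y, rfl⟩
      · exact ⟨.inr true, rfl⟩
      · exact ⟨.inr false, rfl⟩
      · exact ⟨.inl y, rfl⟩)

lemma equiv_inl (y : P.Dart) : h.equiv (.inl y) = ι y := rfl
lemma equiv_true : h.equiv (.inr true) = r := rfl
lemma equiv_false : h.equiv (.inr false) = m.L r := rfl
lemma symm_ι (y : P.Dart) : h.equiv.symm (ι y) = .inl y := by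
  rw [Equiv.symm_apply_eq, equiv_inl]
lemma symm_r : h.equiv.symm r = .inr true := by rw [Equiv.symm_apply_eq, equiv_true]
lemma symm_s : h.equiv.symm (m.L r) = .inr false := by rw [Equiv.symm_apply_eq, equiv_false]

lemma card_dart : Nat.card m.Dart = Nat.card P.Dart + 2 := by
  rw [← Nat.card_congr h.equiv, Nat.card_sum]
  simp

lemma col_s : m.col (m.L r) = false := by rw [m.col_L, h.col_r]; rfl

lemma col_a {y : P.Dart} (hy : a = some y) : P.col y = false := by
  have h1 := h.R_r
  rw [hy] at h1
  rw [← h.map_col, ← show m.R r = ι y from h1, m.col_R, h.col_r]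
  rfl

lemma col_b {y : P.Dart} (hy : b = some y) : P.col y = true := by
  have h1 := h.R_s
  rw [hy] at h1
  rw [← h.map_col, ← show m.R (m.L r) = ι y from h1, m.col_R, h.col_s]
  rfl

/-- In the cycles of `R * L` the dart `r` is inserted just before `b` and `L r` just before `a`. A
step in `P` thus becomes one or two steps in `m`, and no two faces are joined or cut. -/
lemma face_iff (y z : P.Dart) :
    (P.R * P.L).SameCycle y z ↔ (m.R * m.L).SameCycle (ι y) (ι z) := by
  constructor
  · refine sameCycle_map fun y => ?_
    have h1 : (m.R * m.L) (ι y) = m.R (ι (P.L y)) := by rw [Perm.mul_apply, h.map_L]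
    rcases h.step (P.L y) with ⟨ha, h2⟩ | ⟨hb, h2⟩ | ⟨-, -, h2⟩
    · refine ⟨2, ?_⟩
      rw [zpow_two, Perm.mul_apply, h1, h2, Perm.mul_apply, m.L_invol, h.R_r, ha]
      rfl
    · refine ⟨2, ?_⟩
      rw [zpow_two, Perm.mul_apply, h1, h2, Perm.mul_apply, h.R_s, hb]
      rfl
    · exact ⟨1, by rw [zpow_one, h1, h2]; rfl⟩
  · intro hyz
    let mk : P.Dart → Quotient (Perm.SameCycle.setoid (P.R * P.L)) := Quotient.mk _
    have hmk : ∀ y, mk (P.R (P.L y)) = mk y := fun y =>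
      Quotient.sound (s := Perm.SameCycle.setoid (P.R * P.L))
        (Perm.sameCycle_apply_left.2 (Perm.SameCycle.refl (P.R * P.L) y))
    -- The invariant gives `r` the face of its successor `b` and `L r` the face of its successor
    -- `a`; the value is `none` if the successor is absent, when the new dart forms a face by
    -- itself.
    have := sameCycle_invariant (P := m.R * m.L) (g := fun x =>
      Sum.elim (fun y => some (mk y)) (fun x => if x = true then b.map mk else a.map mk)
        (h.equiv.symm x)) (by
      intro x
      rcases h.cover x with rfl | rfl | ⟨y, rfl⟩
      · rw [Perm.mul_apply, h.R_s]
        cases b <;> simp [h.symm_r, h.symm_ι]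
      · rw [Perm.mul_apply, m.L_invol, h.R_r]
        cases a <;> simp [h.symm_s, h.symm_ι]
      · rw [Perm.mul_apply, h.map_L]
        rcases h.step (P.L y) with ⟨ha, h2⟩ | ⟨hb, h2⟩ | ⟨-, -, h2⟩
        · simp only [h2, h.symm_s, h.symm_ι]
          simp [ha, hmk]
        · simp only [h2, h.symm_r, h.symm_ι]
          simp [hb, hmk]
        · simp [h2, h.symm_ι, hmk]) hyz
    simp only [h.symm_ι, Sum.elim_inl] at this
    exact Quotient.exact (Option.some.inj this)

/-- Here `z` is the only new dart of colour `x` and `o` its successor along the face. With a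
successor, `z` joins an old face; without one it is a fixed point of `R * L`, which is one more
face. -/
lemma card_face_aux {x : Bool} {z : m.Dart} {o : Option P.Dart} (hz : m.col z = x)
    (hne : ∀ y, ι y ≠ z)
    (ho : (m.R * m.L) z = o.elim z ι) (cover : ∀ d, m.col d = x → d = z ∨ ∃ y, ι y = d) :
    Nat.card {f : m.Face // m.isWhite f = x} =
      P.numColFaces x + if o = none then 1 else 0 := by
  have hcol : ∀ y, (∃ y', Quotient.mk (Perm.SameCycle.setoid (P.R * P.L)) y' = Quotient.mk _ y ∧
      P.col y' = x) → m.col (ι y) = x := by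
    rintro y ⟨y', h1, h2⟩
    rw [h.map_col, ← P.col_face (Quotient.exact h1), h2]
  cases o with
  | some y₀ =>
    simp only [reduceCtorEq, if_false, add_zero]
    refine card_classes_congr ι _ _ (fun y z _ _ => h.face_iff y z) hcol fun d hd => ?_
    rcases cover d hd with rfl | ⟨y, rfl⟩
    · have h1 : (m.R * m.L).SameCycle d (ι y₀) := ⟨1, ho⟩
      refine ⟨y₀, h1, y₀, rfl, ?_⟩
      rw [← h.map_col, ← hz]
      exact (m.col_of_face_eq (CombMap.face_eq.2 h1)).symm
    · exact ⟨y, Perm.SameCycle.refl _ _, y, rfl, by rw [← h.map_col]; exact hd⟩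
  | none =>
    simp only [if_true]
    rw [card_ne (p := fun f => m.isWhite f = x) (u := m.face z) hz]
    congr 1
    have hfix : ∀ w, (m.R * m.L).SameCycle z w → w = z := by
      intro w hw
      have := sameCycle_invariant (P := m.R * m.L) (g := fun w => w = z) (fun w => by
        conv_lhs => rw [← show (m.R * m.L) z = z from ho]
        exact propext (m.R * m.L).injective.eq_iff) hw
      simpa using this
    refine card_classes_congr ι _ _ (fun y z _ _ => h.face_iff y z)
      (fun y hy => ⟨hcol y hy, fun h' => ?_⟩) fun d hd => ?_
    · exact hne y (hfix _ (CombMap.face_eq.1 h'.symm))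
    · rcases cover d hd.1 with rfl | ⟨y, rfl⟩
      · exact absurd rfl hd.2
      · exact ⟨y, Perm.SameCycle.refl _ _, y, rfl, by rw [← h.map_col]; exact hd.1⟩

lemma card_white_faces : Nat.card {f : m.Face // m.isWhite f = true} =
    P.numColFaces true + if b = none then 1 else 0 :=
  h.card_face_aux h.col_r h.ne_r h.R_s fun d hd => by
    rcases h.cover d with hd' | rfl | hd'
    · exact .inl hd'
    · simp [h.col_s] at hd
    · exact .inr hd'

lemma card_black_faces : Nat.card {f : m.Face // m.isWhite f = false} =
    P.numColFaces false + if a = none then 1 else 0 :=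
  h.card_face_aux h.col_s h.ne_s (by rw [Perm.mul_apply, m.L_invol]; exact h.R_r) fun d hd => by
    rcases h.cover d with rfl | hd' | hd'
    · simp [h.col_r] at hd
    · exact .inl hd'
    · exact .inr hd'

end Ins
end FaceBipartite

/-! ### Effect of the insertion on vertices: loops and links -/

namespace FaceBipartite
open Equiv

lemma disjoint_orbs {α : Type*} {P : Perm α} {a b : Option α}
    (hab : ∀ y z, a = some y → b = some z → ¬ P.SameCycle y z) :
    Disjoint (orbs P a) (orbs P b) := by
  rw [Set.disjoint_left]
  rintro x ⟨y, hy, hyx⟩ ⟨z, hz, hzx⟩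
  exact hab y z hy hz (hyx.trans hzx.symm)

namespace Ins

variable {m : SeqMap} {P : PreMap} {r : m.Dart} {a b : Option P.Dart} {ι : P.Dart → m.Dart}
  (h : Ins m P r a b ι)
include h

lemma pow_of_notMem {y : P.Dart} (hy : y ∉ orbs P.R a ∪ orbs P.R b) (k : ℕ) :
    (m.R ^ k) (ι y) = ι ((P.R ^ k) y) := by
  induction k with
  | zero => rfl
  | succ k ih =>
    rw [pow_succ', Perm.mul_apply, ih, pow_succ', Perm.mul_apply]
    have key : ∀ o : Option P.Dart, y ∉ orbs P.R o → o ≠ some (P.R ((P.R ^ k) y)) := by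
      rintro _ ho rfl
      refine ho ⟨_, rfl, Perm.SameCycle.symm ⟨(k + 1 : ℕ), ?_⟩⟩
      rw [zpow_natCast, pow_succ', Perm.mul_apply]
    exact h.R_ι _ (key a fun h => hy (.inl h)) (key b fun h => hy (.inr h))

lemma pow_of_freeAt {y : P.Dart} (hy : FreeAt m r (m.vertex (ι y))) (k : ℕ) :
    (m.R ^ k) (ι y) = ι ((P.R ^ k) y) := by
  have key : ∀ k : ℕ, m.R.SameCycle (ι y) ((m.R ^ k) (ι y)) := fun k => ⟨k, rfl⟩
  induction k with
  | zero => rfl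
  | succ k ih =>
    have hk := key (k + 1)
    rw [pow_succ', Perm.mul_apply, ih] at hk
    rw [pow_succ', Perm.mul_apply, ih, pow_succ', Perm.mul_apply]
    rcases h.step ((P.R ^ k) y) with ⟨-, h1⟩ | ⟨-, h1⟩ | ⟨-, -, h1⟩
    · exact absurd (CombMap.vertex_eq.2 (h1 ▸ hk)) hy.2
    · exact absurd (CombMap.vertex_eq.2 (h1 ▸ hk)) hy.1
    · exact h1

/-- The only arrows of `R` that change are those into `a` and `b`. A cycle that contains neither is
copied unchanged; a cycle that contains one of them is diverted to `L r` or `r`. -/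
lemma freeAt_iff (y : P.Dart) :
    FreeAt m r (m.vertex (ι y)) ↔ y ∉ orbs P.R a ∪ orbs P.R b := by
  constructor
  · intro hy
    -- The predecessor `w` of `z` is taken at a positive exponent. If `z` were `a` or `b`, then `R`
    -- would lead from `ι w` to a dart of the new edge and not to `ι z`.
    have key : ∀ z, P.R.SameCycle z y → ∃ w, P.R w = z ∧ m.R.SameCycle (ι y) (ι w) ∧
        m.R (ι w) = ι z := by
      intro z hz
      obtain ⟨i, hi, -, h1⟩ := hz.symm.exists_pow_eq''
      obtain ⟨i, rfl⟩ : ∃ j, i = j + 1 := ⟨i - 1, by omega⟩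
      rw [pow_succ', Perm.mul_apply] at h1
      refine ⟨_, h1, ⟨i, by rw [zpow_natCast, h.pow_of_freeAt hy]⟩, ?_⟩
      rw [← h.pow_of_freeAt hy, ← Perm.mul_apply, ← pow_succ', h.pow_of_freeAt hy, pow_succ',
        Perm.mul_apply, h1]
    rintro (⟨z, hz, hzy⟩ | ⟨z, hz, hzy⟩)
    · obtain ⟨w, hw, -, h2⟩ := key z hzy
      rw [h.R_a w (by rw [hw]; exact hz)] at h2
      exact h.ne_s z h2.symm
    · obtain ⟨w, hw, -, h2⟩ := key z hzy
      rw [h.R_b w (by rw [hw]; exact hz)] at h2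
      exact h.ne_r z h2.symm
  · intro hy
    constructor
    · intro h1
      obtain ⟨k, hk⟩ := (CombMap.vertex_eq.1 h1).exists_nat_pow_eq
      rw [h.pow_of_notMem hy] at hk
      exact h.ne_r _ hk
    · intro h1
      obtain ⟨k, hk⟩ := (CombMap.vertex_eq.1 h1).exists_nat_pow_eq
      rw [h.pow_of_notMem hy] at hk
      exact h.ne_s _ hk

lemma orb_of_freeAt {y : P.Dart} (hy : FreeAt m r (m.vertex (ι y))) :
    orb m.R (ι y) = ι '' orb P.R y := by
  ext x
  constructor
  · intro hx
    obtain ⟨k, rfl⟩ := Perm.SameCycle.exists_nat_pow_eq hx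
    exact ⟨_, ⟨k, rfl⟩, (h.pow_of_freeAt hy k).symm⟩
  · rintro ⟨z, hz, rfl⟩
    obtain ⟨k, rfl⟩ := Perm.SameCycle.exists_nat_pow_eq hz
    exact ⟨k, h.pow_of_freeAt hy k⟩

lemma sameCycle_iff {y z : P.Dart} (hy : FreeAt m r (m.vertex (ι y))) :
    m.R.SameCycle (ι y) (ι z) ↔ P.R.SameCycle y z := by
  rw [← mem_orb, ← mem_orb, h.orb_of_freeAt hy, h.inj.mem_set_image]

lemma exists_of_freeAt {v : m.Vertex} (hv : FreeAt m r v) : ∃ y, m.vertex (ι y) = v := by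
  obtain ⟨x, rfl⟩ := m.exists_vertex v
  rcases h.cover x with rfl | rfl | ⟨y, rfl⟩
  · exact absurd rfl hv.1
  · exact absurd rfl hv.2
  · exact ⟨y, rfl⟩

lemma degree_of_freeAt {y : P.Dart} (hy : FreeAt m r (m.vertex (ι y))) :
    m.degree (m.vertex (ι y)) = (orb P.R y).ncard := by
  rw [CombMap.degree_vertex, h.orb_of_freeAt hy, Set.ncard_image_of_injective _ h.inj]

lemma card_freeAt : Nat.card {v // FreeAt m r v} =
    Nat.card {q : Quotient (Perm.SameCycle.setoid P.R) //
      ∃ y, Quotient.mk _ y = q ∧ y ∉ orbs P.R a ∪ orbs P.R b} := by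
  have hfree : ∀ y, (∃ y', Quotient.mk (Perm.SameCycle.setoid P.R) y' = Quotient.mk _ y ∧
      y' ∉ orbs P.R a ∪ orbs P.R b) → FreeAt m r (m.vertex (ι y)) := by
    rintro y ⟨y', h1, h2⟩
    rw [← h.freeAt_iff] at h2
    rwa [← CombMap.vertex_eq.2 ((h.sameCycle_iff h2).2 (Quotient.exact h1))]
  refine card_classes_congr ι _ _ (fun y z hy _ => (h.sameCycle_iff (hfree y hy)).symm) hfree
    fun x hx => ?_
  obtain ⟨y, hy⟩ := h.exists_of_freeAt hx
  refine ⟨y, CombMap.vertex_eq.1 hy.symm, y, rfl, ?_⟩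
  rw [← h.freeAt_iff, hy]
  exact hx

lemma orb_union : orb m.R r ∪ orb m.R (m.L r) =
    {r, m.L r} ∪ ι '' (orbs P.R a ∪ orbs P.R b) := by
  ext x
  rcases h.cover x with rfl | rfl | ⟨y, rfl⟩
  · simp [mem_orb, Perm.SameCycle.refl]
  · simp [mem_orb, Perm.SameCycle.refl]
  · have h1 := h.freeAt_iff y
    rw [← not_iff_not, not_not, FreeAt, not_and_or, not_not, not_not] at h1
    rw [Set.mem_union, Set.mem_union, h.inj.mem_set_image, ← h1, CombMap.vertex_eq,
      CombMap.vertex_eq, mem_orb, mem_orb, Perm.sameCycle_comm, Perm.sameCycle_comm (x := m.L r)]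
    simp [h.ne_r, h.ne_s]

lemma ncard_orb_union : (orb m.R r ∪ orb m.R (m.L r)).ncard =
    2 + (orbs P.R a ∪ orbs P.R b).ncard := by
  rw [h.orb_union, Set.ncard_union_eq _ (Set.toFinite _) (Set.toFinite _),
    Set.ncard_image_of_injective _ h.inj, Set.ncard_pair (m.L_ne r).symm]
  rw [Set.disjoint_left]
  rintro x (rfl | rfl) ⟨y, -, hy⟩
  · exact h.ne_r y hy
  · exact h.ne_s y hy

/-- After the first step from `r` to `a`, the walk in `m` copies that in `P` until it would enter
`a` again or enter `b`. -/
lemma walk {y : P.Dart} (ha : a = some y) {i : ℕ} (hi : ∀ j, 0 < j → j ≤ i →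
    a ≠ some ((P.R ^ j) y) ∧ b ≠ some ((P.R ^ j) y)) : (m.R ^ (i + 1)) r = ι ((P.R ^ i) y) := by
  induction i with
  | zero => rw [zero_add, pow_one, h.R_r, ha]; rfl
  | succ i ih =>
    rw [pow_succ', Perm.mul_apply, ih fun j h0 hj => hi j h0 (by omega)]
    have := hi (i + 1) (by omega) le_rfl
    rw [pow_succ', Perm.mul_apply] at this
    rw [h.R_ι _ this.1 this.2, pow_succ', Perm.mul_apply]

/-- `a` is black and `b` is white. -/
lemma ne_of_some {y z : P.Dart} (ha : a = some y) (hb : b = some z) : y ≠ z := by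
  rintro rfl
  have := h.col_a ha
  simp [h.col_b hb] at this

/-- If `a` and `b` lie in the same cycle of `P`, then the new edge is a link. -/
lemma link {y z : P.Dart} (ha : a = some y) (hb : b = some z) (hyz : P.R.SameCycle y z) :
    ¬ m.R.SameCycle r (m.L r) ∧ z = (P.R ^ ((orb m.R r).ncard - 1)) y := by
  classical
  have hex : ∃ k : ℕ, (P.R ^ k) y = z := hyz.exists_nat_pow_eq
  -- With the least `k`, the arc from `a` to just before `b` has `k` darts and, closed up by `r`,
  -- becomes the cycle of `r`.
  obtain ⟨k, hk, hmin⟩ : ∃ k : ℕ, (P.R ^ k) y = z ∧ ∀ j < k, (P.R ^ j) y ≠ z :=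
    ⟨Nat.find hex, Nat.find_spec hex, fun j hj => Nat.find_min hex hj⟩
  have hk0 : 0 < k := by
    rcases Nat.eq_zero_or_pos k with rfl | h0
    · exact absurd hk (h.ne_of_some ha hb)
    · exact h0
  have hwalk : ∀ i < k, (m.R ^ (i + 1)) r = ι ((P.R ^ i) y) := by
    intro i hi
    refine h.walk ha fun j h0 hj => ⟨?_, ?_⟩
    · rw [ha]
      intro h1
      -- An early return to `a` after `j` steps would make `b` reachable in `k - j` steps.
      refine hmin (k - j) (by omega) ?_
      rw [← hk, ← Nat.sub_add_cancel (show j ≤ k by omega), pow_add, Perm.mul_apply,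
        ← Option.some.inj h1, Nat.add_sub_cancel]
    · rw [hb]
      exact fun h1 => hmin j (by omega) (Option.some.inj h1).symm
  have hlast : m.R (ι ((P.R ^ (k - 1)) y)) = r := by
    refine h.R_b _ ?_
    rw [← Perm.mul_apply, ← pow_succ', Nat.sub_add_cancel hk0, hk, hb]
  have hcard : (orb m.R r).ncard = k + 1 := by
    refine ncard_orb_eq_of_pow (by omega) ?_ fun i h0 hi => ?_
    · have := hwalk (k - 1) (by omega)
      rw [Nat.sub_add_cancel hk0] at this
      rw [pow_succ', Perm.mul_apply, this, hlast]
    · have := hwalk (i - 1) (by omega)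
      rw [Nat.sub_add_cancel h0] at this
      rw [this]
      exact h.ne_r _
  refine ⟨fun hrs => ?_, by rw [hcard, Nat.add_sub_cancel, hk]⟩
  -- The powers of `R` never leave this list of darts, and `L r` is not on it.
  have hclosed : ∀ j : ℕ, (m.R ^ j) r = r ∨ ∃ i < k, (m.R ^ j) r = ι ((P.R ^ i) y) := by
    intro j
    induction j with
    | zero => exact .inl rfl
    | succ j ih =>
      rw [pow_succ', Perm.mul_apply]
      rcases ih with ih | ⟨i, hi, ih⟩
      · refine .inr ⟨0, hk0, ?_⟩
        rw [ih]
        simpa using hwalk 0 hk0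
      · rw [ih]
        rcases eq_or_ne i (k - 1) with rfl | hne
        · exact .inl hlast
        · refine .inr ⟨i + 1, by omega, ?_⟩
          rw [← hwalk (i + 1) (by omega), ← hwalk i hi, ← Perm.mul_apply, ← pow_succ']
  obtain ⟨j, hj⟩ := hrs.exists_nat_pow_eq
  rcases hclosed j with h1 | ⟨i, -, h1⟩
  · exact m.L_ne r (hj.symm.trans h1)
  · exact h.ne_s _ (h1.symm.trans hj)

/-- If `a` and `b` do not lie in the same cycle of `P`, then the new edge is a loop. -/
lemma loop (hab : ∀ y z, a = some y → b = some z → ¬ P.R.SameCycle y z) :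
    m.R.SameCycle r (m.L r) := by
  rcases ha : a with _ | y
  · exact ⟨1, by rw [zpow_one, h.R_r, ha]; rfl⟩
  rcases hb : b with _ | z
  · exact Perm.SameCycle.symm ⟨1, by rw [zpow_one, h.R_s, hb]; rfl⟩
  have h0 := ncard_orb_pos P.R y
  -- The walk traverses the whole cycle of `a` without meeting `b` and ends at the predecessor of
  -- `a`, whose next step is `L r`.
  have hwalk := h.walk (i := (orb P.R y).ncard - 1) ha fun j hj0 hj => ⟨?_, ?_⟩
  · refine ⟨((orb P.R y).ncard - 1 + 1 + 1 : ℕ), ?_⟩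
    rw [zpow_natCast, pow_succ', Perm.mul_apply, hwalk]
    refine h.R_a _ ?_
    rw [← Perm.mul_apply, ← pow_succ', Nat.sub_add_cancel h0, pow_ncard_orb, ha]
  · rw [ha]
    intro h1
    have := pow_injOn (P := P.R) (x := y) (i := 0) (j := j) h0 (by omega) (Option.some.inj h1)
    omega
  · rw [hb]
    intro h1
    exact hab y z ha hb ⟨j, by rw [zpow_natCast, Option.some.inj h1]⟩

lemma ncard_orb_loop (hab : ∀ y z, a = some y → b = some z → ¬ P.R.SameCycle y z) :
    (orb m.R r).ncard = 2 + ((orbs P.R a).ncard + (orbs P.R b).ncard) := by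
  rw [← Set.ncard_union_eq (disjoint_orbs hab) (Set.toFinite _) (Set.toFinite _),
    ← h.ncard_orb_union]
  congr 1
  symm
  rw [Set.union_eq_left]
  exact fun x hx => (h.loop hab).trans hx

/-- The two ends of the link share the darts of the cut cycle, and each receives one dart of the new
edge. -/
lemma ncard_orb_link {y z : P.Dart} (ha : a = some y) (hb : b = some z)
    (hyz : P.R.SameCycle y z) :
    (orb m.R r).ncard + (orb m.R (m.L r)).ncard = 2 + (orb P.R y).ncard := by
  have h1 : orbs P.R a ∪ orbs P.R b = orb P.R y := by
    rw [ha, hb, orbs_some, orbs_some, Set.union_eq_left]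
    exact fun x hx => hyz.trans hx
  rw [← h1, ← h.ncard_orb_union, Set.ncard_union_eq _ (Set.toFinite _) (Set.toFinite _)]
  rw [Set.disjoint_left]
  exact fun x hx hx' => (h.link ha hb hyz).1 (Perm.SameCycle.trans hx (Perm.SameCycle.symm hx'))

end Ins

end FaceBipartite

/-! ### Correspondence of vertices and uniqueness of insertion and removal -/

namespace FaceBipartite
open Equiv

section Lists

variable {α β : Type*} {rel : α → β → Prop}

lemma forall₂_pickFrom {l : List α} {l' : List β} (h : List.Forall₂ rel l l') (S : Finset ℕ)
    (k : ℕ) : List.Forall₂ rel (pickFrom k S l) (pickFrom k S l') := by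
  induction h generalizing k with
  | nil => exact .nil
  | cons hx _ ih =>
    simp only [pickFrom_cons]
    split_ifs
    · exact .cons hx (ih _)
    · exact ih _

lemma forall₂_pick {l : List α} {l' : List β} (h : List.Forall₂ rel l l') (S : Finset ℕ) :
    List.Forall₂ rel (pick S l) (pick S l') := forall₂_pickFrom h S 0

lemma forall₂_eraseIdx {l : List α} {l' : List β} (h : List.Forall₂ rel l l') (j : ℕ) :
    List.Forall₂ rel (l.eraseIdx j) (l'.eraseIdx j) := by
  induction h generalizing j with
  | nil => exact .nil
  | cons hx ht ih =>
    cases j with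
    | zero => exact ht
    | succ j => exact .cons hx (ih j)

lemma forall₂_getElem? {l : List α} {l' : List β} (h : List.Forall₂ rel l l') {j : ℕ} {x : α}
    (hx : l[j]? = some x) : ∃ y, l'[j]? = some y ∧ rel x y := by
  induction h generalizing j with
  | nil => simp at hx
  | cons hx' ht ih =>
    cases j with
    | zero => exact ⟨_, rfl, by simp at hx; exact hx ▸ hx'⟩
    | succ j => simpa using ih (j := j) (by simpa using hx)

lemma forall₂_insertIdx {l : List α} {l' : List β} (h : List.Forall₂ rel l l') (j : ℕ)
    {x : α} {y : β} (hxy : rel x y) : List.Forall₂ rel (l.insertIdx j x) (l'.insertIdx j y) := by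
  induction h generalizing j with
  | nil =>
    cases j with
    | zero => exact .cons hxy .nil
    | succ j => exact .nil
  | cons hx ht ih =>
    cases j with
    | zero => exact .cons hxy (.cons hx ht)
    | succ j => exact .cons hx (ih j)

lemma nodup_of_forall₂ {l : List α} {l' : List β} (h : List.Forall₂ rel l l')
    (hrel : ∀ x y y', rel x y → rel x y' → y = y') (hl' : l'.Nodup) : l.Nodup := by
  induction h with
  | nil => exact List.nodup_nil
  | cons hx ht ih =>
    rw [List.nodup_cons] at hl' ⊢
    refine ⟨fun hmem => hl'.1 ?_, ih hl'.2⟩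
    obtain ⟨y', hy', h'⟩ := forall₂_exists_right ht hmem
    rwa [hrel _ _ _ hx h']

end Lists

/-- Replace the sequence of distinguished vertices. -/
def SeqMap.setMarked (m : SeqMap) (l : List m.Vertex) (hl : l.Nodup)
    (hr : ∀ r ∈ m.root, m.vertex r ∉ l) : SeqMap :=
  { m with marked := l, marked_nodup := hl, root_notMem_marked := hr }

/-- The vertices `v'` and `v` correspond to each other, and `v` is not an end of the edge of `r`. -/
def FreeCorr {m m' : SeqMap} (r : m.Dart) (j : m'.Dart → m.Dart) (v' : m'.Vertex)
    (v : m.Vertex) : Prop := SeqMap.VertexCorr j v' v ∧ FreeAt m r v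

/-- Away from the edge of `r`, the map `j` of darts preserves vertices and degrees. -/
structure CycleEmb (m m' : SeqMap) (r : m.Dart) (j : m'.Dart → m.Dart) : Prop where
  iff : ∀ {y z}, FreeAt m r (m.vertex (j y)) → (m.R.SameCycle (j y) (j z) ↔ m'.R.SameCycle y z)
  degree : ∀ {y}, FreeAt m r (m.vertex (j y)) → m.degree (m.vertex (j y)) = m'.degree (m'.vertex y)

namespace CycleEmb

variable {m m' : SeqMap} {r : m.Dart} {j : m'.Dart → m.Dart} (h : CycleEmb m m' r j)
include h

lemma degree_eq {v' : m'.Vertex} {v : m.Vertex} (hv : FreeCorr r j v' v) :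
    m.degree v = m'.degree v' := by
  obtain ⟨⟨d, rfl, rfl⟩, hf⟩ := hv
  exact h.degree hf

/-- Since `CycleEmb.iff` asks for freeness of one vertex only, a free correspondence can be tested
on any dart. It is therefore one-to-one in both directions, as the next two lemmas record. -/
lemma corr_iff {v' : m'.Vertex} {v : m.Vertex} (hv : FreeCorr r j v' v) (d : m'.Dart) :
    m'.vertex d = v' ↔ m.vertex (j d) = v := by
  obtain ⟨⟨x, rfl, rfl⟩, hf⟩ := hv
  rw [CombMap.vertex_eq, CombMap.vertex_eq, Perm.sameCycle_comm, ← h.iff hf, Perm.sameCycle_comm]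

lemma corr_right {v' : m'.Vertex} {v w : m.Vertex} (hv : FreeCorr r j v' v)
    (hw : FreeCorr r j v' w) : v = w := by
  obtain ⟨⟨d, h1, rfl⟩, hf⟩ := hw
  exact ((h.corr_iff hv d).1 h1).symm

lemma corr_left {v' w' : m'.Vertex} {v : m.Vertex} (hv : FreeCorr r j v' v)
    (hw : FreeCorr r j w' v) : v' = w' := by
  obtain ⟨⟨d, rfl, h1⟩, hf⟩ := hw
  exact ((h.corr_iff hv d).2 h1).symm

lemma nodup_left {l' : List m'.Vertex} {l : List m.Vertex}
    (hl : List.Forall₂ (FreeCorr r j) l' l) (hn : l.Nodup) : l'.Nodup :=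
  nodup_of_forall₂ hl (fun _ _ _ => h.corr_right) hn

lemma nodup_right {l' : List m'.Vertex} {l : List m.Vertex}
    (hl : List.Forall₂ (FreeCorr r j) l' l) (hn : l'.Nodup) : l.Nodup :=
  nodup_of_forall₂ (rel := fun v v' => FreeCorr r j v' v) hl.flip (fun _ _ _ => h.corr_left) hn

lemma map_degree {l' : List m'.Vertex} {l : List m.Vertex}
    (hl : List.Forall₂ (FreeCorr r j) l' l) : l.map m.degree = l'.map m'.degree := by
  induction hl with
  | nil => rfl
  | cons hv _ ih => rw [List.map_cons, List.map_cons, ih, h.degree_eq hv]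

end CycleEmb

namespace SeqMap.IsIso

variable {m n : SeqMap} {φ : m.Dart ≃ n.Dart} (h : IsIso m n φ)
include h

lemma sameCycle_iff {x y : m.Dart} : n.R.SameCycle (φ x) (φ y) ↔ m.R.SameCycle x y := by
  constructor
  · intro h1
    have := h.symm.vertex_eq (CombMap.vertex_eq.2 h1)
    simpa using CombMap.vertex_eq.1 this
  · exact fun h1 => CombMap.vertex_eq.1 (h.vertex_eq (CombMap.vertex_eq.2 h1))

lemma col (d : m.Dart) : n.col (φ d) = m.col d := h.map_isWhite d

lemma cycleEmb_degree (d : m.Dart) : n.degree (n.vertex (φ d)) = m.degree (m.vertex d) := by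
  rw [CombMap.degree_vertex, CombMap.degree_vertex]
  have : orb n.R (φ d) = φ '' orb m.R d := by
    ext x
    obtain ⟨x, rfl⟩ := φ.surjective x
    rw [φ.injective.mem_set_image, mem_orb, mem_orb, h.sameCycle_iff]
  rw [this, Set.ncard_image_of_injective _ φ.injective]

lemma corr_degree {v : m.Vertex} {w : n.Vertex} (hv : VertexCorr φ v w) :
    n.degree w = m.degree v := by
  obtain ⟨d, rfl, rfl⟩ := hv
  exact h.cycleEmb_degree d

lemma freeAt {r : m.Dart} {v : m.Vertex} {w : n.Vertex} (hv : VertexCorr φ v w)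
    (hf : FreeAt m r v) : FreeAt n (φ r) w := by
  obtain ⟨d, rfl, rfl⟩ := hv
  constructor
  · intro h1
    exact hf.1 (CombMap.vertex_eq.2 (h.sameCycle_iff.1 (CombMap.vertex_eq.1 h1)))
  · intro h1
    rw [← h.map_L] at h1
    exact hf.2 (CombMap.vertex_eq.2 (h.sameCycle_iff.1 (CombMap.vertex_eq.1 h1)))

lemma freeCorr {m' : SeqMap} {r : m.Dart} {j : m'.Dart → m.Dart} {v' : m'.Vertex} {v : m.Vertex}
    {w : n.Vertex} (hv : FreeCorr r j v' v) (hw : VertexCorr φ v w) :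
    FreeCorr (φ r) (φ ∘ j) v' w := by
  refine ⟨?_, h.freeAt hw hv.2⟩
  obtain ⟨⟨d, h1, h2⟩, -⟩ := hv
  obtain ⟨e, h3, rfl⟩ := hw
  exact ⟨d, h1, h.vertex_eq (h2.trans h3.symm)⟩

end SeqMap.IsIso

/-- An isomorphism of rooted maps to itself is the identity. -/
lemma SeqMap.IsIso.eq_id {m : SeqMap} {φ : m.Dart ≃ m.Dart} (h : IsIso m m φ) (d : m.Dart) : φ d = d := by
  have : Nonempty m.Dart := ⟨d⟩
  obtain ⟨r, hr⟩ := m.exists_root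
  refine CombMap.dart_induction (m := m.toCombMap) (p := fun d => φ d = d) (x := r) ?_ ?_ ?_ d
  · have := h.map_root
    rw [hr] at this
    simpa using this
  · intro d hd
    rw [h.map_R, hd]
  · intro d hd
    rw [h.map_L, hd]

namespace Ins

variable {m : SeqMap} {P : PreMap} {r : m.Dart} {a b : Option P.Dart} {ι : P.Dart → m.Dart}
  (h : Ins m P r a b ι)
include h

lemma map_iso {n : SeqMap} {φ : m.Dart ≃ n.Dart} (hφ : SeqMap.IsIso m n φ) :
    Ins n P (φ r) a b (φ ∘ ι) where
  inj := φ.injective.comp h.inj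
  ne_r y := φ.injective.ne (h.ne_r y)
  ne_s y := by
    rw [← hφ.map_L]
    exact φ.injective.ne (h.ne_s y)
  cover x := by
    obtain ⟨x, rfl⟩ := φ.surjective x
    rcases h.cover x with rfl | rfl | ⟨y, rfl⟩
    · exact .inl rfl
    · exact .inr (.inl (hφ.map_L r))
    · exact .inr (.inr ⟨y, rfl⟩)
  map_L y := by rw [Function.comp, ← hφ.map_L, h.map_L]; rfl
  col_r := by rw [hφ.col, h.col_r]
  map_col y := by rw [Function.comp, hφ.col, h.map_col]
  R_r := by rw [← hφ.map_R, h.R_r]; cases a <;> simp [hφ.map_L]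
  R_s := by rw [← hφ.map_L, ← hφ.map_R, h.R_s]; cases b <;> simp
  R_a y hy := by rw [Function.comp, ← hφ.map_R, h.R_a y hy, hφ.map_L]
  R_b y hy := by rw [Function.comp, ← hφ.map_R, h.R_b y hy]
  R_ι y hy hy' := by rw [Function.comp, ← hφ.map_R, h.R_ι y hy hy']; rfl

lemma comap {P' : PreMap} (e : P'.Dart ≃ P.Dart) (hR : ∀ y, e (P'.R y) = P.R (e y))
    (hL : ∀ y, e (P'.L y) = P.L (e y)) (hc : ∀ y, P'.col y = P.col (e y)) {a' b' : Option P'.Dart}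
    (ha : a'.map e = a) (hb : b'.map e = b) : Ins m P' r a' b' (ι ∘ e) where
  inj := h.inj.comp e.injective
  ne_r y := h.ne_r _
  ne_s y := h.ne_s _
  cover x := by
    rcases h.cover x with h1 | h1 | ⟨y, rfl⟩
    · exact .inl h1
    · exact .inr (.inl h1)
    · exact .inr (.inr ⟨e.symm y, by simp⟩)
  map_L y := by simp [h.map_L, hL]
  col_r := h.col_r
  map_col y := by simp [h.map_col, hc]
  R_r := by rw [h.R_r, ← ha]; cases a' <;> rfl
  R_s := by rw [h.R_s, ← hb]; cases b' <;> rfl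
  R_a y hy := h.R_a _ (by rw [← ha, hy, ← hR]; rfl)
  R_b y hy := h.R_b _ (by rw [← hb, hy, ← hR]; rfl)
  R_ι y hy hy' := by
    rw [Function.comp, h.R_ι, ← hR]
    · rfl
    · rw [← ha, ← hR]
      exact fun h1 => hy (Option.map_injective e.injective h1)
    · rw [← hb, ← hR]
      exact fun h1 => hy' (Option.map_injective e.injective h1)

/-- The result of the insertion is determined by the data. -/
lemma target_unique {n : SeqMap} {s : n.Dart} {κ : P.Dart → n.Dart} (h' : Ins n P s a b κ) :
    ∃ φ : m.Dart ≃ n.Dart, φ r = s ∧ (∀ y, φ (ι y) = κ y) ∧ (∀ d, φ (m.R d) = n.R (φ d)) ∧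
      (∀ d, φ (m.L d) = n.L (φ d)) ∧ ∀ d, n.col (φ d) = m.col d := by
  -- Both dart sets are the darts of `P` together with the two new ones.
  let φ := h.equiv.symm.trans h'.equiv
  have hr : φ r = s := by simp only [φ, Equiv.trans_apply, h.symm_r, h'.equiv_true]
  have hs : φ (m.L r) = n.L s := by simp only [φ, Equiv.trans_apply, h.symm_s, h'.equiv_false]
  have hι : ∀ y, φ (ι y) = κ y := fun y => by
    simp only [φ, Equiv.trans_apply, h.symm_ι, h'.equiv_inl]
  refine ⟨φ, hr, hι, fun d => ?_, fun d => ?_, fun d => ?_⟩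
  · rcases h.cover d with rfl | rfl | ⟨y, rfl⟩
    · rw [h.R_r, hr, h'.R_r]
      cases a <;> simp [hs, hι]
    · rw [h.R_s, hs, h'.R_s]
      cases b <;> simp [hr, hι]
    · rw [hι]
      rcases h.step y with ⟨h1, h2⟩ | ⟨h1, h2⟩ | ⟨h0, h1, h2⟩
      · rw [h2, hs, h'.R_a y h1]
      · rw [h2, hr, h'.R_b y h1]
      · rw [h2, hι, h'.R_ι y h0 h1]
  · rcases h.cover d with rfl | rfl | ⟨y, rfl⟩
    · rw [hs, hr]
    · rw [m.L_invol, hr, hs, n.L_invol]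
    · rw [h.map_L, hι, hι, h'.map_L]
  · rcases h.cover d with rfl | rfl | ⟨y, rfl⟩
    · rw [hr, h.col_r, h'.col_r]
    · rw [hs, h.col_s, h'.col_s]
    · rw [hι, h.map_col, h'.map_col]

/-- The data are determined by the result of the insertion. -/
lemma source_unique {P' : PreMap} {a' b' : Option P'.Dart} {κ : P'.Dart → m.Dart}
    (h' : Ins m P' r a' b' κ) :
    ∃ e : P.Dart ≃ P'.Dart, (∀ y, κ (e y) = ι y) ∧ (∀ y, e (P.R y) = P'.R (e y)) ∧
      (∀ y, e (P.L y) = P'.L (e y)) ∧ (∀ y, P'.col (e y) = P.col y) ∧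
      a.map e = a' ∧ b.map e = b' := by
  -- Both embeddings have the complement of `{r, L r}` as image.
  have hex : ∀ y, ∃ z, κ z = ι y := by
    intro y
    rcases h'.cover (ι y) with h1 | h1 | h1
    · exact absurd h1 (h.ne_r y)
    · exact absurd h1 (h.ne_s y)
    · exact h1
  choose f hf using hex
  have hbij : Function.Bijective f := by
    constructor
    · intro y z hyz
      apply h.inj
      rw [← hf, ← hf, hyz]
    · intro z
      rcases h.cover (κ z) with h1 | h1 | ⟨y, h1⟩
      · exact absurd h1 (h'.ne_r z)
      · exact absurd h1 (h'.ne_s z)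
      · exact ⟨y, h'.inj (by rw [hf, h1])⟩
  refine ⟨Equiv.ofBijective f hbij, hf, fun y => h'.inj ?_, fun y => h'.inj ?_, fun y => ?_, ?_, ?_⟩
  · change κ (f _) = κ (P'.R (f y))
    rw [hf]
    have hne := m.L_ne r
    -- The value of `m.R` at this dart is `L r`, `r` or an old dart, and both descriptions must
    -- agree on which. In the first two agreeing cases the successor is read off from `R_r` or
    -- `R_s`.
    rcases h.step y with ⟨h1, h2⟩ | ⟨h1, h2⟩ | ⟨-, -, h2⟩ <;>
    rcases h'.step (f y) with ⟨h3, h4⟩ | ⟨h3, h4⟩ | ⟨-, -, h4⟩ <;> rw [hf, h2] at h4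
    · have := h.R_r
      rw [h1, h'.R_r, h3] at this
      exact this.symm
    · exact absurd h4 hne
    · exact absurd h4.symm (h'.ne_s _)
    · exact absurd h4.symm hne
    · have := h.R_s
      rw [h1, h'.R_s, h3] at this
      exact this.symm
    · exact absurd h4.symm (h'.ne_r _)
    · exact absurd h4 (h.ne_s _)
    · exact absurd h4 (h.ne_r _)
    · exact h4
  · change κ (f _) = κ (P'.L (f y))
    rw [hf, ← h.map_L, ← h'.map_L, hf]
  · rw [← h'.map_col, ← h.map_col]
    exact congrArg m.col (hf y)
  · have := h.R_r
    rw [h'.R_r] at this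
    cases ha : a <;> cases ha' : a' <;> rw [ha, ha'] at this
    · rfl
    · exact absurd this (h'.ne_s _)
    · exact absurd this.symm (h.ne_s _)
    · exact congrArg some (h'.inj ((hf _).trans this.symm))
  · have := h.R_s
    rw [h'.R_s] at this
    cases hb : b <;> cases hb' : b' <;> rw [hb, hb'] at this
    · rfl
    · exact absurd this (h'.ne_r _)
    · exact absurd this.symm (h.ne_r _)
    · exact congrArg some (h'.inj ((hf _).trans this.symm))

/-- Connectedness of the result. -/
lemma induction {p : P.Dart → Prop} (ha : ∀ y ∈ a, p y) (hb : ∀ y ∈ b, p y)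
    (hR : ∀ y, p y → p (P.R y)) (hL : ∀ y, p y → p (P.L y)) (y : P.Dart) : p y := by
  -- The transported property holds vacuously at `r` and `L r`, so the induction in the connected
  -- map `m` can start at `r`.
  refine CombMap.dart_induction (m := m.toCombMap) (p := fun x => ∀ y, ι y = x → p y) (x := r)
    (fun y hy => absurd hy (h.ne_r y)) ?_ ?_ (ι y) y rfl
  · intro d hd z hz
    rcases h.cover d with rfl | rfl | ⟨w, rfl⟩
    · rw [h.R_r] at hz
      cases a with
      | none => exact absurd hz (h.ne_s z)
      | some y => rw [h.inj hz]; exact ha y rfl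
    · rw [h.R_s] at hz
      cases b with
      | none => exact absurd hz (h.ne_r z)
      | some y => rw [h.inj hz]; exact hb y rfl
    · rcases h.step w with ⟨-, h2⟩ | ⟨-, h2⟩ | ⟨-, -, h2⟩ <;> rw [h2] at hz
      · exact absurd hz (h.ne_s z)
      · exact absurd hz (h.ne_r z)
      · rw [h.inj hz]
        exact hR _ (hd w rfl)
  · intro d hd z hz
    rcases h.cover d with rfl | rfl | ⟨w, rfl⟩
    · exact absurd hz (h.ne_s z)
    · rw [m.L_invol] at hz
      exact absurd hz (h.ne_r z)
    · rw [h.map_L] at hz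
      rw [h.inj hz]
      exact hL _ (hd w rfl)

/-- When `R` enters the new edge at `L r`, applying `R * L` once more gives `R r`, which is `a`;
from `r` it gives `b`. These are the skips that `EmbedsInRemoval` prescribes. -/
lemma embedsInRemoval {m' : SeqMap} {j : m'.Dart → P.Dart} {sw : Bool} (hj : Function.Injective j)
    (hR : ∀ d, j (m'.R d) = P.R (j d)) (hL : ∀ d, j (m'.L d) = P.L (j d))
    (hc : ∀ d, P.col (j d) = xor sw (m'.col d)) : EmbedsInRemoval m m' r (ι ∘ j) sw where
  injective := h.inj.comp hj
  map_L d := by simp [hL, h.map_L]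
  map_R d := by
    simp only [Function.comp, hR]
    rcases h.step (j d) with ⟨h1, h2⟩ | ⟨h1, h2⟩ | ⟨-, -, h2⟩
    · rw [if_pos (.inr h2), h2, m.L_invol, h.R_r, h1]
      rfl
    · rw [if_pos (.inl h2), h2, h.R_s, h1]
      rfl
    · rw [if_neg, h2]
      rw [h2]
      rintro (h3 | h3)
      · exact h.ne_r _ h3
      · exact h.ne_s _ h3
  map_isWhite d := by
    change m'.col d = (sw ^^ m.col (ι (j d)))
    rw [h.map_col, hc]
    simp

lemma range_eq : Set.range ι = {r, m.L r}ᶜ := by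
  ext x
  simp only [Set.mem_range, Set.mem_compl_iff, Set.mem_insert_iff, Set.mem_singleton_iff, not_or]
  constructor
  · rintro ⟨y, rfl⟩
    exact ⟨h.ne_r y, h.ne_s y⟩
  · rintro ⟨h1, h2⟩
    rcases h.cover x with h3 | h3 | h3
    · exact absurd h3 h1
    · exact absurd h3 h2
    · exact h3

end Ins

end FaceBipartite

/-! ### The three kinds of root edge and their numerical effect -/

namespace FaceBipartite
open Equiv

lemma orb_sumCongr_inl {α β : Type*} (P : Perm α) (Q : Perm β) (x : α) :
    orb (Perm.sumCongr P Q) (.inl x) = Sum.inl '' orb P x := by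
  ext (y | y)
  · rw [Sum.inl_injective.mem_set_image, mem_orb, mem_orb, sameCycle_sumCongr_inl]
  · simp [mem_orb, not_sameCycle_sumCongr]

lemma orb_sumCongr_inr {α β : Type*} (P : Perm α) (Q : Perm β) (x : β) :
    orb (Perm.sumCongr P Q) (.inr x) = Sum.inr '' orb Q x := by
  ext (y | y)
  · simp [mem_orb, Perm.sameCycle_comm (x := Sum.inr x), not_sameCycle_sumCongr]
  · rw [Sum.inr_injective.mem_set_image, mem_orb, mem_orb, sameCycle_sumCongr_inr]

lemma ncard_orbs_sumCongr_inl {α β : Type*} (P : Perm α) (Q : Perm β) (o : Option α) :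
    (orbs (Perm.sumCongr P Q) (o.map Sum.inl)).ncard = (orbs P o).ncard := by
  cases o with
  | none => simp
  | some x =>
    simp only [Option.map_some, orbs_some, orb_sumCongr_inl]
    exact Set.ncard_image_of_injective _ Sum.inl_injective

lemma ncard_orbs_sumCongr_inr {α β : Type*} (P : Perm α) (Q : Perm β) (o : Option β) :
    (orbs (Perm.sumCongr P Q) (o.map Sum.inr)).ncard = (orbs Q o).ncard := by
  cases o with
  | none => simp
  | some x =>
    simp only [Option.map_some, orbs_some, orb_sumCongr_inr]
    exact Set.ncard_image_of_injective _ Sum.inr_injective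

/-- The root edge `{r, L r}` of `m` is a loop whose removal leaves `m₁`, with colours exchanged,
and `m₂`. -/
structure Glues (m m₁ m₂ : SeqMap) (S : Finset ℕ) (r : m.Dart)
    (ι : m₁.Dart ⊕ m₂.Dart → m.Dart) : Prop where
  root : m.root = some r
  ins : Ins m ((m₁.pre true).sum (m₂.pre false)) r (m₁.root.map Sum.inl) (m₂.root.map Sum.inr) ι
  subset : S ⊆ Finset.range m.marked.length
  marked₁ : List.Forall₂ (FreeCorr r (ι ∘ Sum.inl)) m₁.marked (pick S m.marked)
  marked₂ : List.Forall₂ (FreeCorr r (ι ∘ Sum.inr)) m₂.marked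
    (pick (Finset.range m.marked.length \ S) m.marked)

/-- The root edge `{r, L r}` of `m` is a loop whose removal leaves the connected map `m'`, the
dart `b` being the successor of `L r`. -/
structure Splits (m m' : SeqMap) (b : m'.Dart) (r : m.Dart) (ι : m'.Dart → m.Dart) : Prop where
  root : m.root = some r
  ins : Ins m (m'.pre true) r m'.root (some b) ι
  marked : ∃ l, m'.marked = m'.vertex b :: l ∧ List.Forall₂ (FreeCorr r ι) l m.marked

/-- The root edge `{r, L r}` of `m` is a link whose contraction leaves the map `m'` with
distinguished vertices those in `l`, the dart `b` being the successor of `L r`. -/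
structure Contracts (m m' : SeqMap) (b : m'.Dart) (l : List m.Vertex) (r : m.Dart)
    (ι : m'.Dart → m.Dart) : Prop where
  root : m.root = some r
  ins : Ins m (m'.pre true) r m'.root (some b) ι
  cycle : ∀ a ∈ m'.root, m'.R.SameCycle a b
  marked : List.Forall₂ (FreeCorr r ι) m'.marked l

section CycleEmbs

variable {m m' m₁ m₂ : SeqMap} {r : m.Dart}

lemma Ins.cycleEmb {sw : Bool} {a b : Option m'.Dart} {ι : m'.Dart → m.Dart}
    (h : Ins m (m'.pre sw) r a b ι) : CycleEmb m m' r ι where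
  iff hy := h.sameCycle_iff hy
  degree hy := by rw [h.degree_of_freeAt hy, CombMap.degree_vertex]

variable {sw sw' : Bool} {a b : Option (m₁.Dart ⊕ m₂.Dart)} {ι : m₁.Dart ⊕ m₂.Dart → m.Dart}
  (h : Ins m ((m₁.pre sw).sum (m₂.pre sw')) r a b ι)
include h

lemma Ins.cycleEmb_inl : CycleEmb m m₁ r (ι ∘ Sum.inl) where
  iff hy := (h.sameCycle_iff hy).trans sameCycle_sumCongr_inl
  degree hy := by
    rw [Function.comp, h.degree_of_freeAt hy, CombMap.degree_vertex]
    exact (congrArg Set.ncard (orb_sumCongr_inl _ _ _)).trans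
      (Set.ncard_image_of_injective _ Sum.inl_injective)

lemma Ins.cycleEmb_inr : CycleEmb m m₂ r (ι ∘ Sum.inr) where
  iff hy := (h.sameCycle_iff hy).trans sameCycle_sumCongr_inr
  degree hy := by
    rw [Function.comp, h.degree_of_freeAt hy, CombMap.degree_vertex]
    exact (congrArg Set.ncard (orb_sumCongr_inr _ _ _)).trans
      (Set.ncard_image_of_injective _ Sum.inr_injective)

lemma Ins.not_corr_both {v₁ : m₁.Vertex} {v₂ : m₂.Vertex} {v : m.Vertex}
    (h₁ : FreeCorr r (ι ∘ Sum.inl) v₁ v) (h₂ : FreeCorr r (ι ∘ Sum.inr) v₂ v) : False := by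
  obtain ⟨⟨d, rfl, rfl⟩, hf⟩ := h₁
  obtain ⟨⟨e, rfl, h1⟩, -⟩ := h₂
  exact not_sameCycle_sumCongr ((h.sameCycle_iff hf).1 (CombMap.vertex_eq.1 h1.symm))

end CycleEmbs

lemma SeqMap.root_eq_none_iff (m : SeqMap) : m.root = none ↔ IsEmpty m.Dart := by
  refine ⟨m.isEmpty_of_root, fun h => ?_⟩
  rcases m.root with _ | r
  · rfl
  · exact h.elim r

/-- The conventional face of the empty map is isolated as a correction term of the same form as in
`Ins.card_white_faces` and `Ins.card_black_faces`, so that they cancel. -/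
lemma SeqMap.numWhite_eq (m : SeqMap) : m.numWhite =
    Nat.card {f : m.Face // m.isWhite f = true} + if m.root = none then 1 else 0 := by
  unfold SeqMap.numWhite
  by_cases h : IsEmpty m.Dart
  · have : IsEmpty {f : m.Face // m.isWhite f = true} :=
      ⟨fun f => by obtain ⟨d, -⟩ := Quotient.exists_rep f.1; exact h.elim d⟩
    rw [if_pos h, if_pos (m.root_eq_none_iff.2 h)]
    simp
  · rw [if_neg h, if_neg fun h' => h (m.isEmpty_of_root h'), add_zero]

lemma SeqMap.exists_root_of_dart {m : SeqMap} (d : m.Dart) : ∃ a, m.root = some a :=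
  have : Nonempty m.Dart := ⟨d⟩
  m.exists_root

/-- The Euler characteristic. -/
noncomputable def SeqMap.euler (m : SeqMap) : ℤ := m.numVertices - m.numEdges + m.numFaces

lemma SeqMap.numVertices_of_root {m : SeqMap} {r : m.Dart} (_ : m.root = some r) :
    m.numVertices = Nat.card m.Vertex := by
  unfold CombMap.numVertices
  rw [if_neg]
  exact fun h => h.elim r

lemma not_sameCycle_sum_root {m₁ m₂ : SeqMap} (y z : m₁.Dart ⊕ m₂.Dart) (hy : m₁.root.map Sum.inl = some y)
    (hz : m₂.root.map Sum.inr = some z) : ¬ (Perm.sumCongr m₁.R m₂.R).SameCycle y z := by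
  obtain ⟨y, -, rfl⟩ := Option.map_eq_some_iff.1 hy
  obtain ⟨z, -, rfl⟩ := Option.map_eq_some_iff.1 hz
  exact not_sameCycle_sumCongr

namespace Glues

variable {m m₁ m₂ : SeqMap} {S : Finset ℕ} {r : m.Dart} {ι : m₁.Dart ⊕ m₂.Dart → m.Dart}
  (h : Glues m m₁ m₂ S r ι)
include h

lemma isLoop : IsLoop m r := CombMap.vertex_eq.2 (h.ins.loop not_sameCycle_sum_root)

lemma loopSplits : LoopSplits m m₁ m₂ S := by
  refine ⟨r, h.root, h.isLoop, ι ∘ Sum.inl, ι ∘ Sum.inr,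
    h.ins.embedsInRemoval Sum.inl_injective (fun _ => rfl) (fun _ => rfl) (fun _ => rfl),
    h.ins.embedsInRemoval Sum.inr_injective (fun _ => rfl) (fun _ => rfl) (fun _ => rfl),
    ?_, ?_, ?_, ?_, h.marked₁.imp fun _ _ => And.left, h.marked₂.imp fun _ _ => And.left⟩
  · rw [Set.disjoint_left]
    rintro _ ⟨y, rfl⟩ ⟨z, hz⟩
    simpa using h.ins.inj hz
  · rw [← h.ins.range_eq]
    ext x
    simp
  · have h1 := h.ins.R_r
    cases hr : m₁.root with
    | none =>
      rw [hr] at h1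
      exact (if_pos h1).symm
    | some y =>
      rw [hr] at h1
      have h1 : m.R r = ι (.inl y) := h1
      rw [if_neg (by rw [h1]; exact h.ins.ne_s _), h1]
      rfl
  · have h1 := h.ins.R_s
    cases hr : m₂.root with
    | none =>
      rw [hr] at h1
      exact (if_pos h1).symm
    | some y =>
      rw [hr] at h1
      have h1 : m.R (m.L r) = ι (.inr y) := h1
      rw [if_neg (by rw [h1]; exact h.ins.ne_r _), h1]
      rfl

lemma numEdges_eq : m.numEdges = m₁.numEdges + m₂.numEdges + 1 := by
  have h1 := h.ins.card_dart
  have h2 : Nat.card (m₁.Dart ⊕ m₂.Dart) = _ := Nat.card_sum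
  change _ = Nat.card (m₁.Dart ⊕ m₂.Dart) + 2 at h1
  have := m.two_mul_numEdges
  have := m₁.two_mul_numEdges
  have := m₂.two_mul_numEdges
  omega

lemma numWhite_eq : m.numWhite = m₁.numBlack + m₂.numWhite := by
  have h1 := h.ins.card_white_faces
  rw [PreMap.numColFaces_sum, PreMap.numColFaces_pre, PreMap.numColFaces_pre] at h1
  rw [m.numWhite_eq, m₂.numWhite_eq, SeqMap.numBlack, h1, h.root]
  simp [add_assoc]

lemma numBlack_eq : m.numBlack = m₁.numWhite + m₂.numBlack := by
  have h1 := h.ins.card_black_faces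
  rw [PreMap.numColFaces_sum, PreMap.numColFaces_pre, PreMap.numColFaces_pre] at h1
  rw [m₁.numWhite_eq, SeqMap.numBlack, h1, SeqMap.numBlack]
  simp only [Bool.xor_false, Option.map_eq_none_iff]
  omega

lemma rootDegree_eq : m.rootDegree = 2 + (m₁.rootDegree + m₂.rootDegree) := by
  have h1 := h.ins.ncard_orb_loop not_sameCycle_sum_root
  rw [m.rootDegree_eq, m₁.rootDegree_eq, m₂.rootDegree_eq, h.root, orbs_some, h1,
    ncard_orbs_sumCongr_inl, ncard_orbs_sumCongr_inr]

/-- The vertices off the loop are the non-root vertices of the two parts, and the two root vertices,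
conventional ones included, become one. -/
lemma numVertices_eq : m.numVertices + 1 = m₁.numVertices + m₂.numVertices := by
  classical
  have h1 := h.ins.card_freeAt
  rw [card_classes_sum] at h1
  rw [SeqMap.numVertices_of_root h.root, card_ne_ne (m.vertex r) (m.vertex (m.L r)),
    if_pos (show m.vertex r = m.vertex (m.L r) from h.isLoop), m₁.numVertices_eq, m₂.numVertices_eq]
  change Nat.card {v // FreeAt m r v} + 1 + 1 = _
  -- Avoiding the two root cycles is a property of the whole cycle, not of the representative.
  have e₁ : ∀ x y : m₁.Dart ⊕ m₂.Dart, Quotient.mk (Perm.SameCycle.setoid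
      (Perm.sumCongr m₁.R m₂.R)) x = Quotient.mk _ y →
      x ∉ orbs (Perm.sumCongr m₁.R m₂.R) (m₁.root.map Sum.inl) ∪
        orbs (Perm.sumCongr m₁.R m₂.R) (m₂.root.map Sum.inr) →
      y ∉ orbs (Perm.sumCongr m₁.R m₂.R) (m₁.root.map Sum.inl) ∪
        orbs (Perm.sumCongr m₁.R m₂.R) (m₂.root.map Sum.inr) := by
    intro x y hxy hx hy
    have hxy : (Perm.sumCongr m₁.R m₂.R).SameCycle x y := Quotient.exact hxy
    rcases hy with ⟨z, hz, hzy⟩ | ⟨z, hz, hzy⟩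
    · exact hx (.inl ⟨z, hz, hzy.trans hxy.symm⟩)
    · exact hx (.inr ⟨z, hz, hzy.trans hxy.symm⟩)
  rw [h1, add_add_add_comm, add_assoc]
  congr 1
  congr 1
  · refine Nat.card_congr (Equiv.subtypeEquivRight fun q => exists_congr fun y =>
      and_congr_right fun _ => ⟨?_, fun hy => ⟨.inl y, rfl, ?_⟩⟩)
    · rintro ⟨x, hx, hx'⟩ z hz hzy
      exact e₁ _ _ hx hx' (.inl ⟨.inl z, Option.mem_map_of_mem _ hz, sameCycle_sumCongr_inl.2 hzy⟩)
    · rintro (⟨z, hz, hzy⟩ | ⟨z, hz, hzy⟩)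
      · obtain ⟨w, hw, rfl⟩ := Option.map_eq_some_iff.1 hz
        exact hy w hw (sameCycle_sumCongr_inl.1 hzy)
      · obtain ⟨z, hz, rfl⟩ := Option.map_eq_some_iff.1 hz
        exact not_sameCycle_sumCongr hzy.symm
  · refine Nat.card_congr (Equiv.subtypeEquivRight fun q => exists_congr fun y =>
      and_congr_right fun _ => ⟨?_, fun hy => ⟨.inr y, rfl, ?_⟩⟩)
    · rintro ⟨x, hx, hx'⟩ z hz hzy
      exact e₁ _ _ hx hx' (.inr ⟨.inr z, Option.mem_map_of_mem _ hz, sameCycle_sumCongr_inr.2 hzy⟩)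
    · rintro (⟨z, hz, hzy⟩ | ⟨z, hz, hzy⟩)
      · obtain ⟨z, hz, rfl⟩ := Option.map_eq_some_iff.1 hz
        exact not_sameCycle_sumCongr hzy
      · obtain ⟨w, hw, rfl⟩ := Option.map_eq_some_iff.1 hz
        exact hy w hw (sameCycle_sumCongr_inr.1 hzy)

lemma euler_eq : m.euler = m₁.euler + m₂.euler - 2 := by
  have h1 := h.numVertices_eq
  have h2 := h.numEdges_eq
  have h3 := h.numWhite_eq
  have h4 := h.numBlack_eq
  simp only [SeqMap.euler, SeqMap.numFaces_eq]
  omega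

end Glues

namespace Ins

variable {m m' : SeqMap} {b : m'.Dart} {r : m.Dart} {ι : m'.Dart → m.Dart}
  (h : Ins m (m'.pre true) r m'.root (some b) ι)
include h

lemma numEdges_eq : m.numEdges = m'.numEdges + 1 := by
  have := h.card_dart
  have := m.two_mul_numEdges
  have := m'.two_mul_numEdges
  simp only at *
  omega

lemma numWhite_eq (hr : m.root = some r) : m.numWhite = m'.numBlack := by
  have h1 := h.card_white_faces
  rw [PreMap.numColFaces_pre] at h1
  rw [m.numWhite_eq, h1, hr, SeqMap.numBlack]
  simp

lemma numBlack_eq : m.numBlack = m'.numWhite := by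
  have h1 := h.card_black_faces
  rw [PreMap.numColFaces_pre] at h1
  rw [m'.numWhite_eq, SeqMap.numBlack, h1]
  simp

lemma card_freeAt_eq {a : m'.Dart} (ha : m'.root = some a) : Nat.card {v // FreeAt m r v} =
    Nat.card {v : m'.Vertex // v ≠ m'.vertex a ∧ v ≠ m'.vertex b} := by
  rw [h.card_freeAt]
  refine Nat.card_congr (Equiv.subtypeEquivRight fun q => ?_)
  obtain ⟨d, rfl⟩ := m'.exists_vertex q
  have key : ∀ y, y ∉ orbs m'.R m'.root ∪ orbs m'.R (some b) ↔
      m'.vertex y ≠ m'.vertex a ∧ m'.vertex y ≠ m'.vertex b := by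
    intro y
    rw [ha, orbs_some, orbs_some, Set.mem_union, not_or, mem_orb, mem_orb, Ne, Ne,
      CombMap.vertex_eq, CombMap.vertex_eq, Perm.sameCycle_comm, Perm.sameCycle_comm (x := b)]
  constructor
  · rintro ⟨y, h1, h2⟩
    have h1 : m'.vertex y = m'.vertex d := h1
    rw [← h1]
    exact (key y).1 h2
  · exact fun h1 => ⟨d, rfl, (key d).2 h1⟩

/-- Away from the ends of the edge on one side, and from the vertices of `a` and `b` on the other,
there are equally many vertices. Only the numbers of exceptional vertices, one or two on each side,
distinguish loops from links. -/
lemma euler_add_eq (hr : m.root = some r) {a : m'.Dart} (ha : m'.root = some a)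
    [Decidable (m.vertex r = m.vertex (m.L r))] [Decidable (m'.vertex a = m'.vertex b)] :
    m.euler + 1 + (if m'.vertex a = m'.vertex b then 1 else 2) =
      m'.euler + if m.vertex r = m.vertex (m.L r) then 1 else 2 := by
  have h1 := h.numEdges_eq
  have h2 := h.numWhite_eq hr
  have h3 := h.numBlack_eq
  have h4 := card_ne_ne (m.vertex r) (m.vertex (m.L r))
  have h5 := card_ne_ne (m'.vertex a) (m'.vertex b)
  have h6 := h.card_freeAt_eq ha
  have h7 : Nat.card {v // FreeAt m r v} = Nat.card {v : m.Vertex // v ≠ m.vertex r ∧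
    v ≠ m.vertex (m.L r)} := rfl
  simp only [SeqMap.euler, SeqMap.numFaces_eq, SeqMap.numVertices_of_root hr,
    SeqMap.numVertices_of_root ha]
  split_ifs at * <;> omega

lemma root_map : m'.root.map ι = some (m.R r) := by
  obtain ⟨a, ha⟩ := SeqMap.exists_root_of_dart b
  have := h.R_r
  rw [ha] at this
  rw [ha, this]
  rfl

end Ins

namespace Splits

variable {m m' : SeqMap} {b : m'.Dart} {r : m.Dart} {ι : m'.Dart → m.Dart}
  (h : Splits m m' b r ι)
include h

/-- `Splits` needs no separate hypothesis on cycles: the vertex of `b` is distinguished, hence is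
not the root vertex. -/
lemma separate (y z : m'.Dart) (hy : m'.root = some y) (hz : some b = some z) :
    ¬ m'.R.SameCycle y z := by
  obtain rfl := Option.some.inj hz
  obtain ⟨l, hl, -⟩ := h.marked
  intro h1
  refine m'.root_notMem_marked y hy ?_
  rw [hl, CombMap.vertex_eq.2 h1]
  exact List.mem_cons_self

lemma isLoop : IsLoop m r := CombMap.vertex_eq.2 (h.ins.loop h.separate)

lemma loopReduces : LoopReduces m m' := by
  obtain ⟨l, hl, hl'⟩ := h.marked
  obtain ⟨a, ha⟩ := SeqMap.exists_root_of_dart b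
  refine ⟨r, h.root, h.isLoop, ι, h.ins.embedsInRemoval (j := id) Function.injective_id
    (fun _ => rfl) (fun _ => rfl) (fun _ => rfl), h.ins.range_eq, h.ins.root_map,
    m'.vertex b, l, hl, ⟨b, rfl, h.ins.R_s.symm⟩, hl'.imp fun _ _ => And.left⟩

lemma euler_eq : m.euler = m'.euler - 2 := by
  classical
  obtain ⟨a, ha⟩ := SeqMap.exists_root_of_dart b
  have h1 := h.ins.euler_add_eq h.root ha
  rw [if_pos (show m.vertex r = m.vertex (m.L r) from h.isLoop), if_neg fun h' => h.separate a b ha rfl (CombMap.vertex_eq.1 h')] at h1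
  omega

lemma rootDegree_eq : m.rootDegree = 2 + (m'.rootDegree + m'.degree (m'.vertex b)) := by
  have h1 := h.ins.ncard_orb_loop h.separate
  rw [m.rootDegree_eq, m'.rootDegree_eq, h.root, orbs_some, h1, CombMap.degree_vertex, orbs_some]

end Splits

namespace Contracts

variable {m m' : SeqMap} {b : m'.Dart} {l : List m.Vertex} {r : m.Dart} {ι : m'.Dart → m.Dart}
  (h : Contracts m m' b l r ι)
include h

lemma not_isLoop : ¬ IsLoop m r := by
  obtain ⟨a, ha⟩ := SeqMap.exists_root_of_dart b
  exact fun h1 => (h.ins.link ha rfl (h.cycle a ha)).1 (CombMap.vertex_eq.1 h1)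

lemma linkReduces : LinkReduces m m' l := by
  obtain ⟨a, ha⟩ := SeqMap.exists_root_of_dart b
  exact ⟨r, h.root, h.not_isLoop, ι, h.ins.embedsInRemoval (j := id) Function.injective_id
    (fun _ => rfl) (fun _ => rfl) (fun _ => rfl), h.ins.range_eq, h.ins.root_map,
    h.marked.imp fun _ _ => And.left⟩

lemma euler_eq : m.euler = m'.euler := by
  classical
  obtain ⟨a, ha⟩ := SeqMap.exists_root_of_dart b
  have h1 := h.ins.euler_add_eq h.root ha
  rw [if_neg (show ¬ m.vertex r = m.vertex (m.L r) from h.not_isLoop), if_pos (CombMap.vertex_eq.2 (h.cycle a ha))] at h1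
  omega

lemma rootDegree_add_eq : m.rootDegree + m.degree (m.vertex (m.L r)) = 2 + m'.rootDegree := by
  obtain ⟨a, ha⟩ := SeqMap.exists_root_of_dart b
  have h1 := h.ins.ncard_orb_link ha rfl (h.cycle a ha)
  rw [m.rootDegree_eq, m'.rootDegree_eq, h.root, ha, orbs_some, orbs_some, ← h1,
    CombMap.degree_vertex]

/-- From `a` one first passes the darts of the root vertex of `m` other than `r`, one fewer than its
degree, and then arrives at `b`. So the root degree tells where to cut. -/
lemma eq_pow {a : m'.Dart} (ha : m'.root = some a) : b = (m'.R ^ (m.rootDegree - 1)) a := by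
  rw [m.rootDegree_eq, h.root, orbs_some]
  exact (h.ins.link ha rfl (h.cycle a ha)).2

end Contracts

end FaceBipartite

/-! ### Construction of maps: insertion, removal and components -/

namespace FaceBipartite
open Equiv

/-- Connected two-coloured permutations with a root of the right colour give a map. -/
lemma exists_seqMap {X : Type} [Finite X] (R L : Perm X) (c : X → Bool) (hL : ∀ x, L (L x) = x)
    (hcR : ∀ x, c (R x) = !c x) (hcL : ∀ x, c (L x) = !c x) (o : Option X)
    (ho : ∀ x ∈ o, c x = true)
    (hconn : ∀ y, ∃ x ∈ o, ∃ σ ∈ Subgroup.closure {R, L}, σ x = y) :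
    ∃ (m : SeqMap) (e : m.Dart ≃ X), (∀ d, e (m.R d) = R (e d)) ∧ (∀ d, e (m.L d) = L (e d)) ∧
      (∀ d, c (e d) = m.col d) ∧ m.root.map e = o ∧ m.marked = [] := by
  have hc : ∀ {x y : X}, (R * L).SameCycle x y → c x = c y :=
    sameCycle_invariant (P := R * L) fun x => by simp [hcR, hcL]
  refine ⟨{
    Dart := X
    finite_dart := inferInstance
    R := R
    L := L
    L_invol := hL
    L_ne := fun x hx => by
      have := hcL x
      rw [hx] at this
      cases h : c x <;> simp [h] at this
    transitive := fun x y => by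
      obtain ⟨x₀, h0, σ, hσ, rfl⟩ := hconn x
      obtain ⟨x₁, h1, τ, hτ, rfl⟩ := hconn y
      obtain rfl := Option.mem_unique h0 h1
      exact ⟨τ * σ⁻¹, mul_mem hτ (inv_mem hσ), by simp⟩
    root := o
    root_isSome := fun ⟨x⟩ => by
      obtain ⟨x₀, h0, -⟩ := hconn x
      exact Option.isSome_iff_exists.2 ⟨x₀, h0⟩
    isWhite := Quotient.lift c fun x y h => hc h
    isWhite_edge := fun x => by
      change c (L x) ≠ c x
      rw [hcL]
      cases c x <;> simp
    isWhite_root := ho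
    marked := []
    marked_nodup := List.nodup_nil
    root_notMem_marked := by simp }, Equiv.refl X, fun _ => rfl, fun _ => rfl, fun _ => rfl, ?_, rfl⟩
  cases o <;> rfl

/-- An edge can be inserted whenever the result is connected. -/
lemma exists_ins (P : PreMap) (a b : Option P.Dart) (ha : ∀ y ∈ a, P.col y = false)
    (hb : ∀ y ∈ b, P.col y = true)
    (conn : ∀ p : P.Dart → Prop, (∀ y ∈ a, p y) → (∀ y ∈ b, p y) → (∀ y, p y → p (P.R y)) →
      (∀ y, p y → p (P.L y)) → ∀ y, p y) :
    ∃ (m : SeqMap) (r : m.Dart) (ι : P.Dart → m.Dart), Ins m P r a b ι ∧ m.root = some r ∧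
      m.marked = [] := by
  classical
  let r : P.Dart ⊕ Bool := .inr true
  let s : P.Dart ⊕ Bool := .inr false
  -- The defaults express absence: `r` is then followed by `s` at its vertex, and in `b'` likewise
  -- `s` by `r`.
  let a' : P.Dart ⊕ Bool := a.elim s .inl
  let b' : P.Dart ⊕ Bool := b.elim r .inl
  let L : Perm (P.Dart ⊕ Bool) := Perm.sumCongr P.L Equiv.boolNot
  -- Initially `r` and `s` form a vertex of their own. The first transposition makes `r` lead to `a`
  -- and the predecessor of `a` to `s`; the second does the same for `s`, `b` and `r`. They do not
  -- interfere, as `s` and `a'` are black while `r` and `b'` are white.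
  let R : Perm (P.Dart ⊕ Bool) := swap r b' * swap s a' * Perm.sumCongr P.R Equiv.boolNot
  let c : P.Dart ⊕ Bool → Bool := Sum.elim P.col id
  have hca : c a' = false := by
    cases h : a with
    | none => simp [a', h, c, s]
    | some y => simpa [a', h, c] using ha y h
  have hcb : c b' = true := by
    cases h : b with
    | none => simp [b', h, c, r]
    | some y => simpa [b', h, c] using hb y h
  have hne : ∀ {x y}, c x ≠ c y → x ≠ y := fun h h' => h (congrArg c h')
  have hLr : L r = s := rfl
  have hRr : R r = a' := by
    change swap r b' (swap s a' s) = a'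
    rw [swap_apply_left, swap_apply_of_ne_of_ne (hne (by simp [hca, c, r]))
      (hne (by simp [hca, hcb]))]
  have hRs : R s = b' := by
    change swap r b' (swap s a' r) = b'
    rw [swap_apply_of_ne_of_ne (a := s) (b := a') (hne (by simp [c, s, r]))
      (hne (by simp [hca, c, r])), swap_apply_left]
  have hRa : ∀ y, a = some (P.R y) → R (.inl y) = s := by
    intro y hy
    have h1 : a' = .inl (P.R y) := by simp [a', hy]
    change swap r b' (swap s a' (.inl (P.R y))) = s
    rw [← h1, swap_apply_right, swap_apply_of_ne_of_ne (hne (by simp [c, s, r]))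
      (hne (by simp [hcb, c, s]))]
  have hRb : ∀ y, b = some (P.R y) → R (.inl y) = r := by
    intro y hy
    have h1 : b' = .inl (P.R y) := by simp [b', hy]
    change swap r b' (swap s a' (.inl (P.R y))) = r
    rw [← h1, swap_apply_of_ne_of_ne (a := s) (b := a') (hne (by simp [c, s, hcb]))
      (hne (by simp [hca, hcb])), swap_apply_right]
  have hRι : ∀ y, a ≠ some (P.R y) → b ≠ some (P.R y) → R (.inl y) = .inl (P.R y) := by
    intro y h1 h2
    change swap r b' (swap s a' (.inl (P.R y))) = .inl (P.R y)
    have h3 : (.inl (P.R y) : P.Dart ⊕ Bool) ≠ a' := by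
      cases h : a with
      | none => simp [a', h, s]
      | some y' =>
        rw [h] at h1
        simpa [a', h, eq_comm] using h1
    have h4 : (.inl (P.R y) : P.Dart ⊕ Bool) ≠ b' := by
      cases h : b with
      | none => simp [b', h, r]
      | some y' =>
        rw [h] at h2
        simpa [b', h, eq_comm] using h2
    rw [swap_apply_of_ne_of_ne (a := s) (b := a') (by simp [s]) h3,
      swap_apply_of_ne_of_ne (by simp [r]) h4]
  have hR : ∀ x, c (R x) = !c x := by
    rintro (y | x | x)
    · by_cases h1 : a = some (P.R y)
      · rw [hRa y h1]
        have := ha _ h1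
        rw [P.col_R] at this
        simpa [c, s] using this.symm
      by_cases h2 : b = some (P.R y)
      · rw [hRb y h2]
        have := hb _ h2
        rw [P.col_R] at this
        simpa [c, r] using this
      rw [hRι y h1 h2]
      simp [c, P.col_R]
    · change c (R s) = _
      rw [hRs, hcb]
      rfl
    · change c (R r) = _
      rw [hRr, hca]
      rfl
  have hconn : ∀ x, ∃ σ ∈ Subgroup.closure {R, L}, σ r = x := by
    have stepR : ∀ x, (∃ σ ∈ Subgroup.closure {R, L}, σ r = x) →
        ∃ σ ∈ Subgroup.closure {R, L}, σ r = R x := by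
      rintro _ ⟨σ, hσ, rfl⟩
      exact ⟨R * σ, mul_mem (Subgroup.subset_closure (by simp)) hσ, rfl⟩
    have stepL : ∀ x, (∃ σ ∈ Subgroup.closure {R, L}, σ r = x) →
        ∃ σ ∈ Subgroup.closure {R, L}, σ r = L x := by
      rintro _ ⟨σ, hσ, rfl⟩
      exact ⟨L * σ, mul_mem (Subgroup.subset_closure (by simp)) hσ, rfl⟩
    have h0 : ∃ σ ∈ Subgroup.closure {R, L}, σ r = r := ⟨1, one_mem _, rfl⟩
    have h1 : ∃ σ ∈ Subgroup.closure {R, L}, σ r = s := hLr ▸ stepL _ h0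
    have h2 := conn (fun y => ∃ σ ∈ Subgroup.closure {R, L}, σ r = .inl y)
      (fun y hy => by
        have h := stepR _ h0
        rw [hRr] at h
        simpa [a', Option.mem_def.1 hy] using h)
      (fun y hy => by
        have h := stepR _ h1
        rw [hRs] at h
        simpa [b', Option.mem_def.1 hy] using h)
      (fun y hy => by
        by_cases h3 : a = some (P.R y)
        · have h := stepR _ h0
          rw [hRr] at h
          simpa [a', h3] using h
        by_cases h4 : b = some (P.R y)
        · have h := stepR _ h1
          rw [hRs] at h
          simpa [b', h4] using h
        have h := stepR _ hy
        rwa [hRι y h3 h4] at h)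
      (fun y hy => stepL _ hy)
    rintro (y | x | x)
    · exact h2 y
    · exact h1
    · exact h0
  obtain ⟨m, e, eR, eL, ec, er, em⟩ := exists_seqMap R L c
    (by rintro (y | x) <;> simp [L, P.L_invol]) hR
    (by rintro (y | x) <;> simp [L, c, P.col_L]) (some r) (by simp [c, r])
    (fun x => ⟨r, rfl, hconn x⟩)
  have eR' : ∀ x, m.R (e.symm x) = e.symm (R x) := fun x => by
    rw [Equiv.eq_symm_apply, eR, Equiv.apply_symm_apply]
  have eL' : ∀ x, m.L (e.symm x) = e.symm (L x) := fun x => by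
    rw [Equiv.eq_symm_apply, eL, Equiv.apply_symm_apply]
  have ec' : ∀ x, m.col (e.symm x) = c x := fun x => by rw [← ec, Equiv.apply_symm_apply]
  have hs : m.L (e.symm r) = e.symm s := by rw [eL', hLr]
  refine ⟨m, e.symm r, fun y => e.symm (.inl y), ?_, ?_, em⟩
  · exact
      { inj := e.symm.injective.comp Sum.inl_injective
        ne_r := fun y => e.symm.injective.ne (by simp [r])
        ne_s := fun y => by
          rw [hs]
          exact e.symm.injective.ne (by simp [s])
        cover := fun x => by
          rw [hs]
          obtain ⟨x, rfl⟩ := e.symm.surjective x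
          rcases x with y | x | x
          · exact .inr (.inr ⟨y, rfl⟩)
          · exact .inr (.inl rfl)
          · exact .inl rfl
        map_L := fun y => by rw [eL']; rfl
        col_r := by rw [ec']; rfl
        map_col := fun y => by rw [ec']; rfl
        R_r := by rw [eR', hs, hRr]; cases h : a <;> simp [a', h]
        R_s := by rw [hs, eR', hRs]; cases h : b <;> simp [b', h]
        R_a := fun y hy => by rw [eR', hRa y hy, hs]
        R_b := fun y hy => by rw [eR', hRb y hy]
        R_ι := fun y hy hy' => by rw [eR', hRι y hy hy'] }
  · rcases h : m.root with _ | x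
    · simp [h] at er
    · rw [h] at er
      simp only [Option.map_some, Option.some.injEq] at er
      rw [← er, Equiv.symm_apply_apply]

/-- The edge of a white dart can be removed. -/
lemma exists_removal (m : SeqMap) (r : m.Dart) (hr : m.col r = true) :
    ∃ (P : PreMap) (a b : Option P.Dart) (ι : P.Dart → m.Dart), Ins m P r a b ι := by
  classical
  have hs : m.col (m.L r) = false := by rw [m.col_L, hr]; rfl
  let Y := {d : m.Dart // d ≠ r ∧ d ≠ m.L r}
  -- Colours forbid fixed points of `R`. With injectivity this ensures that one skip over `r` or `L
  -- r` already lands on a remaining dart.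
  have hRr : m.R r ≠ r := fun h => by
    have := m.col_R r
    rw [h, hr] at this
    simp at this
  have hRs : m.R (m.L r) ≠ m.L r := fun h => by
    have := m.col_R (m.L r)
    rw [h, hs] at this
    simp at this
  let f : Y → Y := fun d =>
    if h1 : m.R d.1 = r then ⟨m.R (m.L r), fun h => d.2.2 (m.R.injective (h1.trans h.symm)), hRs⟩
    else if h2 : m.R d.1 = m.L r then
      ⟨m.R r, hRr, fun h => d.2.1 (m.R.injective (h2.trans h.symm))⟩
    else ⟨m.R d.1, h1, h2⟩
  have hf1 : ∀ d : Y, m.R d.1 = r → (f d).1 = m.R (m.L r) := fun d h => by simp [f, h]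
  have hf2 : ∀ d : Y, m.R d.1 = m.L r → (f d).1 = m.R r := fun d h => by
    simp [f, h, m.L_ne]
  have hf3 : ∀ d : Y, m.R d.1 ≠ r → m.R d.1 ≠ m.L r → (f d).1 = m.R d.1 := fun d h h' => by
    simp [f, h, h']
  have hinj : Function.Injective f := by
    intro d d' hdd
    have h := congrArg Subtype.val hdd
    apply Subtype.ext
    apply m.R.injective
    by_cases h1 : m.R d.1 = r <;> by_cases h1' : m.R d'.1 = r
    · rw [h1, h1']
    · by_cases h2' : m.R d'.1 = m.L r
      · rw [hf1 d h1, hf2 d' h2'] at h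
        exact absurd (m.R.injective h) (m.L_ne r)
      · rw [hf1 d h1, hf3 d' h1' h2'] at h
        exact absurd (m.R.injective h).symm d'.2.2
    · by_cases h2 : m.R d.1 = m.L r
      · rw [hf1 d' h1', hf2 d h2] at h
        exact absurd (m.R.injective h).symm (m.L_ne r)
      · rw [hf1 d' h1', hf3 d h1 h2] at h
        exact absurd (m.R.injective h) d.2.2
    · by_cases h2 : m.R d.1 = m.L r <;> by_cases h2' : m.R d'.1 = m.L r
      · rw [h2, h2']
      · rw [hf2 d h2, hf3 d' h1' h2'] at h
        exact absurd (m.R.injective h).symm d'.2.1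
      · rw [hf2 d' h2', hf3 d h1 h2] at h
        exact absurd (m.R.injective h) d.2.1
      · rw [hf3 d h1 h2, hf3 d' h1' h2'] at h
        exact h
  let P : PreMap :=
    { Dart := Y
      finite_dart := inferInstance
      R := Equiv.ofBijective f (Finite.injective_iff_bijective.1 hinj)
      L := m.L.subtypePerm fun d => by
        have h1 : m.L d = m.L r ↔ d = r := m.L.injective.eq_iff
        have h2 : m.L d = r ↔ d = m.L r := by rw [← m.L.injective.eq_iff, m.L_invol]
        simp only [ne_eq, h1, h2, and_comm]
      col := fun d => m.col d.1
      L_invol := fun d => Subtype.ext (m.L_invol d.1)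
      col_R := fun d => by
        change m.col (f d).1 = _
        by_cases h1 : m.R d.1 = r
        · have := m.col_R d.1
          rw [h1, hr] at this
          rw [hf1 d h1, m.col_R, hs]
          exact this
        by_cases h2 : m.R d.1 = m.L r
        · have := m.col_R d.1
          rw [h2, hs] at this
          rw [hf2 d h2, m.col_R, hr]
          exact this
        rw [hf3 d h1 h2, m.col_R]
      col_L := fun d => m.col_L d.1 }
  have hPR : ∀ d : Y, P.R d = f d := fun _ => rfl
  refine ⟨P, if h : m.R r = m.L r then none else some ⟨m.R r, hRr, h⟩,
    if h : m.R (m.L r) = r then none else some ⟨m.R (m.L r), h, hRs⟩, Subtype.val, ?_⟩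
  have hstep : ∀ d : Y, m.R d.1 = r ∧ (f d).1 = m.R (m.L r) ∨
      m.R d.1 = m.L r ∧ (f d).1 = m.R r ∨ (f d).1 = m.R d.1 ∧ m.R d.1 ≠ r ∧ m.R d.1 ≠ m.L r := by
    intro d
    by_cases h1 : m.R d.1 = r
    · exact .inl ⟨h1, hf1 d h1⟩
    by_cases h2 : m.R d.1 = m.L r
    · exact .inr (.inl ⟨h2, hf2 d h2⟩)
    exact .inr (.inr ⟨hf3 d h1 h2, h1, h2⟩)
  exact
    { inj := Subtype.val_injective
      ne_r := fun y => y.2.1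
      ne_s := fun y => y.2.2
      cover := fun x => by
        by_cases h1 : x = r
        · exact .inl h1
        by_cases h2 : x = m.L r
        · exact .inr (.inl h2)
        exact .inr (.inr ⟨⟨x, h1, h2⟩, rfl⟩)
      map_L := fun y => rfl
      col_r := hr
      map_col := fun y => rfl
      R_r := by split_ifs with h <;> simp [h]
      R_s := by split_ifs with h <;> simp [h]
      R_a := fun y hy => by
        split_ifs at hy with h
        have h1 : m.R r = (f y).1 := congrArg Subtype.val (Option.some.inj hy)
        rcases hstep y with ⟨-, h3⟩ | ⟨h2, -⟩ | ⟨h3, -⟩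
        · exact absurd (m.R.injective (h1.trans h3)).symm (m.L_ne r)
        · exact h2
        · exact absurd (m.R.injective (h1.trans h3)).symm y.2.1
      R_b := fun y hy => by
        split_ifs at hy with h
        have h1 : m.R (m.L r) = (f y).1 := congrArg Subtype.val (Option.some.inj hy)
        rcases hstep y with ⟨h2, -⟩ | ⟨-, h3⟩ | ⟨h3, -⟩
        · exact h2
        · exact absurd (m.R.injective (h1.trans h3)) (m.L_ne r)
        · exact absurd (m.R.injective (h1.trans h3)).symm y.2.2
      R_ι := fun y hy hy' => by
        rw [hPR] at hy hy'
        rcases hstep y with ⟨-, h3⟩ | ⟨-, h3⟩ | ⟨h3, -⟩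
        · refine absurd ?_ hy'
          rw [dif_neg (fun h => (f y).2.1 (h3.trans h))]
          exact congrArg some (Subtype.ext h3.symm)
        · refine absurd ?_ hy
          rw [dif_neg (fun h => (f y).2.2 (h3.trans h))]
          exact congrArg some (Subtype.ext h3.symm)
        · exact h3.symm }

/-- The darts of `P` that can be reached from the dart in `o`. -/
def reach (P : PreMap) (o : Option P.Dart) : Set P.Dart :=
  {y | ∃ x ∈ o, ∃ σ ∈ Subgroup.closure {P.R, P.L}, σ x = y}

lemma reach_R {P : PreMap} {o : Option P.Dart} {y : P.Dart} : P.R y ∈ reach P o ↔ y ∈ reach P o := by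
  constructor
  · rintro ⟨x, hx, σ, hσ, h⟩
    exact ⟨x, hx, P.R⁻¹ * σ, mul_mem (inv_mem (Subgroup.subset_closure (by simp))) hσ,
      by simp [h]⟩
  · rintro ⟨x, hx, σ, hσ, rfl⟩
    exact ⟨x, hx, P.R * σ, mul_mem (Subgroup.subset_closure (by simp)) hσ, rfl⟩

lemma reach_L {P : PreMap} {o : Option P.Dart} {y : P.Dart} : P.L y ∈ reach P o ↔ y ∈ reach P o := by
  constructor
  · rintro ⟨x, hx, σ, hσ, h⟩
    exact ⟨x, hx, P.L⁻¹ * σ, mul_mem (inv_mem (Subgroup.subset_closure (by simp))) hσ,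
      by simp [h]⟩
  · rintro ⟨x, hx, σ, hσ, rfl⟩
    exact ⟨x, hx, P.L * σ, mul_mem (Subgroup.subset_closure (by simp)) hσ, rfl⟩

lemma mem_reach {P : PreMap} {o : Option P.Dart} {y : P.Dart} (hy : y ∈ o) : y ∈ reach P o :=
  ⟨y, hy, 1, one_mem _, rfl⟩

/-- A connected component as a rooted map. -/
lemma exists_component (P : PreMap) (o : Option P.Dart) (sw : Bool)
    (ho : ∀ x ∈ o, (sw ^^ P.col x) = true) :
    ∃ (m : SeqMap) (j : m.Dart → P.Dart), Function.Injective j ∧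
      (∀ d, j (m.R d) = P.R (j d)) ∧ (∀ d, j (m.L d) = P.L (j d)) ∧
      (∀ d, P.col (j d) = xor sw (m.col d)) ∧ m.root.map j = o ∧ m.marked = [] ∧
      Set.range j = reach P o := by
  let R : Perm (reach P o) := P.R.subtypePerm fun _ => reach_R
  let L : Perm (reach P o) := P.L.subtypePerm fun _ => reach_L
  -- On the component, each element of the big group acts at a given dart like some element
  -- generated by the restricted permutations; the latter may depend on the dart.
  have hcl : ∀ σ ∈ Subgroup.closure {P.R, P.L}, ∀ x : reach P o,
      ∃ τ ∈ Subgroup.closure {R, L}, (τ x).1 = σ x.1 := by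
    intro σ hσ
    induction hσ using Subgroup.closure_induction with
    | mem σ hσ =>
      intro x
      rcases hσ with rfl | rfl
      · exact ⟨R, Subgroup.subset_closure (by simp), rfl⟩
      · exact ⟨L, Subgroup.subset_closure (by simp), rfl⟩
    | one => exact fun x => ⟨1, one_mem _, rfl⟩
    | mul σ τ _ _ ihσ ihτ =>
      intro x
      obtain ⟨τ', hτ', h1⟩ := ihτ x
      obtain ⟨σ', hσ', h2⟩ := ihσ (τ' x)
      exact ⟨σ' * τ', mul_mem hσ' hτ', by rw [Perm.mul_apply, h2, h1, Perm.mul_apply]⟩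
    | inv σ hσ ih =>
      intro x
      have hx : σ⁻¹ x.1 ∈ reach P o := by
        obtain ⟨x₀, h0, τ, hτ, h1⟩ := x.2
        exact ⟨x₀, h0, σ⁻¹ * τ, mul_mem (inv_mem hσ) hτ, by rw [Perm.mul_apply, h1]⟩
      obtain ⟨τ, hτ, h1⟩ := ih ⟨_, hx⟩
      refine ⟨τ⁻¹, inv_mem hτ, ?_⟩
      have h2 : τ ⟨_, hx⟩ = x := Subtype.ext (by rw [h1]; simp)
      rw [Perm.inv_eq_iff_eq.2 h2.symm]
  let o' : Option (reach P o) := o.pmap Subtype.mk fun x hx => mem_reach hx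
  have ho' : o'.map Subtype.val = o := by
    simp only [o', Option.map_pmap, Option.pmap_eq_map, Option.map_id']
  obtain ⟨m, e, eR, eL, ec, er, em⟩ := exists_seqMap R L (fun x => xor sw (P.col x.1))
    (fun x => Subtype.ext (P.L_invol x.1))
    (fun x => by
      change xor sw (P.col (P.R x.1)) = _
      simp [P.col_R])
    (fun x => by
      change xor sw (P.col (P.L x.1)) = _
      simp [P.col_L]) o'
    (fun x hx => ho x.1 (by
      have := Option.mem_map_of_mem Subtype.val hx
      rwa [ho'] at this))
    (fun y => by
      obtain ⟨x₀, h0, σ, hσ, h1⟩ := y.2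
      obtain ⟨τ, hτ, h2⟩ := hcl σ hσ ⟨x₀, mem_reach h0⟩
      have h3 : x₀ ∈ o'.map Subtype.val := by rwa [ho']
      obtain ⟨x, hx, rfl⟩ := Option.map_eq_some_iff.1 h3
      exact ⟨x, hx, τ, hτ, Subtype.ext (h2.trans h1)⟩)
  refine ⟨m, fun d => (e d).1, Subtype.val_injective.comp e.injective, fun d => ?_, fun d => ?_,
    fun d => ?_, ?_, em, ?_⟩
  · exact congrArg Subtype.val (eR d)
  · exact congrArg Subtype.val (eL d)
  · rw [← ec]; simp
  · have := congrArg (Option.map Subtype.val) er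
    rw [Option.map_map, ho'] at this
    exact this
  · ext y
    constructor
    · rintro ⟨d, rfl⟩
      exact (e d).2
    · exact fun hy => ⟨e.symm ⟨y, hy⟩, by simp⟩

end FaceBipartite

/-! ### Compatibility with isomorphism -/

namespace FaceBipartite
open Equiv SeqMap

lemma exists_sumCongr {α β α' β' : Type*} (e : α ⊕ β ≃ α' ⊕ β')
    (h : ∀ y, ∃ z, e (.inl y) = .inl z) (h' : ∀ z, ∃ y, e.symm (.inl z) = .inl y) :
    ∃ (e₁ : α ≃ α') (e₂ : β ≃ β'), e = Equiv.sumCongr e₁ e₂ := by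
  have k : ∀ y, ∃ z, e (.inr y) = .inr z := by
    intro y
    rcases hy : e (.inr y) with z | z
    · obtain ⟨x, hx⟩ := h' z
      rw [← hy, Equiv.symm_apply_apply] at hx
      cases hx
    · exact ⟨z, rfl⟩
  have k' : ∀ z, ∃ y, e.symm (.inr z) = .inr y := by
    intro z
    rcases hz : e.symm (.inr z) with y | y
    · obtain ⟨x, hx⟩ := h y
      rw [← hz, Equiv.apply_symm_apply] at hx
      cases hx
    · exact ⟨y, rfl⟩
  choose f hf using h
  choose f' hf' using h'
  choose g hg using k
  choose g' hg' using k'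
  refine ⟨⟨f, f', fun y => ?_, fun z => ?_⟩, ⟨g, g', fun y => ?_, fun z => ?_⟩, ?_⟩
  · exact Sum.inl_injective (by rw [← hf', ← hf, Equiv.symm_apply_apply])
  · exact Sum.inl_injective (by rw [← hf, ← hf', Equiv.apply_symm_apply])
  · exact Sum.inr_injective (by rw [← hg', ← hg, Equiv.symm_apply_apply])
  · exact Sum.inr_injective (by rw [← hg, ← hg', Equiv.apply_symm_apply])
  · ext (y | y)
    · exact hf y
    · exact hg y

/-- The left part is connected and its root goes to the left, so all of it does. Applied to an
equivalence and its inverse, this yields the hypotheses of `exists_sumCongr`. -/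
lemma map_inl_of_root {m m' : SeqMap} {P P' : PreMap} (e : m.Dart ⊕ P.Dart → m'.Dart ⊕ P'.Dart)
    (hR : ∀ y, e (Perm.sumCongr m.R P.R y) = Perm.sumCongr m'.R P'.R (e y))
    (hL : ∀ y, e (Perm.sumCongr m.L P.L y) = Perm.sumCongr m'.L P'.L (e y))
    (hr : (m.root.map Sum.inl).map e = m'.root.map Sum.inl) (y : m.Dart) :
    ∃ z, e (.inl y) = .inl z := by
  obtain ⟨a, ha⟩ := SeqMap.exists_root_of_dart y
  refine CombMap.dart_induction (m := m.toCombMap) (p := fun y => ∃ z, e (.inl y) = .inl z) (x := a)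
    ?_ ?_ ?_ y
  · rw [ha] at hr
    obtain ⟨z, -, hz⟩ := Option.map_eq_some_iff.1 hr.symm
    exact ⟨z, hz.symm⟩
  · rintro d ⟨z, hz⟩
    exact ⟨m'.R z, (hR (.inl d)).trans (by rw [hz]; rfl)⟩
  · rintro d ⟨z, hz⟩
    exact ⟨m'.L z, (hL (.inl d)).trans (by rw [hz]; rfl)⟩

section Correspondence

variable {m n m' m'' : SeqMap}

lemma Ins.notMem_of_corr {sw : Bool} {r : m.Dart} {a b : Option m'.Dart} {ι : m'.Dart → m.Dart}
    (h : Ins m (m'.pre sw) r a b ι) {d : m'.Dart} {v : m.Vertex}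
    (hv : FreeCorr r ι (m'.vertex d) v) : d ∉ orbs m'.R a ∪ orbs m'.R b := by
  refine (h.freeAt_iff d).1 ?_
  rw [(h.cycleEmb.corr_iff hv d).1 rfl]
  exact hv.2

lemma CycleEmb.vertexCorr_target {r : m.Dart} {s : n.Dart} {j : m'.Dart → m.Dart}
    {κ : m'.Dart → n.Dart} (h : CycleEmb n m' s κ) {φ : m.Dart → n.Dart}
    (hφ : ∀ y, φ (j y) = κ y) {v' : m'.Vertex} {v : m.Vertex} {w : n.Vertex}
    (hv : FreeCorr r j v' v) (hw : FreeCorr s κ v' w) : VertexCorr φ v w := by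
  obtain ⟨⟨x, h1, h2⟩, -⟩ := hv
  exact ⟨j x, h2, by rw [hφ]; exact (h.corr_iff hw x).1 h1⟩

lemma CycleEmb.vertexCorr_source {r : m.Dart} {j : m'.Dart → m.Dart} {κ : m''.Dart → m.Dart}
    (h : CycleEmb m m'' r κ) {e : m'.Dart → m''.Dart} (he : ∀ y, κ (e y) = j y) {v' : m'.Vertex}
    {w' : m''.Vertex} {v : m.Vertex} (hv : FreeCorr r j v' v) (hw : FreeCorr r κ w' v) :
    VertexCorr e v' w' := by
  obtain ⟨⟨x, h1, h2⟩, -⟩ := hv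
  exact ⟨x, h1, (h.corr_iff hw (e x)).2 (by rw [he, h2])⟩

lemma CycleEmb.comp_iso {r : m.Dart} {j : m'.Dart → m.Dart} (h : CycleEmb m m' r j)
    {ψ : m''.Dart → m'.Dart} {v'' : m''.Vertex} {v' : m'.Vertex} {v : m.Vertex}
    (hv'' : VertexCorr ψ v'' v') (hv : FreeCorr r j v' v) : FreeCorr r (j ∘ ψ) v'' v := by
  obtain ⟨x, h1, h2⟩ := hv''
  exact ⟨⟨x, h1, (h.corr_iff hv (ψ x)).1 h2⟩, hv.2⟩

lemma root_map_of_eq {φ : m.Dart → n.Dart} {r : m.Dart} {s : n.Dart} (hm : m.root = some r)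
    (hn : n.root = some s) (h : φ r = s) : m.root.map φ = n.root := by
  rw [hm, hn, ← h]
  rfl

lemma Ins.comap_iso {r : m.Dart} {a b : Option m'.Dart} {ι : m'.Dart → m.Dart} {sw : Bool}
    (h : Ins m (m'.pre sw) r a b ι) {ψ : m''.Dart ≃ m'.Dart} (hψ : IsIso m'' m' ψ)
    {a' b' : Option m''.Dart} (ha : a'.map ψ = a) (hb : b'.map ψ = b) :
    Ins m (m''.pre sw) r a' b' (ι ∘ ψ) :=
  h.comap (P' := m''.pre sw) ψ hψ.map_R hψ.map_L (fun y => by simp [hψ.col]) ha hb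

end Correspondence

namespace Glues

variable {m n m₁ m₂ m₁' m₂' : SeqMap} {S S' : Finset ℕ} {r : m.Dart}
  {ι : m₁.Dart ⊕ m₂.Dart → m.Dart} (h : Glues m m₁ m₂ S r ι)
include h

lemma map_iso {φ : m.Dart ≃ n.Dart} (hφ : IsIso m n φ) : Glues n m₁ m₂ S (φ r) (φ ∘ ι) where
  root := by rw [← hφ.map_root, h.root]; rfl
  ins := h.ins.map_iso hφ
  subset := by rw [← hφ.map_marked.length_eq]; exact h.subset
  marked₁ := by
    refine forall₂_trans (fun _ _ _ h1 h2 => ?_) h.marked₁ (forall₂_pick hφ.map_marked S)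
    exact hφ.freeCorr h1 h2
  marked₂ := by
    rw [← hφ.map_marked.length_eq]
    refine forall₂_trans (fun _ _ _ h1 h2 => ?_) h.marked₂ (forall₂_pick hφ.map_marked _)
    exact hφ.freeCorr h1 h2

lemma comap_iso {ψ₁ : m₁'.Dart ≃ m₁.Dart} {ψ₂ : m₂'.Dart ≃ m₂.Dart} (h₁ : IsIso m₁' m₁ ψ₁)
    (h₂ : IsIso m₂' m₂ ψ₂) : Glues m m₁' m₂' S r (ι ∘ Sum.map ψ₁ ψ₂) where
  root := h.root
  ins := by
    refine h.ins.comap (P' := (m₁'.pre true).sum (m₂'.pre false)) (Equiv.sumCongr ψ₁ ψ₂)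
      ?_ ?_ ?_ ?_ ?_
    · rintro (y | y)
      · exact congrArg Sum.inl (h₁.map_R y)
      · exact congrArg Sum.inr (h₂.map_R y)
    · rintro (y | y)
      · exact congrArg Sum.inl (h₁.map_L y)
      · exact congrArg Sum.inr (h₂.map_L y)
    · rintro (y | y)
      · simp [h₁.col]
      · simp [h₂.col]
    · rw [← h₁.map_root]
      cases m₁'.root <;> rfl
    · rw [← h₂.map_root]
      cases m₂'.root <;> rfl
  subset := h.subset
  marked₁ := by
    refine forall₂_trans (fun _ _ _ h1 h2 => ?_) h₁.map_marked h.marked₁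
    exact h.ins.cycleEmb_inl.comp_iso h1 h2
  marked₂ := by
    refine forall₂_trans (fun _ _ _ h1 h2 => ?_) h₂.map_marked h.marked₂
    exact h.ins.cycleEmb_inr.comp_iso h1 h2

lemma target_equiv {s : n.Dart} {κ : m₁.Dart ⊕ m₂.Dart → n.Dart} (h' : Glues n m₁ m₂ S s κ)
    (hl : m.marked.length = n.marked.length) : m ≈ n := by
  obtain ⟨φ, hr, hι, hR, hL, hc⟩ := h.ins.target_unique h'.ins
  refine ⟨φ, hR, hL, root_map_of_eq h.root h'.root hr, hc, forall₂_of_pick (S := S) hl ?_ ?_⟩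
  · refine forall₂_trans (fun v v' w h1 h2 => ?_) (rel := fun v v' => FreeCorr r (ι ∘ Sum.inl) v' v)
      h.marked₁.flip h'.marked₁
    exact h'.ins.cycleEmb_inl.vertexCorr_target (fun y => hι (.inl y)) h1 h2
  · refine forall₂_trans (fun v v' w h1 h2 => ?_) (rel := fun v v' => FreeCorr r (ι ∘ Sum.inr) v' v)
      h.marked₂.flip h'.marked₂
    exact h'.ins.cycleEmb_inr.vertexCorr_target (fun y => hι (.inr y)) h1 h2

/-- This describes `S` by the left part of the map alone, so that the decomposition determines `S`.
-/
lemma mem_iff {i : ℕ} {v : m.Vertex} (hi : m.marked[i]? = some v) :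
    i ∈ S ↔ ∃ y, m.vertex (ι (.inl y)) = v := by
  have hlt : i < m.marked.length := (List.getElem?_eq_some_iff.1 hi).1
  constructor
  · intro hS
    obtain ⟨v₁, -, ⟨d, -, h1⟩, -⟩ := forall₂_exists_left h.marked₁ (mem_pick.2 ⟨i, hS, hi⟩)
    exact ⟨d, h1⟩
  · rintro ⟨y, hy⟩
    by_contra hS
    obtain ⟨v₂, -, h2⟩ := forall₂_exists_left h.marked₂ (mem_pick.2 ⟨i, by simp [hS, hlt], hi⟩)
    exact h.ins.not_corr_both ⟨⟨y, rfl, hy⟩, h2.2⟩ h2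

/-- The parts are determined by the map. -/
lemma source_equiv {s : m.Dart} {κ : m₁'.Dart ⊕ m₂'.Dart → m.Dart}
    (h' : Glues m m₁' m₂' S' s κ) : m₁ ≈ m₁' ∧ m₂ ≈ m₂' ∧ S = S' := by
  obtain rfl : r = s := Option.some.inj (h.root.symm.trans h'.root)
  obtain ⟨e, he, hR, hL, hc, ha, hb⟩ := h.ins.source_unique h'.ins
  have hR' : ∀ y, e.symm (Perm.sumCongr m₁'.R m₂'.R y) = Perm.sumCongr m₁.R m₂.R (e.symm y) :=
    fun y => by rw [Equiv.symm_apply_eq]; exact ((hR _).trans (by rw [e.apply_symm_apply])).symm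
  have hL' : ∀ y, e.symm (Perm.sumCongr m₁'.L m₂'.L y) = Perm.sumCongr m₁.L m₂.L (e.symm y) :=
    fun y => by rw [Equiv.symm_apply_eq]; exact ((hL _).trans (by rw [e.apply_symm_apply])).symm
  obtain ⟨e₁, e₂, rfl⟩ := exists_sumCongr e
    (map_inl_of_root (P := m₂.pre false) (P' := m₂'.pre false) e hR hL ha)
    (map_inl_of_root (P := m₂'.pre false) (P' := m₂.pre false) e.symm hR' hL' (by
      rw [← ha, Option.map_map]
      cases m₁.root <;> simp))
  have hS : S = S' := by
    ext i
    by_cases hi : i < m.marked.length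
    · have hi' := List.getElem?_eq_getElem hi
      rw [h.mem_iff hi', h'.mem_iff hi']
      constructor
      · rintro ⟨y, hy⟩
        exact ⟨e₁ y, by rw [← hy]; exact congrArg _ (he (.inl y))⟩
      · rintro ⟨y, hy⟩
        refine ⟨e₁.symm y, ?_⟩
        rw [← hy, ← he (.inl (e₁.symm y))]
        simp
    · exact iff_of_false (fun h1 => hi (by simpa using h.subset h1))
        (fun h1 => hi (by simpa using h'.subset h1))
  subst hS
  refine ⟨⟨e₁, fun d => Sum.inl_injective (hR (.inl d)), fun d => Sum.inl_injective (hL (.inl d)),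
    ?_, fun d => ?_, ?_⟩, ⟨e₂, fun d => Sum.inr_injective (hR (.inr d)),
    fun d => Sum.inr_injective (hL (.inr d)), ?_, fun d => ?_, ?_⟩, rfl⟩
  · apply Option.map_injective (Sum.inl_injective (β := m₂'.Dart))
    rw [← ha]
    cases m₁.root <;> rfl
  · have : m₁'.col (e₁ d) = m₁.col d := by simpa using hc (.inl d)
    exact this
  · refine forall₂_trans (fun v v' w h1 h2 => ?_) h.marked₁
      (rel' := fun v v' => FreeCorr r (κ ∘ Sum.inl) v' v) h'.marked₁.flip
    exact h'.ins.cycleEmb_inl.vertexCorr_source (fun y => he (.inl y)) h1 h2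
  · apply Option.map_injective (Sum.inr_injective (α := m₁'.Dart))
    rw [← hb]
    cases m₂.root <;> rfl
  · have : m₂'.col (e₂ d) = m₂.col d := by simpa using hc (.inr d)
    exact this
  · refine forall₂_trans (fun v v' w h1 h2 => ?_) h.marked₂
      (rel' := fun v v' => FreeCorr r (κ ∘ Sum.inr) v' v) h'.marked₂.flip
    exact h'.ins.cycleEmb_inr.vertexCorr_source (fun y => he (.inr y)) h1 h2

/-- Removing a separating loop does not leave a connected map. -/
lemma not_splits {m' : SeqMap} {b : m'.Dart} {s : m.Dart} {κ : m'.Dart → m.Dart}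
    (h' : Splits m m' b s κ) : False := by
  obtain rfl : r = s := Option.some.inj (h.root.symm.trans h'.root)
  obtain ⟨e, he, hR, hL, hc, ha, hb⟩ := h'.ins.source_unique h.ins
  obtain ⟨z, -, hz⟩ := Option.map_eq_some_iff.1 hb.symm
  obtain ⟨a, ha'⟩ := SeqMap.exists_root_of_dart b
  rw [ha'] at ha
  obtain ⟨y, -, hy⟩ := Option.map_eq_some_iff.1 ha.symm
  -- The root of the connected map `m'` corresponds to a left dart, hence all its darts do; but `b`
  -- corresponds to a right dart.
  have := CombMap.dart_induction (m := m'.toCombMap)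
    (p := fun d => ∃ y, e d = .inl y) (x := a) ⟨y, hy.symm⟩
    (by
      rintro d ⟨y, hy⟩
      exact ⟨m₁.R y, (hR d).trans (by rw [hy]; rfl)⟩)
    (by
      rintro d ⟨y, hy⟩
      exact ⟨m₁.L y, (hL d).trans (by rw [hy]; rfl)⟩) b
  obtain ⟨y, hy⟩ := this
  rw [← hz] at hy
  cases hy

end Glues

namespace Splits

variable {m n m' m'' : SeqMap} {b : m'.Dart} {r : m.Dart} {ι : m'.Dart → m.Dart}
  (h : Splits m m' b r ι)
include h

lemma map_iso {φ : m.Dart ≃ n.Dart} (hφ : IsIso m n φ) : Splits n m' b (φ r) (φ ∘ ι) where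
  root := by rw [← hφ.map_root, h.root]; rfl
  ins := h.ins.map_iso hφ
  marked := by
    obtain ⟨l, hl, hl'⟩ := h.marked
    refine ⟨l, hl, forall₂_trans (fun _ _ _ h1 h2 => ?_) hl' hφ.map_marked⟩
    exact hφ.freeCorr h1 h2

lemma comap_iso {ψ : m''.Dart ≃ m'.Dart} (hψ : IsIso m'' m' ψ) :
    Splits m m'' (ψ.symm b) r (ι ∘ ψ) where
  root := h.root
  ins := h.ins.comap_iso hψ hψ.map_root (by simp)
  marked := by
    obtain ⟨l, hl, hl'⟩ := h.marked
    have h1 := hψ.map_marked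
    rw [hl] at h1
    obtain ⟨v, l'', hv, hl'', h2⟩ := List.forall₂_cons_right_iff.1 h1
    refine ⟨l'', ?_, ?_⟩
    · rw [h2]
      congr 1
      obtain ⟨x, rfl, h3⟩ := hv
      rw [CombMap.vertex_eq, ← hψ.sameCycle_iff, Equiv.apply_symm_apply]
      exact CombMap.vertex_eq.1 h3
    · refine forall₂_trans (fun _ _ _ h1 h2 => ?_) hl'' hl'
      exact h.ins.cycleEmb.comp_iso h1 h2

lemma target_equiv {s : n.Dart} {κ : m'.Dart → n.Dart} (h' : Splits n m' b s κ) : m ≈ n := by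
  obtain ⟨φ, hr, hι, hR, hL, hc⟩ := h.ins.target_unique h'.ins
  obtain ⟨l, hl, hl'⟩ := h.marked
  obtain ⟨k, hk, hk'⟩ := h'.marked
  obtain rfl : l = k := List.tail_eq_of_cons_eq (hl.symm.trans hk)
  refine ⟨φ, hR, hL, root_map_of_eq h.root h'.root hr, hc, ?_⟩
  refine forall₂_trans (fun v v' w h1 h2 => ?_) (rel := fun v v' => FreeCorr r ι v' v) hl'.flip hk'
  exact h'.ins.cycleEmb.vertexCorr_target hι h1 h2

/-- The image of `b` is recorded too, because it carries the factor `{1, …, p}`. -/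
lemma source_equiv {b' : m''.Dart} {s : m.Dart} {κ : m''.Dart → m.Dart}
    (h' : Splits m m'' b' s κ) : ∃ e : m'.Dart ≃ m''.Dart, IsIso m' m'' e ∧ e b = b' := by
  obtain rfl : r = s := Option.some.inj (h.root.symm.trans h'.root)
  obtain ⟨e, he, hR, hL, hc, ha, hb⟩ := h.ins.source_unique h'.ins
  have hb : e b = b' := Option.some.inj hb
  obtain ⟨l, hl, hl'⟩ := h.marked
  obtain ⟨k, hk, hk'⟩ := h'.marked
  refine ⟨e, ⟨hR, hL, ha, fun d => ?_, ?_⟩, hb⟩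
  · have : m''.col (e d) = m'.col d := by simpa using hc d
    exact this
  rw [hl, hk]
  refine .cons ⟨b, rfl, congrArg _ hb⟩ ?_
  refine forall₂_trans (fun v v' w h1 h2 => ?_) hl' (rel' := fun v v' => FreeCorr r κ v' v) hk'.flip
  exact h'.ins.cycleEmb.vertexCorr_source he h1 h2

end Splits

namespace Contracts

variable {m n m' m'' : SeqMap} {b : m'.Dart} {l : List m.Vertex} {r : m.Dart}
  {ι : m'.Dart → m.Dart} (h : Contracts m m' b l r ι)
include h

lemma map_iso {φ : m.Dart ≃ n.Dart} (hφ : IsIso m n φ) {k : List n.Vertex}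
    (hk : List.Forall₂ (VertexCorr φ) l k) : Contracts n m' b k (φ r) (φ ∘ ι) where
  root := by rw [← hφ.map_root, h.root]; rfl
  ins := h.ins.map_iso hφ
  cycle := h.cycle
  marked := by
    refine forall₂_trans (fun _ _ _ h1 h2 => ?_) h.marked hk
    exact hφ.freeCorr h1 h2

lemma comap_iso {ψ : m''.Dart ≃ m'.Dart} (hψ : IsIso m'' m' ψ) :
    Contracts m m'' (ψ.symm b) l r (ι ∘ ψ) where
  root := h.root
  ins := h.ins.comap_iso hψ hψ.map_root (by simp)
  cycle a ha := by
    rw [← hψ.sameCycle_iff, Equiv.apply_symm_apply]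
    exact h.cycle _ (by rw [← hψ.map_root]; exact Option.mem_map_of_mem _ ha)
  marked := by
    refine forall₂_trans (fun _ _ _ h1 h2 => ?_) hψ.map_marked h.marked
    exact h.ins.cycleEmb.comp_iso h1 h2

lemma target_iso {s : n.Dart} {κ : m'.Dart → n.Dart} {b' : m'.Dart} {k : List n.Vertex}
    (h' : Contracts n m' b' k s κ) (hd : m.rootDegree = n.rootDegree) :
    ∃ φ : m.Dart ≃ n.Dart, φ r = s ∧ (∀ d, φ (m.R d) = n.R (φ d)) ∧
      (∀ d, φ (m.L d) = n.L (φ d)) ∧ (∀ d, n.col (φ d) = m.col d) ∧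
      List.Forall₂ (VertexCorr φ) l k := by
  obtain ⟨a, ha⟩ := SeqMap.exists_root_of_dart b
  obtain rfl : b = b' := by rw [h.eq_pow ha, h'.eq_pow ha, hd]
  obtain ⟨φ, hr, hι, hR, hL, hc⟩ := h.ins.target_unique h'.ins
  refine ⟨φ, hr, hR, hL, hc, ?_⟩
  refine forall₂_trans (fun v v' w h1 h2 => ?_) (rel := fun v v' => FreeCorr r ι v' v)
    h.marked.flip h'.marked
  exact h'.ins.cycleEmb.vertexCorr_target hι h1 h2

lemma source_equiv {b' : m''.Dart} {s : m.Dart} {κ : m''.Dart → m.Dart}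
    (h' : Contracts m m'' b' l s κ) : m' ≈ m'' := by
  obtain rfl : r = s := Option.some.inj (h.root.symm.trans h'.root)
  obtain ⟨e, he, hR, hL, hc, ha, hb⟩ := h.ins.source_unique h'.ins
  refine ⟨e, hR, hL, ha, fun d => ?_, ?_⟩
  · have : m''.col (e d) = m'.col d := by simpa using hc d
    exact this
  refine forall₂_trans (fun v v' w h1 h2 => ?_) h.marked
    (rel' := fun v v' => FreeCorr r κ v' v) h'.marked.flip
  exact h'.ins.cycleEmb.vertexCorr_source he h1 h2

end Contracts

end FaceBipartite

/-! ### Existence of the inverse constructions and of the decomposition -/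

namespace FaceBipartite
open Equiv SeqMap

section Existence

/-- The darts of a component are reached from its root. -/
lemma SeqMap.closed_of_root {m : SeqMap} {p : m.Dart → Prop} (ha : ∀ a ∈ m.root, p a)
    (hR : ∀ y, p y → p (m.R y)) (hL : ∀ y, p y → p (m.L y)) (y : m.Dart) : p y := by
  obtain ⟨a, ha'⟩ := SeqMap.exists_root_of_dart y
  exact CombMap.dart_induction (m := m.toCombMap) (ha a ha') hR hL y

lemma exists_freeCorr {m m' : SeqMap} {r : m.Dart} {j : m'.Dart → m.Dart} {l : List m.Vertex}
    (h : ∀ v ∈ l, FreeAt m r v ∧ ∃ y, m.vertex (j y) = v) :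
    ∃ l' : List m'.Vertex, List.Forall₂ (FreeCorr r j) l' l := by
  refine exists_forall₂ fun v hv => ?_
  obtain ⟨hf, y, hy⟩ := h v hv
  exact ⟨m'.vertex y, ⟨y, rfl, hy⟩, hf⟩

lemma exists_freeCorr' {m m' : SeqMap} {r : m.Dart} {j : m'.Dart → m.Dart} {l' : List m'.Vertex}
    (h : ∀ v ∈ l', ∃ y, m'.vertex y = v ∧ FreeAt m r (m.vertex (j y))) :
    ∃ l : List m.Vertex, List.Forall₂ (FreeCorr r j) l' l := by
  obtain ⟨l, hl⟩ := exists_forall₂ (rel := fun v v' => FreeCorr r j v' v) (l := l') fun v hv => by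
    obtain ⟨y, rfl, hy⟩ := h v hv
    exact ⟨_, ⟨y, rfl, rfl⟩, hy⟩
  exact ⟨l, hl.flip⟩

lemma forall₂_freeAt {m m' : SeqMap} {r : m.Dart} {j : m'.Dart → m.Dart} {l' : List m'.Vertex}
    {l : List m.Vertex} (h : List.Forall₂ (FreeCorr r j) l' l) {v : m.Vertex} (hv : v ∈ l) :
    FreeAt m r v := by
  obtain ⟨_, -, h⟩ := forall₂_exists_left h hv
  exact h.2

/-- Two maps can be glued along a new loop. -/
lemma exists_glues (m₁ m₂ : SeqMap) {S : Finset ℕ} {D : List ℕ}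
    (hS : S ⊆ Finset.range D.length) (h₁ : m₁.marked.length = (pick S D).length)
    (h₂ : m₂.marked.length = (pick (Finset.range D.length \ S) D).length) :
    ∃ (m : SeqMap) (r : m.Dart) (ι : m₁.Dart ⊕ m₂.Dart → m.Dart), Glues m m₁ m₂ S r ι ∧
      m.marked.length = D.length := by
  obtain ⟨m, r, ι, h, hr, -⟩ := exists_ins ((m₁.pre true).sum (m₂.pre false))
    (m₁.root.map Sum.inl) (m₂.root.map Sum.inr)
    (by
      rintro y hy
      obtain ⟨a, ha, rfl⟩ := Option.map_eq_some_iff.1 hy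
      simp [m₁.col_root ha])
    (by
      rintro y hy
      obtain ⟨a, ha, rfl⟩ := Option.map_eq_some_iff.1 hy
      simp [m₂.col_root ha])
    (by
      intro p ha hb hR hL
      rintro (y | y)
      · exact m₁.closed_of_root (p := fun y => p (.inl y))
          (fun a h => ha _ (Option.mem_map_of_mem _ h)) (fun y => hR _) (fun y => hL _) y
      · exact m₂.closed_of_root (p := fun y => p (.inr y))
          (fun a h => hb _ (Option.mem_map_of_mem _ h)) (fun y => hR _) (fun y => hL _) y)
  obtain ⟨l₁, hl₁⟩ := exists_freeCorr' (m := m) (m' := m₁) (r := r) (j := ι ∘ Sum.inl)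
    (l' := m₁.marked) (by
      intro v hv
      obtain ⟨y, rfl⟩ := m₁.exists_vertex v
      refine ⟨y, rfl, (h.freeAt_iff (.inl y)).2 ?_⟩
      rintro (⟨z, hz, hzy⟩ | ⟨z, hz, hzy⟩)
      · obtain ⟨w, hw, rfl⟩ := Option.map_eq_some_iff.1 hz
        refine m₁.root_notMem_marked w hw ?_
        rwa [CombMap.vertex_eq.2 (sameCycle_sumCongr_inl.1 hzy)]
      · obtain ⟨w, hw, rfl⟩ := Option.map_eq_some_iff.1 hz
        exact not_sameCycle_sumCongr hzy.symm)
  obtain ⟨l₂, hl₂⟩ := exists_freeCorr' (m := m) (m' := m₂) (r := r) (j := ι ∘ Sum.inr)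
    (l' := m₂.marked) (by
      intro v hv
      obtain ⟨y, rfl⟩ := m₂.exists_vertex v
      refine ⟨y, rfl, (h.freeAt_iff (.inr y)).2 ?_⟩
      rintro (⟨z, hz, hzy⟩ | ⟨z, hz, hzy⟩)
      · obtain ⟨w, hw, rfl⟩ := Option.map_eq_some_iff.1 hz
        exact not_sameCycle_sumCongr hzy
      · obtain ⟨w, hw, rfl⟩ := Option.map_eq_some_iff.1 hz
        refine m₂.root_notMem_marked w hw ?_
        rwa [CombMap.vertex_eq.2 (sameCycle_sumCongr_inr.1 hzy)])
  obtain ⟨l, hl, rfl, rfl⟩ := exists_pick (S := S) (D := D) (hl₁.length_eq.symm.trans h₁)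
    (hl₂.length_eq.symm.trans h₂)
  have hn : l.Nodup := by
    rw [← (pick_perm (S := S) (l := l)).nodup_iff, List.nodup_append]
    refine ⟨h.cycleEmb_inl.nodup_right hl₁ m₁.marked_nodup,
      h.cycleEmb_inr.nodup_right hl₂ m₂.marked_nodup, ?_⟩
    rintro v hv _ hv' rfl
    obtain ⟨v₁, -, h1⟩ := forall₂_exists_left hl₁ hv
    obtain ⟨v₂, -, h2⟩ := forall₂_exists_left hl₂ hv'
    exact h.not_corr_both h1 h2
  have hroot : ∀ r ∈ m.root, m.vertex r ∉ l := by
    intro s hs hmem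
    obtain rfl : r = s := Option.some.inj (hr.symm.trans hs)
    rw [← (pick_perm (S := S) (l := l)).mem_iff, List.mem_append] at hmem
    rcases hmem with hmem | hmem
    · exact (forall₂_freeAt hl₁ hmem).1 rfl
    · exact (forall₂_freeAt hl₂ hmem).1 rfl
  -- `setMarked` does not affect anything that `Ins` mentions, so the fields are merely repacked for
  -- the new map.
  refine ⟨m.setMarked l hn hroot, r, ι, ⟨hr, ⟨h.1, h.2, h.3, h.4, h.5, h.6, h.7, h.8, h.9, h.10,
    h.11, h.12⟩, ?_, hl₁, hl₂⟩, hl⟩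
  change S ⊆ Finset.range l.length
  rwa [hl]

lemma exists_ins_connected (m' : SeqMap) (b : m'.Dart) (hb : m'.col b = false) :
    ∃ (m : SeqMap) (r : m.Dart) (ι : m'.Dart → m.Dart), Ins m (m'.pre true) r m'.root (some b) ι ∧
      m.root = some r := by
  obtain ⟨m, r, ι, h, hr, -⟩ := exists_ins (m'.pre true) m'.root (some b)
    (fun y hy => by simp [m'.col_root hy]) (fun y hy => by cases hy; simp [hb])
    (fun p ha _ hR hL => m'.closed_of_root ha hR hL)
  exact ⟨m, r, ι, h, hr⟩

lemma notMem_orbs_of_ne {m' : SeqMap} {b y : m'.Dart} (hr : ∀ a ∈ m'.root, ¬ m'.R.SameCycle a y)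
    (hb : ¬ m'.R.SameCycle b y) : y ∉ orbs m'.R m'.root ∪ orbs m'.R (some b) := by
  rintro (⟨z, hz, hzy⟩ | ⟨z, hz, hzy⟩)
  · exact hr z hz hzy
  · cases hz
    exact hb hzy

/-- A distinguished vertex can be merged into the root vertex by a new loop. -/
lemma exists_splits (m' : SeqMap) (b : m'.Dart) (hb : m'.col b = false) {l' : List m'.Vertex}
    (hl' : m'.marked = m'.vertex b :: l') :
    ∃ (m : SeqMap) (r : m.Dart) (ι : m'.Dart → m.Dart), Splits m m' b r ι := by
  obtain ⟨m, r, ι, h, hr⟩ := exists_ins_connected m' b hb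
  have hnd := m'.marked_nodup
  rw [hl', List.nodup_cons] at hnd
  obtain ⟨l, hl⟩ := exists_freeCorr' (m := m) (m' := m') (r := r) (j := ι) (l' := l') (by
    intro v hv
    obtain ⟨y, rfl⟩ := m'.exists_vertex v
    refine ⟨y, rfl, (h.freeAt_iff y).2 (notMem_orbs_of_ne (fun a ha hay => ?_) fun hby => ?_)⟩
    · refine m'.root_notMem_marked a ha ?_
      rw [hl', CombMap.vertex_eq.2 hay]
      exact List.mem_cons_of_mem _ hv
    · exact hnd.1 (by rwa [CombMap.vertex_eq.2 hby]))
  have hn : l.Nodup := h.cycleEmb.nodup_right hl hnd.2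
  have hroot : ∀ r ∈ m.root, m.vertex r ∉ l := by
    intro s hs hmem
    obtain rfl : r = s := Option.some.inj (hr.symm.trans hs)
    exact (forall₂_freeAt hl hmem).1 rfl
  exact ⟨m.setMarked l hn hroot, r, ι, hr, ⟨h.1, h.2, h.3, h.4, h.5, h.6, h.7, h.8, h.9, h.10,
    h.11, h.12⟩, l', hl', hl⟩

/-- The list `l` is not yet made the sequence of `m`: the two link terms either take it as it is or
insert the far end into it. -/
lemma exists_contracts_aux (m' : SeqMap) (b : m'.Dart) (hb : m'.col b = false)
    (hc : ∀ a ∈ m'.root, m'.R.SameCycle a b) :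
    ∃ (m : SeqMap) (r : m.Dart) (ι : m'.Dart → m.Dart) (l : List m.Vertex),
      Contracts m m' b l r ι ∧ l.Nodup := by
  obtain ⟨m, r, ι, h, hr⟩ := exists_ins_connected m' b hb
  obtain ⟨a, ha⟩ := SeqMap.exists_root_of_dart b
  obtain ⟨l, hl⟩ := exists_freeCorr' (m := m) (m' := m') (r := r) (j := ι) (l' := m'.marked) (by
    intro v hv
    obtain ⟨y, rfl⟩ := m'.exists_vertex v
    have key : ∀ a ∈ m'.root, ¬ m'.R.SameCycle a y := fun a ha hay =>
      m'.root_notMem_marked a ha (by rwa [CombMap.vertex_eq.2 hay])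
    exact ⟨y, rfl, (h.freeAt_iff y).2 (notMem_orbs_of_ne key
      fun hby => key a ha ((hc a ha).trans hby))⟩)
  exact ⟨m, r, ι, l, ⟨hr, h, hc, hl⟩, h.cycleEmb.nodup_right hl m'.marked_nodup⟩

/-- The root vertex can be split in two by a new link. -/
lemma exists_contracts (m' : SeqMap) (b : m'.Dart) (hb : m'.col b = false)
    (hc : ∀ a ∈ m'.root, m'.R.SameCycle a b) :
    ∃ (m : SeqMap) (r : m.Dart) (ι : m'.Dart → m.Dart), Contracts m m' b m.marked r ι := by
  obtain ⟨m, r, ι, l, h, hn⟩ := exists_contracts_aux m' b hb hc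
  have hroot : ∀ r ∈ m.root, m.vertex r ∉ l := by
    intro s hs hmem
    obtain rfl : r = s := Option.some.inj (h.root.symm.trans hs)
    exact (forall₂_freeAt h.marked hmem).1 rfl
  have hi := h.ins
  exact ⟨m.setMarked l hn hroot, r, ι, h.root, ⟨hi.1, hi.2, hi.3, hi.4, hi.5, hi.6, hi.7, hi.8,
    hi.9, hi.10, hi.11, hi.12⟩, hc, h.marked⟩

/-- The root vertex can be split in two by a new link with a distinguished far end. -/
lemma exists_contracts_marked (m' : SeqMap) (b : m'.Dart) (hb : m'.col b = false)
    (hc : ∀ a ∈ m'.root, m'.R.SameCycle a b) {j : ℕ} (hj : j ≤ m'.marked.length) :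
    ∃ (m : SeqMap) (r : m.Dart) (ι : m'.Dart → m.Dart),
      Contracts m m' b (m.marked.eraseIdx j) r ι ∧
      m.marked[j]? = some (m.vertex (m.L r)) := by
  obtain ⟨m, r, ι, l, h, hn⟩ := exists_contracts_aux m' b hb hc
  have hloop : ¬ m.vertex r = m.vertex (m.L r) := h.not_isLoop
  rw [h.marked.length_eq] at hj
  have hperm := List.perm_insertIdx (m.vertex (m.L r)) l hj
  have hn' : (l.insertIdx j (m.vertex (m.L r))).Nodup := by
    rw [hperm.nodup_iff, List.nodup_cons]
    exact ⟨fun hmem => (forall₂_freeAt h.marked hmem).2 rfl, hn⟩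
  have hroot : ∀ r' ∈ m.root, m.vertex r' ∉ l.insertIdx j (m.vertex (m.L r)) := by
    intro s hs hmem
    obtain rfl : r = s := Option.some.inj (h.root.symm.trans hs)
    rw [hperm.mem_iff, List.mem_cons] at hmem
    rcases hmem with hmem | hmem
    · exact hloop hmem
    · exact (forall₂_freeAt h.marked hmem).1 rfl
  have hi := h.ins
  refine ⟨m.setMarked _ hn' hroot, r, ι, ⟨h.root, ⟨hi.1, hi.2, hi.3, hi.4, hi.5, hi.6, hi.7, hi.8,
    hi.9, hi.10, hi.11, hi.12⟩, hc, ?_⟩, ?_⟩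
  · change List.Forall₂ _ _ ((l.insertIdx j (m.vertex (m.L r))).eraseIdx j)
    rw [List.eraseIdx_insertIdx_self]
    exact h.marked
  · change (l.insertIdx j (m.vertex (m.L r)))[j]? = _
    rw [List.getElem?_insertIdx_self, if_pos hj]
    rfl

/-- Only the sequence of `m'` has to be replaced. Both ends of a loop are the root vertex, so every
distinguished vertex of `m` is free and has a counterpart in `m'`. -/
lemma Ins.exists_splits {m m' : SeqMap} {b : m'.Dart} {r : m.Dart} {ι : m'.Dart → m.Dart}
    (h : Ins m (m'.pre true) r m'.root (some b) ι) (hr : m.root = some r)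
    (hc : ∀ a ∈ m'.root, ¬ m'.R.SameCycle a b) :
    ∃ (m'' : SeqMap) (b' : m''.Dart) (κ : m''.Dart → m.Dart), Splits m m'' b' r κ := by
  have hloop : m.vertex (m.L r) = m.vertex r := CombMap.vertex_eq.2 (Perm.SameCycle.symm
    (h.loop fun y z hy hz => by cases hz; exact hc y hy))
  obtain ⟨l, hl⟩ := exists_freeCorr (m := m) (m' := m') (r := r) (j := ι) (l := m.marked) (by
    intro v hv
    have hf : FreeAt m r v := by
      refine ⟨?_, ?_⟩
      · rintro rfl
        exact m.root_notMem_marked r hr hv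
      · rintro rfl
        rw [hloop] at hv
        exact m.root_notMem_marked r hr hv
    exact ⟨hf, h.exists_of_freeAt hf⟩)
  have key : ∀ d, m'.vertex d ∈ l → d ∉ orbs m'.R m'.root ∪ orbs m'.R (some b) := by
    intro d hd
    obtain ⟨v, -, hv⟩ := forall₂_exists_right hl hd
    exact h.notMem_of_corr hv
  have hn : (m'.vertex b :: l).Nodup := by
    rw [List.nodup_cons]
    exact ⟨fun hb => key b hb (.inr ⟨b, rfl, Perm.SameCycle.refl _ _⟩),
      h.cycleEmb.nodup_left hl m.marked_nodup⟩
  have hroot : ∀ a ∈ m'.root, m'.vertex a ∉ m'.vertex b :: l := by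
    intro a ha hmem
    rcases List.mem_cons.1 hmem with h1 | h1
    · exact hc a ha (CombMap.vertex_eq.1 h1)
    · exact key a h1 (.inl ⟨a, ha, Perm.SameCycle.refl _ _⟩)
  exact ⟨m'.setMarked _ hn hroot, b, ι, hr, ⟨h.1, h.2, h.3, h.4, h.5, h.6, h.7, h.8, h.9, h.10,
    h.11, h.12⟩, l, rfl, hl⟩

lemma Ins.exists_contracts {m m' : SeqMap} {b : m'.Dart} {r : m.Dart} {ι : m'.Dart → m.Dart}
    (h : Ins m (m'.pre true) r m'.root (some b) ι) (hr : m.root = some r)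
    (hc : ∀ a ∈ m'.root, m'.R.SameCycle a b) {k : List m.Vertex} (hk : k.Nodup)
    (hf : ∀ v ∈ k, FreeAt m r v) :
    ∃ (m'' : SeqMap) (b' : m''.Dart) (κ : m''.Dart → m.Dart), Contracts m m'' b' k r κ := by
  obtain ⟨l, hl⟩ := exists_freeCorr (m := m) (m' := m') (r := r) (j := ι) (l := k)
    fun v hv => ⟨hf v hv, h.exists_of_freeAt (hf v hv)⟩
  have hn : l.Nodup := h.cycleEmb.nodup_left hl hk
  have hroot : ∀ a ∈ m'.root, m'.vertex a ∉ l := by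
    intro a ha hmem
    obtain ⟨v, -, hv⟩ := forall₂_exists_right hl hmem
    exact h.notMem_of_corr hv (.inl ⟨a, ha, Perm.SameCycle.refl _ _⟩)
  exact ⟨m'.setMarked _ hn hroot, b, ι, hr, ⟨h.1, h.2, h.3, h.4, h.5, h.6, h.7, h.8, h.9, h.10,
    h.11, h.12⟩, hc, hl⟩

open Classical in
lemma exists_glues_of_ins {m : SeqMap} {m₁ m₂ : SeqMap} {r : m.Dart}
    {ι : m₁.Dart ⊕ m₂.Dart → m.Dart} (h : Ins m ((m₁.pre true).sum (m₂.pre false)) r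
      (m₁.root.map Sum.inl) (m₂.root.map Sum.inr) ι) (hr : m.root = some r) :
    ∃ (m₁ m₂ : SeqMap) (S : Finset ℕ) (κ : m₁.Dart ⊕ m₂.Dart → m.Dart),
      Glues m m₁ m₂ S r κ := by
  have hloop : m.vertex (m.L r) = m.vertex r := CombMap.vertex_eq.2 (Perm.SameCycle.symm
    (h.loop not_sameCycle_sum_root))
  have hf : ∀ v ∈ m.marked, FreeAt m r v := by
    intro v hv
    refine ⟨?_, ?_⟩
    · rintro rfl
      exact m.root_notMem_marked r hr hv
    · rintro rfl
      rw [hloop] at hv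
      exact m.root_notMem_marked r hr hv
  -- The positions of the distinguished vertices that meet the left part; all other distinguished
  -- vertices lie in the right part.
  let S : Finset ℕ := (Finset.range m.marked.length).filter fun i =>
    ∃ v y, m.marked[i]? = some v ∧ m.vertex (ι (.inl y)) = v
  obtain ⟨l₁, hl₁⟩ := exists_freeCorr (m := m) (m' := m₁) (r := r) (j := ι ∘ Sum.inl)
    (l := pick S m.marked) (by
      intro v hv
      obtain ⟨i, hi, h1⟩ := mem_pick.1 hv
      obtain ⟨-, v', y, h2, h3⟩ := Finset.mem_filter.1 hi
      obtain rfl : v = v' := Option.some.inj (h1.symm.trans h2)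
      exact ⟨hf v (List.mem_iff_getElem?.2 ⟨i, h1⟩), y, h3⟩)
  obtain ⟨l₂, hl₂⟩ := exists_freeCorr (m := m) (m' := m₂) (r := r) (j := ι ∘ Sum.inr)
    (l := pick (Finset.range m.marked.length \ S) m.marked) (by
      intro v hv
      obtain ⟨i, hi, h1⟩ := mem_pick.1 hv
      have hfv := hf v (List.mem_iff_getElem?.2 ⟨i, h1⟩)
      refine ⟨hfv, ?_⟩
      obtain ⟨y | y, hy⟩ := h.exists_of_freeAt hfv
      · obtain ⟨h2, h3⟩ := Finset.mem_sdiff.1 hi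
        exact absurd (Finset.mem_filter.2 ⟨h2, v, y, h1, hy⟩) h3
      · exact ⟨y, hy⟩)
  have hnd := m.marked_nodup
  rw [← (pick_perm (S := S) (l := m.marked)).nodup_iff, List.nodup_append] at hnd
  have hroot₁ : ∀ a ∈ m₁.root, m₁.vertex a ∉ l₁ := by
    intro a ha hmem
    obtain ⟨v, -, hv⟩ := forall₂_exists_right hl₁ hmem
    have h1 : FreeAt m r (m.vertex (ι (.inl a))) := by
      rw [show m.vertex (ι (.inl a)) = v from (h.cycleEmb_inl.corr_iff hv a).1 rfl]
      exact hv.2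
    exact (h.freeAt_iff _).1 h1
      (.inl ⟨_, Option.mem_map_of_mem _ ha, Perm.SameCycle.refl _ _⟩)
  have hroot₂ : ∀ a ∈ m₂.root, m₂.vertex a ∉ l₂ := by
    intro a ha hmem
    obtain ⟨v, -, hv⟩ := forall₂_exists_right hl₂ hmem
    have h1 : FreeAt m r (m.vertex (ι (.inr a))) := by
      rw [show m.vertex (ι (.inr a)) = v from (h.cycleEmb_inr.corr_iff hv a).1 rfl]
      exact hv.2
    exact (h.freeAt_iff _).1 h1
      (.inr ⟨_, Option.mem_map_of_mem _ ha, Perm.SameCycle.refl _ _⟩)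
  exact ⟨m₁.setMarked l₁ (h.cycleEmb_inl.nodup_left hl₁ hnd.1) hroot₁,
    m₂.setMarked l₂ (h.cycleEmb_inr.nodup_left hl₂ hnd.2.1) hroot₂, S, ι, hr,
    ⟨h.1, h.2, h.3, h.4, h.5, h.6, h.7, h.8, h.9, h.10, h.11, h.12⟩, Finset.filter_subset _ _,
    hl₁, hl₂⟩

/-- The cases of the removal of the root edge. -/
theorem exists_decomposition (m : SeqMap) :
    m.root = none ∨
    (∃ (m₁ m₂ : SeqMap) (S : Finset ℕ) (r : m.Dart) (ι : m₁.Dart ⊕ m₂.Dart → m.Dart),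
      Glues m m₁ m₂ S r ι) ∨
    (∃ (m' : SeqMap) (b : m'.Dart) (r : m.Dart) (ι : m'.Dart → m.Dart), Splits m m' b r ι) ∨
    (∃ (m' : SeqMap) (b : m'.Dart) (r : m.Dart) (ι : m'.Dart → m.Dart),
      Contracts m m' b m.marked r ι) ∨
    (∃ (m' : SeqMap) (b : m'.Dart) (j : ℕ) (r : m.Dart) (ι : m'.Dart → m.Dart),
      Contracts m m' b (m.marked.eraseIdx j) r ι ∧ m.marked[j]? = some (m.vertex (m.L r))) := by
  rcases hr : m.root with _ | r
  · exact .inl rfl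
  right
  obtain ⟨P, a, b, ι, h⟩ := exists_removal m r (m.col_root hr)
  -- Every remaining dart is reachable from `a` or from `b`, so this asks whether the removal leaves
  -- a connected non-empty map.
  by_cases hconn : ∃ y z, a = some y ∧ b = some z ∧ z ∈ reach P (some y)
  · right
    obtain ⟨y, z, rfl, rfl, hyz⟩ := hconn
    obtain ⟨m', j, hj, jR, jL, jc, jr, -, hrange⟩ := exists_component P (some y) true
      (by
        intro x hx
        cases hx
        simp [h.col_a rfl])
    have hbij : Function.Bijective j := by
      refine ⟨hj, fun w => ?_⟩
      change w ∈ Set.range j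
      rw [hrange]
      refine h.induction (p := fun w => w ∈ reach P (some y)) ?_ ?_ (fun _ => reach_R.2)
        (fun _ => reach_L.2) w
      · exact fun x hx => mem_reach hx
      · intro x hx
        cases hx
        exact hyz
    let e := Equiv.ofBijective j hbij
    have h' : Ins m (m'.pre true) r m'.root (some (e.symm z)) (ι ∘ e) :=
      h.comap (P' := m'.pre true) e jR jL (fun d => (jc d).symm) jr (by simp)
    obtain ⟨a', ha'⟩ := SeqMap.exists_root_of_dart (e.symm z)
    -- The same vertex in the reduced map means a link, different vertices a loop.
    by_cases hc : m'.R.SameCycle a' (e.symm z)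
    · right
      have hc' : ∀ a ∈ m'.root, m'.R.SameCycle a (e.symm z) := by
        intro a ha
        obtain rfl := Option.mem_unique ha ha'
        exact hc
      have hroot : ∀ v ∈ m.marked, v ≠ m.vertex r := by
        rintro v hv rfl
        exact m.root_notMem_marked r hr hv
      by_cases hfar : m.vertex (m.L r) ∈ m.marked
      · right
        obtain ⟨i, hi⟩ := List.mem_iff_getElem?.1 hfar
        have hlt : i < m.marked.length := (List.getElem?_eq_some_iff.1 hi).1
        obtain ⟨m'', b'', κ, h''⟩ := h'.exists_contracts hr hc' (k := m.marked.eraseIdx i)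
          (m.marked_nodup.eraseIdx i) (by
            intro v hv
            obtain ⟨i', hne, hi'⟩ := List.mem_eraseIdx_iff_getElem?.1 hv
            refine ⟨hroot v (List.mem_iff_getElem?.2 ⟨i', hi'⟩), ?_⟩
            rintro rfl
            exact hne ((List.getElem?_inj hlt m.marked_nodup).1 (hi.trans hi'.symm)).symm)
        exact ⟨m'', b'', i, r, κ, h'', hi⟩
      · left
        obtain ⟨m'', b'', κ, h''⟩ := h'.exists_contracts hr hc' (k := m.marked)
          m.marked_nodup (by
            intro v hv
            refine ⟨hroot v hv, ?_⟩
            rintro rfl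
            exact hfar hv)
        exact ⟨m'', b'', r, κ, h''⟩
    · left
      obtain ⟨m'', b'', κ, h''⟩ := h'.exists_splits hr (by
        intro a ha
        obtain rfl := Option.mem_unique ha ha'
        exact hc)
      exact ⟨m'', b'', r, κ, h''⟩
  · left
    obtain ⟨m₁, j₁, hj₁, jR₁, jL₁, jc₁, jr₁, -, hrange₁⟩ := exists_component P a true
      (fun x hx => by simp [h.col_a hx])
    obtain ⟨m₂, j₂, hj₂, jR₂, jL₂, jc₂, jr₂, -, hrange₂⟩ := exists_component P b false
      (fun x hx => by simp [h.col_b hx])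
    have hbij : Function.Bijective (Sum.elim j₁ j₂) := by
      constructor
      -- A common dart would connect `a` with `b`, contrary to the case assumption.
      · have hdis : ∀ x y, j₁ x ≠ j₂ y := by
          intro x y hxy
          have h1 : j₁ x ∈ reach P a := hrange₁ ▸ ⟨x, rfl⟩
          have h2 : j₁ x ∈ reach P b := hrange₂ ▸ ⟨y, hxy.symm⟩
          obtain ⟨u, hu, σ, hσ, h3⟩ := h1
          obtain ⟨w, hw, τ, hτ, h4⟩ := h2
          refine hconn ⟨u, w, hu, hw, u, rfl, τ⁻¹ * σ, mul_mem (inv_mem hτ) hσ, ?_⟩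
          rw [Perm.mul_apply, h3, Perm.inv_eq_iff_eq, h4]
        exact hj₁.sumElim hj₂ hdis
      · intro w
        have := h.induction (p := fun w => w ∈ reach P a ∨ w ∈ reach P b)
          (fun x hx => .inl (mem_reach hx)) (fun x hx => .inr (mem_reach hx))
          (fun x hx => hx.imp reach_R.2 reach_R.2) (fun x hx => hx.imp reach_L.2 reach_L.2) w
        rw [← hrange₁, ← hrange₂] at this
        rcases this with ⟨x, hx⟩ | ⟨x, hx⟩
        · exact ⟨.inl x, hx⟩
        · exact ⟨.inr x, hx⟩
    have h' : Ins m ((m₁.pre true).sum (m₂.pre false)) r (m₁.root.map Sum.inl)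
        (m₂.root.map Sum.inr) (ι ∘ Equiv.ofBijective _ hbij) := by
      refine h.comap (P' := (m₁.pre true).sum (m₂.pre false)) (Equiv.ofBijective _ hbij)
        ?_ ?_ ?_ ?_ ?_
      · rintro (d | d)
        · exact jR₁ d
        · exact jR₂ d
      · rintro (d | d)
        · exact jL₁ d
        · exact jL₂ d
      · rintro (d | d)
        · exact (jc₁ d).symm
        · exact (jc₂ d).symm
      · rw [← jr₁, Option.map_map]
        rfl
      · rw [← jr₂, Option.map_map]
        rfl
    obtain ⟨n₁, n₂, S, κ, hg⟩ := exists_glues_of_ins h' hr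
    exact ⟨n₁, n₂, S, r, κ, hg⟩

end Existence

end FaceBipartite

/-! ### Parameters and the genus -/

namespace FaceBipartite
open Equiv SeqMap

section Parameters

lemma SeqMap.even_rootDegree (m : SeqMap) : Even m.rootDegree := by
  rw [m.rootDegree_eq]
  cases m.root with
  | none => simp
  | some r => rw [orbs_some]; exact even_ncard_orb m.col_R r

lemma SeqMap.marked_of_root {m : SeqMap} (h : m.root = none) : m.marked = [] := by
  have := m.isEmpty_of_root h
  rw [List.eq_nil_iff_forall_not_mem]
  intro v
  obtain ⟨d, -⟩ := m.exists_vertex v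
  exact this.elim d

lemma SeqMap.hasParams_of_root {m : SeqMap} (h : m.root = none) : HasParams 0 0 1 0 0 [] m := by
  have hm := m.isEmpty_of_root h
  have he : m.numEdges = 0 := m.numEdges_eq_zero.2 hm
  have hv : m.numVertices = 1 := if_pos hm
  have hf : m.numFaces = 1 := if_pos hm
  have hw : m.numWhite = 1 := if_pos hm
  have hfb := m.numFaces_eq
  refine ⟨?_, by omega, by omega, by omega, ?_, by simp [SeqMap.marked_of_root h]⟩
  · change (m.numVertices : ℤ) - m.numEdges + m.numFaces = 2 * (1 - 0)
    omega
  · rw [m.rootDegree_eq, h]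
    simp

lemma SeqMap.equiv_empty {m : SeqMap} (h : m.root = none) : m ≈ emptyMap := by
  have hm := m.isEmpty_of_root h
  have : IsEmpty emptyMap.Dart := inferInstanceAs (IsEmpty Empty)
  exact ⟨Equiv.equivOfIsEmpty _ _, fun d => hm.elim d, fun d => hm.elim d, by rw [h]; rfl,
    fun d => hm.elim d, by rw [SeqMap.marked_of_root h]; exact .nil⟩

/-- The genus is a natural number. -/
lemma exists_genus (m : SeqMap) : ∃ g : ℕ, m.euler = 2 * (1 - (g : ℤ)) := by
  induction hk : m.numEdges using Nat.strong_induction_on generalizing m with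
  | _ k ih =>
    subst hk
    rcases exists_decomposition m with h | ⟨m₁, m₂, S, r, ι, h⟩ | ⟨m', b, r, ι, h⟩ |
      ⟨m', b, r, ι, h⟩ | ⟨m', b, j, r, ι, h, -⟩
    · exact ⟨0, (SeqMap.hasParams_of_root h).1⟩
    · have he := h.numEdges_eq
      obtain ⟨g₁, h₁⟩ := ih _ (by omega) m₁ rfl
      obtain ⟨g₂, h₂⟩ := ih _ (by omega) m₂ rfl
      exact ⟨g₁ + g₂, by rw [h.euler_eq, h₁, h₂]; push_cast; ring⟩
    · obtain ⟨g', h'⟩ := ih _ (by rw [h.ins.numEdges_eq]; omega) m' rfl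
      exact ⟨g' + 1, by rw [h.euler_eq, h']; push_cast; ring⟩
    · obtain ⟨g', h'⟩ := ih _ (by rw [h.ins.numEdges_eq]; omega) m' rfl
      exact ⟨g', by rw [h.euler_eq, h']⟩
    · obtain ⟨g', h'⟩ := ih _ (by rw [h.ins.numEdges_eq]; omega) m' rfl
      exact ⟨g', by rw [h.euler_eq, h']⟩

lemma HasParams.unique {g e w b n g' e' w' b' n' : ℤ} {D D' : List ℕ} {m : SeqMap}
    (h : HasParams g e w b n D m) (h' : HasParams g' e' w' b' n' D' m) :
    g = g' ∧ e = e' ∧ w = w' ∧ b = b' ∧ n = n' ∧ D = D' := by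
  obtain ⟨h1, h2, h3, h4, h5, h6⟩ := h
  obtain ⟨k1, k2, k3, k4, k5, k6⟩ := h'
  unfold CombMap.HasGenus at h1 k1
  refine ⟨by omega, by omega, by omega, by omega, by omega, ?_⟩
  exact List.map_injective_iff.2 (fun x y (h : 2 * x = 2 * y) => by omega) (h6.symm.trans k6)

lemma card_face_of_iso {m m' : SeqMap} {φ : m.Dart ≃ m'.Dart} (h : IsIso m m' φ) (x : Bool) :
    Nat.card {f : m'.Face // m'.isWhite f = x} = Nat.card {f : m.Face // m.isWhite f = x} := by
  have hstep : ∀ d, φ ((m.R * m.L) d) = (m'.R * m'.L) (φ d) := fun d => by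
    rw [Perm.mul_apply, Perm.mul_apply, h.map_R, h.map_L]
  refine card_classes_congr φ _ _ (fun y z _ _ => ⟨?_, fun hyz => ?_⟩)
    (fun y hy => (h.map_isWhite y).trans hy) fun d hd => ?_
  · exact sameCycle_map fun d => ⟨1, by rw [zpow_one, hstep]⟩
  · have := sameCycle_map (P := m'.R * m'.L) (Q := m.R * m.L) (f := φ.symm)
      (fun d => ⟨1, by rw [zpow_one, Equiv.eq_symm_apply, hstep, Equiv.apply_symm_apply]⟩) hyz
    simpa using this
  · refine ⟨φ.symm d, by rw [Equiv.apply_symm_apply], ?_⟩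
    have h1 := h.map_isWhite (φ.symm d)
    rw [Equiv.apply_symm_apply] at h1
    exact h1.symm.trans hd

lemma HasParams.congr {g e w b n : ℤ} {D : List ℕ} {m m' : SeqMap} (hm : HasParams g e w b n D m)
    (hmm : m ≈ m') : HasParams g e w b n D m' := by
  obtain ⟨φ, h⟩ := hmm
  have hroot : m'.root = none ↔ m.root = none := by
    rw [← h.map_root, Option.map_eq_none_iff]
  have he : m'.numEdges = m.numEdges := by
    have h1 := m.two_mul_numEdges
    have h2 := m'.two_mul_numEdges
    rw [Nat.card_congr φ] at h1
    omega
  have hw : m'.numWhite = m.numWhite := by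
    rw [m.numWhite_eq, m'.numWhite_eq, card_face_of_iso h]
    simp only [hroot]
  have hb : m'.numBlack = m.numBlack := card_face_of_iso h false
  have hv : m'.numVertices = m.numVertices := by
    rw [m.numVertices_eq, m'.numVertices_eq]
    congr 1
    have key : ∀ {x y}, (∃ d, m.vertex d = m.vertex x ∧ ∀ r ∈ m.root, ¬ m.R.SameCycle r d) →
        y = φ x → ∃ d, m'.vertex d = m'.vertex y ∧ ∀ r ∈ m'.root, ¬ m'.R.SameCycle r d := by
      rintro x y ⟨d, h1, h2⟩ rfl
      refine ⟨φ d, h.vertex_eq h1, fun r hr => ?_⟩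
      rw [← h.map_root] at hr
      obtain ⟨r', hr', rfl⟩ := Option.map_eq_some_iff.1 hr
      rw [h.sameCycle_iff]
      exact h2 r' hr'
    have key' : ∀ {x}, (∃ d, m'.vertex d = m'.vertex (φ x) ∧
        ∀ r ∈ m'.root, ¬ m'.R.SameCycle r d) →
        ∃ d, m.vertex d = m.vertex x ∧ ∀ r ∈ m.root, ¬ m.R.SameCycle r d := by
      rintro x ⟨d, h1, h2⟩
      obtain ⟨d, rfl⟩ := φ.surjective d
      refine ⟨d, CombMap.vertex_eq.2 (h.sameCycle_iff.1 (CombMap.vertex_eq.1 h1)), fun r hr => ?_⟩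
      rw [← h.sameCycle_iff]
      exact h2 _ (by rw [← h.map_root]; exact Option.mem_map_of_mem _ hr)
    refine card_classes_congr φ _ _ (fun y z _ _ => h.sameCycle_iff.symm) (fun y hy => key hy rfl)
      fun x hx => ?_
    obtain ⟨x, rfl⟩ := φ.surjective x
    exact ⟨x, Perm.SameCycle.refl _ _, key' hx⟩
  have hr : m'.rootDegree = m.rootDegree := by
    unfold SeqMap.rootDegree
    rw [← h.map_root]
    cases m.root with
    | none => rfl
    | some r => exact h.cycleEmb_degree r
  have hf : m'.numFaces = m.numFaces := by rw [m.numFaces_eq, m'.numFaces_eq, hw, hb]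
  have hd : m'.marked.map m'.degree = m.marked.map m.degree := by
    have key : ∀ {l l'}, List.Forall₂ (VertexCorr φ) l l' → l'.map m'.degree = l.map m.degree := by
      intro l l' hl
      induction hl with
      | nil => rfl
      | cons hv _ ih => rw [List.map_cons, List.map_cons, ih, h.corr_degree hv]
    exact key h.map_marked
  obtain ⟨h1, h2, h3, h4, h5, h6⟩ := hm
  refine ⟨?_, by omega, by omega, by omega, by omega, hd.trans h6⟩
  unfold CombMap.HasGenus at h1 ⊢
  omega

lemma HasParams.length {g e w b n : ℤ} {D : List ℕ} {m : SeqMap} (h : HasParams g e w b n D m) :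
    m.marked.length = D.length := by
  have := congrArg List.length h.2.2.2.2.2
  simpa using this

/-- `SplitIndex` has natural numbers as genera; Euler's formula for `m` gives only their sum, and
`exists_genus` provides the two summands. -/
lemma Glues.hasParams_parts {g e w b n : ℕ} {D : List ℕ} {m m₁ m₂ : SeqMap} {S : Finset ℕ}
    {r : m.Dart} {ι : m₁.Dart ⊕ m₂.Dart → m.Dart} (h : Glues m m₁ m₂ S r ι)
    (hm : HasParams g e w b n D m) : ∃ i : SplitIndex g e w b n D, i.S = S ∧
      HasParams i.g₁ i.e₁ i.w₁ i.b₁ i.n₁ i.D₁ m₁ ∧ HasParams i.g₂ i.e₂ i.w₂ i.b₂ i.n₂ i.D₂ m₂ := by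
  have hlen := hm.length
  obtain ⟨h1, h2, h3, h4, h5, h6⟩ := hm
  obtain ⟨g₁, hg₁⟩ := exists_genus m₁
  obtain ⟨g₂, hg₂⟩ := exists_genus m₂
  obtain ⟨n₁, hn₁⟩ := m₁.even_rootDegree
  obtain ⟨n₂, hn₂⟩ := m₂.even_rootDegree
  have k1 : m.euler = 2 * (1 - (g : ℤ)) := h1
  rw [h.euler_eq] at k1
  have k2 := h.numEdges_eq
  have k3 := h.numWhite_eq
  have k4 := h.numBlack_eq
  have k5 := h.rootDegree_eq
  have hsub : S ⊆ Finset.range D.length := hlen ▸ h.subset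
  have hm₁ : m₁.marked.map m₁.degree = (pick S D).map (2 * ·) := by
    rw [← h.ins.cycleEmb_inl.map_degree h.marked₁, map_pick, h6, map_pick]
  have hm₂ : m₂.marked.map m₂.degree = (pick (Finset.range D.length \ S) D).map (2 * ·) := by
    rw [← h.ins.cycleEmb_inr.map_degree h.marked₂, map_pick, h6, map_pick, hlen]
  refine ⟨⟨g₁, g₂, m₁.numEdges, m₂.numEdges, m₁.numWhite, m₂.numWhite, m₁.numBlack, m₂.numBlack,
    n₁, n₂, S, by omega, by omega, by omega, by omega, by omega, hsub⟩, rfl,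
    ⟨hg₁, rfl, rfl, rfl, ?_, hm₁⟩, ⟨hg₂, rfl, rfl, rfl, ?_, hm₂⟩⟩
  · change (m₁.rootDegree : ℤ) = 2 * (n₁ : ℤ)
    omega
  · change (m₂.rootDegree : ℤ) = 2 * (n₂ : ℤ)
    omega

lemma Glues.hasParams {g e w b n : ℕ} {D : List ℕ} {m m₁ m₂ : SeqMap}
    (i : SplitIndex g e w b n D) {r : m.Dart} {ι : m₁.Dart ⊕ m₂.Dart → m.Dart}
    (h : Glues m m₁ m₂ i.S r ι) (h₁ : HasParams i.g₁ i.e₁ i.w₁ i.b₁ i.n₁ i.D₁ m₁)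
    (h₂ : HasParams i.g₂ i.e₂ i.w₂ i.b₂ i.n₂ i.D₂ m₂) (hl : m.marked.length = D.length) :
    HasParams g e w b n D m := by
  obtain ⟨a1, a2, a3, a4, a5, a6⟩ := h₁
  obtain ⟨b1, b2, b3, b4, b5, b6⟩ := h₂
  have k1 := h.euler_eq
  rw [show m₁.euler = _ from a1, show m₂.euler = _ from b1] at k1
  have k2 := h.numEdges_eq
  have k3 := h.numWhite_eq
  have k4 := h.numBlack_eq
  have k5 := h.rootDegree_eq
  have e1 := i.g_eq
  have e2 := i.e_eq
  have e3 := i.b_eq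
  have e4 := i.w_eq
  have e5 := i.n_eq
  refine ⟨?_, by omega, by omega, by omega, by omega, ?_⟩
  · change m.euler = _
    omega
  · refine List.forall₂_eq_eq_eq ▸ forall₂_of_pick (S := i.S) (rel := Eq) (by simp [hl]) ?_ ?_
    · rw [List.forall₂_eq_eq_eq, ← map_pick, ← map_pick, h.ins.cycleEmb_inl.map_degree h.marked₁,
        a6]
      rfl
    · rw [List.forall₂_eq_eq_eq, List.length_map, List.length_map, ← map_pick, ← map_pick,
        h.ins.cycleEmb_inr.map_degree h.marked₂, b6, SplitIndex.D₂]

/-- Both vertices into which the root vertex splits have positive even degree. This gives `1 ≤ p`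
for the distinguished one and `p ≤ n - 2` for the new root vertex. -/
lemma Splits.hasParams_source {g e w b n : ℕ} {D : List ℕ} {m m' : SeqMap} {d : m'.Dart}
    {r : m.Dart} {ι : m'.Dart → m.Dart} (h : Splits m m' d r ι)
    (hm : HasParams g e w b n D m) : ∃ p : {p : ℕ // 1 ≤ p ∧ (p : ℤ) ≤ (n : ℤ) - 2},
      HasParams ((g : ℤ) - 1) ((e : ℤ) - 1) b w ((n : ℤ) - 1 - (p : ℕ)) ((p : ℕ) :: D) m' := by
  obtain ⟨h1, h2, h3, h4, h5, h6⟩ := hm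
  obtain ⟨p, hp⟩ := m'.even_degree (m'.vertex d)
  have hp0 := m'.degree_pos (m'.vertex d)
  obtain ⟨n', hn'⟩ := m'.even_rootDegree
  have hn0 : 0 < m'.rootDegree := by
    obtain ⟨a, ha⟩ := SeqMap.exists_root_of_dart d
    rw [m'.rootDegree_eq, ha, orbs_some]
    exact ncard_orb_pos _ _
  have k1 : m.euler = 2 * (1 - (g : ℤ)) := h1
  rw [h.euler_eq] at k1
  have k2 := h.ins.numEdges_eq
  have k3 := h.ins.numWhite_eq h.root
  have k4 := h.ins.numBlack_eq
  have k5 := h.rootDegree_eq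
  obtain ⟨l, hl, hl'⟩ := h.marked
  refine ⟨⟨p, by omega, by omega⟩, ?_, by omega, by omega, by omega, ?_, ?_⟩
  · change m'.euler = _
    omega
  · simp only
    omega
  · rw [hl, List.map_cons, List.map_cons, ← h.ins.cycleEmb.map_degree hl', h6, hp, two_mul]

lemma Splits.hasParams {g e w b n p : ℤ} {k : ℕ} {D : List ℕ} {m m' : SeqMap} {d : m'.Dart}
    {r : m.Dart} {ι : m'.Dart → m.Dart} (h : Splits m m' d r ι) (hp : p = k)
    (hm : HasParams (g - 1) (e - 1) b w (n - 1 - p) (k :: D) m') : HasParams g e w b n D m := by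
  obtain ⟨h1, h2, h3, h4, h5, h6⟩ := hm
  have k1 : m'.euler = 2 * (1 - (g - 1)) := h1
  have k1' := h.euler_eq
  have k2 := h.ins.numEdges_eq
  have k3 := h.ins.numWhite_eq h.root
  have k4 := h.ins.numBlack_eq
  have k5 := h.rootDegree_eq
  obtain ⟨l, hl, hl'⟩ := h.marked
  rw [hl, List.map_cons, List.map_cons, List.cons.injEq] at h6
  refine ⟨?_, by omega, by omega, by omega, by omega, ?_⟩
  · change m.euler = _
    omega
  · rw [h.ins.cycleEmb.map_degree hl', h6.2]

namespace Contracts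

variable {g e w b n : ℤ} {D : List ℕ} {m m' : SeqMap} {d : m'.Dart} {l : List m.Vertex}
  {r : m.Dart} {ι : m'.Dart → m.Dart} (h : Contracts m m' d l r ι)
include h

/-- Converse of `eq_pow`: the far end has degree at least two, so both exponents are below the
length of the cycle of `a` and must agree. -/
lemma rootDegree_of_pow {a : m'.Dart} (ha : m'.root = some a) {k : ℕ} (hk : d = (m'.R ^ k) a)
    (hlt : k < m'.rootDegree) : m.rootDegree = k + 1 := by
  have h1 := h.eq_pow ha
  have h2 := h.rootDegree_add_eq
  have h3 := m.degree_pos (m.vertex (m.L r))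
  obtain ⟨u, hu⟩ := m.even_degree (m.vertex (m.L r))
  have h4 : 0 < m.rootDegree := by
    rw [m.rootDegree_eq, h.root, orbs_some]
    exact ncard_orb_pos _ _
  have h5 : m'.rootDegree = (orb m'.R a).ncard := by rw [m'.rootDegree_eq, ha, orbs_some]
  have := pow_injOn (P := m'.R) (x := a) (i := k) (j := m.rootDegree - 1) (by omega) (by omega)
    (by rw [← hk, ← h1])
  omega

lemma hasParams_source (hm : HasParams g e w b n D m) {n' : ℤ} {D' : List ℕ}
    (hn' : (m.degree (m.vertex (m.L r)) : ℤ) + 2 * n = 2 + 2 * n')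
    (hl : l.map m.degree = D'.map (2 * ·)) : HasParams g (e - 1) b w n' D' m' := by
  obtain ⟨h1, h2, h3, h4, h5, -⟩ := hm
  have k1 : m.euler = 2 * (1 - g) := h1
  have k1' := h.euler_eq
  have k2 := h.ins.numEdges_eq
  have k3 := h.ins.numWhite_eq h.root
  have k4 := h.ins.numBlack_eq
  have k5 := h.rootDegree_add_eq
  refine ⟨?_, by omega, by omega, by omega, by omega, ?_⟩
  · change m'.euler = _
    omega
  · rw [← h.ins.cycleEmb.map_degree h.marked, hl]

lemma hasParams {n' : ℤ} {D' : List ℕ} (hm : HasParams g (e - 1) b w n' D' m')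
    (hn : (m.rootDegree : ℤ) = 2 * n) (hD : m.marked.map m.degree = D.map (2 * ·)) :
    HasParams g e w b n D m := by
  obtain ⟨h1, h2, h3, h4, h5, -⟩ := hm
  have k1 : m'.euler = 2 * (1 - g) := h1
  have k1' := h.euler_eq
  have k2 := h.ins.numEdges_eq
  have k3 := h.ins.numWhite_eq h.root
  have k4 := h.ins.numBlack_eq
  refine ⟨?_, by omega, by omega, by omega, hn, hD⟩
  change m.euler = _
  omega

end Contracts

end Parameters

/-! ### Representatives of classes and the black darts of a vertex -/

section Classes

variable {g e w b n : ℤ} {D : List ℕ}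

/-- A representative of an isomorphism class. -/
noncomputable def rep (x : F g e w b n D) : SeqMap := (Quotient.out x).1

lemma rep_params (x : F g e w b n D) : HasParams g e w b n D (rep x) := (Quotient.out x).2

lemma represents_rep (x : F g e w b n D) : Represents (rep x) x :=
  ⟨rep_params x, (Quotient.out_eq x).symm⟩

lemma eq_of_rep_equiv {x y : F g e w b n D} (h : rep x ≈ rep y) : x = y := by
  rw [← Quotient.out_eq x, ← Quotient.out_eq y]
  exact Quotient.sound h

lemma exists_rep_equiv {m : SeqMap} (h : HasParams g e w b n D m) :
    ∃ x : F g e w b n D, rep x ≈ m :=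
  ⟨Quotient.mk _ ⟨m, h⟩, Quotient.mk_out
    (s := SeqMap.setoid.comap (Subtype.val : {m // HasParams g e w b n D m} → SeqMap)) ⟨m, h⟩⟩

/-- The black darts of the first distinguished vertex. -/
abbrev BlackDart (m : SeqMap) : Type :=
  {d : m.Dart // m.col d = false ∧ ∃ l, m.marked = m.vertex d :: l}

lemma card_blackDart {m : SeqMap} {p : ℕ} (h : HasParams g e w b n (p :: D) m) :
    Nat.card (BlackDart m) = p := by
  have h6 := h.2.2.2.2.2
  rcases hl : m.marked with _ | ⟨v, l⟩
  · rw [hl] at h6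
    simp at h6
  · obtain ⟨d₀, rfl⟩ := m.exists_vertex v
    rw [hl, List.map_cons, List.map_cons, List.cons.injEq, CombMap.degree_vertex,
      ← ncard_orb_col m.col_R d₀ false] at h6
    have h7 : Nat.card (BlackDart m) = {y | m.R.SameCycle d₀ y ∧ m.col y = false}.ncard := by
      rw [← Nat.card_coe_set_eq]
      refine Nat.card_congr (Equiv.subtypeEquivRight fun d => ?_)
      rw [hl]
      constructor
      · rintro ⟨h1, l', h2⟩
        exact ⟨CombMap.vertex_eq.1 (List.cons.inj h2).1, h1⟩
      · rintro ⟨h1, h2⟩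
        exact ⟨h2, l, by rw [CombMap.vertex_eq.2 h1]⟩
    have := h6.1
    omega

/-- A numbering of the black darts of the first distinguished vertex. -/
noncomputable def blackDart {p : ℕ} (y : F g e w b n (p :: D)) : Fin p ≃ BlackDart (rep y) :=
  have := (rep y).finite_dart
  (Finite.equivFinOfCardEq (card_blackDart (rep_params y))).symm

end Classes

end FaceBipartite

/-! ### The bijection -/

namespace FaceBipartite
open Equiv SeqMap

section Target

lemma forall₂_of_eraseIdx {α β : Type*} {rel : α → β → Prop} {l : List α} {l' : List β} {j : ℕ}
    (h : List.Forall₂ rel (l.eraseIdx j) (l'.eraseIdx j)) {x : α} {y : β} (hx : l[j]? = some x)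
    (hy : l'[j]? = some y) (hxy : rel x y) : List.Forall₂ rel l l' := by
  obtain ⟨hj, rfl⟩ := List.getElem?_eq_some_iff.1 hx
  obtain ⟨hj', rfl⟩ := List.getElem?_eq_some_iff.1 hy
  have := forall₂_insertIdx h j hxy
  rwa [List.insertIdx_eraseIdx_getElem, List.insertIdx_eraseIdx_getElem] at this

lemma SeqMap.rootDegree_le (m : SeqMap) : m.rootDegree ≤ 2 * m.numEdges := by
  rw [m.rootDegree_eq, m.two_mul_numEdges]
  exact Set.ncard_le_card _

/-- The place for a link that is to leave root degree `2 n`. The exponent is odd and the root white,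
so the dart has the colour that an insertion requires. -/
lemma SeqMap.exists_dart_at (m : SeqMap) {n : ℕ} (hn : 1 ≤ n) (h : 2 * n ≤ m.rootDegree) :
    ∃ a, m.root = some a ∧ m.col ((m.R ^ (2 * n - 1)) a) = false ∧
      ∀ a' ∈ m.root, m.R.SameCycle a' ((m.R ^ (2 * n - 1)) a) := by
  rcases ha : m.root with _ | a
  · rw [m.rootDegree_eq, ha] at h
    simp at h
    omega
  · refine ⟨a, rfl, ?_, fun a' ha' => ?_⟩
    · have : Odd (2 * n - 1) := ⟨n - 1, by omega⟩
      rw [col_pow m.col_R, m.col_root ha]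
      simp [this]
    · obtain rfl : a = a' := Option.some.inj ha'
      exact ⟨(2 * n - 1 : ℕ), by rw [zpow_natCast]⟩

lemma SeqMap.IsIso.far_eq {m m' : SeqMap} {φ : m.Dart ≃ m'.Dart} (h : IsIso m m' φ) {r : m.Dart}
    {v : m'.Vertex} (hv : VertexCorr φ (m.vertex (m.L r)) v) : v = m'.vertex (m'.L (φ r)) := by
  obtain ⟨d, h1, rfl⟩ := hv
  rw [← h.map_L]
  exact h.vertex_eq h1

lemma Glues.not_contracts {m m₁ m₂ m' : SeqMap} {S : Finset ℕ} {r s : m.Dart}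
    {ι : m₁.Dart ⊕ m₂.Dart → m.Dart} {κ : m'.Dart → m.Dart} {b : m'.Dart} {l : List m.Vertex}
    (h : Glues m m₁ m₂ S r ι) (h' : Contracts m m' b l s κ) : False := by
  obtain rfl : r = s := Option.some.inj (h.root.symm.trans h'.root)
  exact h'.not_isLoop h.isLoop

lemma Splits.not_contracts {m m' m'' : SeqMap} {r s : m.Dart} {d : m'.Dart} {b : m''.Dart}
    {ι : m'.Dart → m.Dart} {κ : m''.Dart → m.Dart} {l : List m.Vertex}
    (h : Splits m m' d r ι) (h' : Contracts m m'' b l s κ) : False := by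
  obtain rfl : r = s := Option.some.inj (h.root.symm.trans h'.root)
  exact h'.not_isLoop h.isLoop

lemma Contracts.far_notMem {m m' : SeqMap} {b : m'.Dart} {l : List m.Vertex} {r s : m.Dart}
    {ι : m'.Dart → m.Dart} (h : Contracts m m' b l r ι) (hs : m.root = some s) :
    m.vertex (m.L s) ∉ l := fun hl => by
  obtain rfl : r = s := Option.some.inj (h.root.symm.trans hs)
  exact (forall₂_freeAt h.marked hl).2 rfl

variable {g e w b n : ℕ} {D : List ℕ}

/-- The disjoint union of the five terms. -/
abbrev Target (g e w b n : ℕ) (D : List ℕ) : Type 1 :=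
  (Σ i : SplitIndex g e w b n D,
    F i.g₁ i.e₁ i.w₁ i.b₁ i.n₁ i.D₁ × F i.g₂ i.e₂ i.w₂ i.b₂ i.n₂ i.D₂) ⊕
  (Σ p : {p : ℕ // 1 ≤ p ∧ (p : ℤ) ≤ (n : ℤ) - 2},
    F ((g : ℤ) - 1) ((e : ℤ) - 1) b w ((n : ℤ) - 1 - (p : ℕ)) ((p : ℕ) :: D) × Fin p) ⊕
  (Σ p : {p : ℕ // n ≤ p ∧ (p : ℤ) ≤ (e : ℤ) - 1},
    F g ((e : ℤ) - 1) b w (p : ℕ) D) ⊕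
  (Σ j : Fin D.length,
    F g ((e : ℤ) - 1) b w ((D.get j : ℤ) + n - 1) (D.eraseIdx j)) ⊕
  Delta ((g, e, w, b, n, D) = (0, 0, 1, 0, 0, []))

/-- The element of the disjoint union is obtained by removing the root edge. -/
def Removes (x : F g e w b n D) : Target g e w b n D → Prop
  | .inl ⟨i, (y₁, y₂)⟩ => ∃ r ι, Glues (rep x) (rep y₁) (rep y₂) i.S r ι
  | .inr (.inl ⟨_, (y, k)⟩) => ∃ r ι, Splits (rep x) (rep y) (blackDart y k).1 r ι
  | .inr (.inr (.inl ⟨_, y⟩)) => ∃ d r ι, Contracts (rep x) (rep y) d (rep x).marked r ι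
  | .inr (.inr (.inr (.inl ⟨j, y⟩))) => ∃ d r ι,
      Contracts (rep x) (rep y) d ((rep x).marked.eraseIdx j) r ι ∧
        (rep x).marked[(j : ℕ)]? = some ((rep x).vertex ((rep x).L r))
  | .inr (.inr (.inr (.inr _))) => (rep x).root = none

lemma exists_removes (x : F g e w b n D) : ∃ t, Removes x t := by
  have hx := rep_params x
  rcases exists_decomposition (rep x) with h | ⟨m₁, m₂, S, r, ι, h⟩ | ⟨m', d, r, ι, h⟩ |
    ⟨m', d, r, ι, h⟩ | ⟨m', d, j, r, ι, h, hj⟩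
  · obtain ⟨h1, h2, h3, h4, h5, h6⟩ := hx.unique (SeqMap.hasParams_of_root h)
    refine ⟨.inr (.inr (.inr (.inr ⟨emptyMap, rfl, ?_⟩))), h⟩
    rw [Prod.mk.injEq, Prod.mk.injEq, Prod.mk.injEq, Prod.mk.injEq, Prod.mk.injEq]
    exact ⟨by omega, by omega, by omega, by omega, by omega, h6⟩
  · obtain ⟨i, rfl, h1, h2⟩ := h.hasParams_parts hx
    obtain ⟨y₁, ψ₁, hψ₁⟩ := exists_rep_equiv h1
    obtain ⟨y₂, ψ₂, hψ₂⟩ := exists_rep_equiv h2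
    exact ⟨.inl ⟨i, (y₁, y₂)⟩, r, _, h.comap_iso hψ₁ hψ₂⟩
  · obtain ⟨p, hp⟩ := h.hasParams_source hx
    obtain ⟨y, ψ, hψ⟩ := exists_rep_equiv hp
    have h' := h.comap_iso hψ
    obtain ⟨l, hl, -⟩ := h'.marked
    -- The successor of `L r` is white in the big map and becomes black when the colours are
    -- exchanged.
    have hc : (rep y).col (ψ.symm d) = false := by simpa using h'.ins.col_b rfl
    refine ⟨.inr (.inl ⟨p, (y, (blackDart y).symm ⟨ψ.symm d, hc, l, hl⟩)⟩), r, ι ∘ ψ, ?_⟩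
    rw [Equiv.apply_symm_apply]
    exact h'
  · obtain ⟨k, hk⟩ := (rep x).even_degree ((rep x).vertex ((rep x).L r))
    have hk0 := (rep x).degree_pos ((rep x).vertex ((rep x).L r))
    -- The far end has degree `2 k`, and the link takes two darts with it. From `k ≥ 1` comes the
    -- lower bound of the index; the upper one comes from `SeqMap.rootDegree_le`.
    have hm' := h.hasParams_source hx (n' := (k + n - 1 : ℕ)) (by omega) hx.2.2.2.2.2
    have hle := m'.rootDegree_le
    have h2 := hm'.2.1
    have h5 := hm'.2.2.2.2.1
    obtain ⟨y, ψ, hψ⟩ := exists_rep_equiv hm'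
    exact ⟨.inr (.inr (.inl ⟨⟨k + n - 1, by omega, by omega⟩, y⟩)), _, r, _, h.comap_iso hψ⟩
  · obtain ⟨hj', hj''⟩ := List.getElem?_eq_some_iff.1 hj
    have hlt : j < D.length := hx.length ▸ hj'
    have hdeg : (rep x).degree ((rep x).vertex ((rep x).L r)) = 2 * D[j] := by
      have h6 := congrArg (·[j]?) hx.2.2.2.2.2
      simpa [hj, hlt] using h6
    have hm' := h.hasParams_source hx (n' := (D.get ⟨j, hlt⟩ : ℤ) + n - 1) (D' := D.eraseIdx j)
      (by rw [hdeg, List.get_eq_getElem]; push_cast; ring)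
      (by rw [← List.eraseIdx_map, hx.2.2.2.2.2, List.eraseIdx_map])
    obtain ⟨y, ψ, hψ⟩ := exists_rep_equiv hm'
    exact ⟨.inr (.inr (.inr (.inl ⟨⟨j, hlt⟩, y⟩))), _, r, _, h.comap_iso hψ, hj⟩

lemma exists_removes_source (hD : ∀ d ∈ D, 1 ≤ d) (hn : 1 ≤ n ∨ e = 0) (t : Target g e w b n D) :
    ∃ x, Removes x t := by
  rcases t with ⟨i, y₁, y₂⟩ | ⟨p, y, k⟩ | ⟨p, y⟩ | ⟨j, y⟩ | ⟨m, rfl, ht⟩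
  · obtain ⟨m, r, ι, h, hl⟩ := exists_glues (rep y₁) (rep y₂) i.S_subset (rep_params y₁).length
      (rep_params y₂).length
    obtain ⟨x, φ, hφ⟩ := exists_rep_equiv (h.hasParams i (rep_params y₁) (rep_params y₂) hl)
    exact ⟨x, _, _, h.map_iso hφ.symm⟩
  · obtain ⟨l, hl⟩ := (blackDart y k).2.2
    obtain ⟨m, r, ι, h⟩ := exists_splits (rep y) (blackDart y k).1 (blackDart y k).2.1 hl
    obtain ⟨x, φ, hφ⟩ := exists_rep_equiv (h.hasParams rfl (rep_params y))
    exact ⟨x, _, _, h.map_iso hφ.symm⟩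
  · have hy := rep_params y
    have h2 := hy.2.1
    have h5 := hy.2.2.2.2.1
    have hp := p.2.1
    -- For `e = 0` the range of `p` is empty.
    have hn' : 1 ≤ n := by omega
    obtain ⟨a, ha, hc, hs⟩ := (rep y).exists_dart_at hn' (by omega)
    obtain ⟨m, r, ι, h⟩ := exists_contracts (rep y) _ hc hs
    have hr := h.rootDegree_of_pow ha rfl (by omega)
    obtain ⟨x, φ, hφ⟩ := exists_rep_equiv (h.hasParams (n := n) (D := D) hy (by omega)
      (by rw [h.ins.cycleEmb.map_degree h.marked, hy.2.2.2.2.2]))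
    exact ⟨x, _, _, _, h.map_iso hφ.symm hφ.symm.map_marked⟩
  · have hy := rep_params y
    have h2 := hy.2.1
    have h5 := hy.2.2.2.2.1
    have hj := hD (D.get j) (List.get_mem _ _)
    -- The class `y` has `e - 1` edges, which excludes `e = 0`.
    have hn' : 1 ≤ n := by omega
    obtain ⟨a, ha, hc, hs⟩ := (rep y).exists_dart_at hn' (by omega)
    obtain ⟨m, r, ι, h, hmj⟩ := exists_contracts_marked (rep y) _ hc hs (j := j) (by
      rw [hy.length, List.length_eraseIdx_of_lt j.2]
      omega)
    have hr := h.rootDegree_of_pow ha rfl (by omega)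
    have hdeg : m.degree (m.vertex (m.L r)) = 2 * D.get j := by
      have := h.rootDegree_add_eq
      omega
    have hmarked : m.marked.map m.degree = D.map (2 * ·) := by
      rw [← List.forall₂_eq_eq_eq]
      refine forall₂_of_eraseIdx (j := j) (x := 2 * D.get j) (y := 2 * D.get j) ?_
        (by rw [List.getElem?_map, hmj, ← hdeg]; rfl) (by simp) rfl
      rw [List.forall₂_eq_eq_eq, List.eraseIdx_map, List.eraseIdx_map,
        h.ins.cycleEmb.map_degree h.marked, hy.2.2.2.2.2]
    obtain ⟨x, φ, hφ⟩ := exists_rep_equiv (h.hasParams (n := n) (D := D) hy (by omega) hmarked)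
    obtain ⟨v, hv, hv'⟩ := forall₂_getElem? hφ.symm.map_marked hmj
    rw [hφ.symm.far_eq hv'] at hv
    exact ⟨x, _, _, _, h.map_iso hφ.symm (forall₂_eraseIdx hφ.symm.map_marked j), hv⟩
  · rw [Prod.mk.injEq, Prod.mk.injEq, Prod.mk.injEq, Prod.mk.injEq, Prod.mk.injEq] at ht
    obtain ⟨rfl, rfl, rfl, rfl, rfl, rfl⟩ := ht
    obtain ⟨x, φ, hφ⟩ := exists_rep_equiv (SeqMap.hasParams_of_root (m := emptyMap) rfl)
    refine ⟨x, ?_⟩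
    have := hφ.map_root
    exact Option.map_eq_none_iff.1 this

/-- The position of the term that contains an element of the disjoint union. -/
def Target.term : Target g e w b n D → ℕ
  | .inl _ => 0
  | .inr (.inl _) => 1
  | .inr (.inr (.inl _)) => 2
  | .inr (.inr (.inr (.inl _))) => 3
  | .inr (.inr (.inr (.inr _))) => 4

/-- The terms are told apart by properties of the big map: whether it has a root, whether the root
edge is a loop, whether its removal disconnects, whether the far end is distinguished. An inequality
suffices by symmetry and halves the number of cases. -/
lemma Removes.term_le {x : F g e w b n D} {t t' : Target g e w b n D} (h : Removes x t)
    (h' : Removes x t') : t.term ≤ t'.term := by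
  by_contra! hlt
  rcases t with ⟨i, y₁, y₂⟩ | ⟨p, y, k⟩ | ⟨p, y⟩ | ⟨j, y⟩ | t <;>
  rcases t' with ⟨i', y₁', y₂'⟩ | ⟨p', y', k'⟩ | ⟨p', y'⟩ | ⟨j', y'⟩ | t' <;>
  try (simp [Target.term] at hlt; done)
  · obtain ⟨r, ι, h⟩ := h
    obtain ⟨s, κ, h'⟩ := h'
    exact h'.not_splits h
  · obtain ⟨d, r, ι, h⟩ := h
    obtain ⟨s, κ, h'⟩ := h'
    exact h'.not_contracts h
  · obtain ⟨d, r, ι, h⟩ := h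
    obtain ⟨s, κ, h'⟩ := h'
    exact h'.not_contracts h
  · obtain ⟨d, r, ι, h, -⟩ := h
    obtain ⟨s, κ, h'⟩ := h'
    exact h'.not_contracts h
  · obtain ⟨d, r, ι, h, -⟩ := h
    obtain ⟨s, κ, h'⟩ := h'
    exact h'.not_contracts h
  · obtain ⟨d, r, ι, h, hj⟩ := h
    obtain ⟨d', s, κ, h'⟩ := h'
    exact h'.far_notMem h.root (List.mem_of_getElem? hj)
  · obtain ⟨s, κ, h'⟩ := h'
    exact Option.some_ne_none _ (h'.root.symm.trans h)
  · obtain ⟨s, κ, h'⟩ := h'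
    exact Option.some_ne_none _ (h'.root.symm.trans h)
  · obtain ⟨d, s, κ, h'⟩ := h'
    exact Option.some_ne_none _ (h'.root.symm.trans h)
  · obtain ⟨d, s, κ, h', -⟩ := h'
    exact Option.some_ne_none _ (h'.root.symm.trans h)

lemma Removes.target_eq {x : F g e w b n D} {t t' : Target g e w b n D} (h : Removes x t)
    (h' : Removes x t') : t = t' := by
  have hterm := le_antisymm (h.term_le h') (h'.term_le h)
  rcases t with ⟨i, y₁, y₂⟩ | ⟨p, y, k⟩ | ⟨p, y⟩ | ⟨j, y⟩ | t <;>
  rcases t' with ⟨i', y₁', y₂'⟩ | ⟨p', y', k'⟩ | ⟨p', y'⟩ | ⟨j', y'⟩ | t' <;>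
  try (simp [Target.term] at hterm; done)
  · obtain ⟨r, ι, h⟩ := h
    obtain ⟨s, κ, h'⟩ := h'
    obtain ⟨e₁, e₂, hS⟩ := h.source_equiv h'
    have hi : i = i' := by
      obtain ⟨h1, h2, h3, h4, h5, -⟩ := ((rep_params y₁).congr e₁).unique (rep_params y₁')
      obtain ⟨k1, k2, k3, k4, k5, -⟩ := ((rep_params y₂).congr e₂).unique (rep_params y₂')
      cases i
      cases i'
      simp only [Nat.cast_inj] at h1 h2 h3 h4 h5 k1 k2 k3 k4 k5 hS
      subst h1 h2 h3 h4 h5 k1 k2 k3 k4 k5 hS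
      rfl
    subst hi
    obtain rfl := eq_of_rep_equiv e₁
    obtain rfl := eq_of_rep_equiv e₂
    rfl
  · obtain ⟨r, ι, h⟩ := h
    obtain ⟨s, κ, h'⟩ := h'
    obtain ⟨ε, hε, hk⟩ := h.source_equiv h'
    obtain ⟨-, -, -, -, h5, -⟩ := ((rep_params y).congr ⟨ε, hε⟩).unique (rep_params y')
    obtain rfl : p = p' := Subtype.ext (by omega)
    obtain rfl := eq_of_rep_equiv ⟨ε, hε⟩
    -- Both black darts belong to the same representative, and its only automorphism is the
    -- identity, so their numbers agree.
    rw [hε.eq_id] at hk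
    obtain rfl := (blackDart y).injective (Subtype.ext hk)
    rfl
  · obtain ⟨d, r, ι, h⟩ := h
    obtain ⟨d', s, κ, h'⟩ := h'
    have hy := h.source_equiv h'
    obtain ⟨-, -, -, -, h5, -⟩ := ((rep_params y).congr hy).unique (rep_params y')
    obtain rfl : p = p' := Subtype.ext (by omega)
    obtain rfl := eq_of_rep_equiv hy
    rfl
  · obtain ⟨d, r, ι, h, hj⟩ := h
    obtain ⟨d', s, κ, h', hj'⟩ := h'
    obtain rfl : r = s := Option.some.inj (h.root.symm.trans h'.root)
    -- The far end occurs only once among the distinguished vertices.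
    obtain rfl : j = j' := Fin.ext ((List.getElem?_inj (List.getElem?_eq_some_iff.1 hj).1
      (rep x).marked_nodup).1 (hj.trans hj'.symm))
    obtain rfl := eq_of_rep_equiv (h.source_equiv h')
    rfl
  · obtain rfl : t = t' := Subtype.ext (t.2.1.trans t'.2.1.symm)
    rfl

/-- For links, `t` does not record the dart `b`; the common root degree `2 n` restores it. -/
lemma Removes.source_eq {x x' : F g e w b n D} {t : Target g e w b n D} (h : Removes x t)
    (h' : Removes x' t) : x = x' := by
  have hx := rep_params x
  have hx' := rep_params x'
  have hroot : (rep x).rootDegree = (rep x').rootDegree := by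
    have := hx.2.2.2.2.1
    have := hx'.2.2.2.2.1
    omega
  apply eq_of_rep_equiv
  rcases t with ⟨i, y₁, y₂⟩ | ⟨p, y, k⟩ | ⟨p, y⟩ | ⟨j, y⟩ | t
  · obtain ⟨r, ι, h⟩ := h
    obtain ⟨s, κ, h'⟩ := h'
    exact h.target_equiv h' (hx.length.trans hx'.length.symm)
  · obtain ⟨r, ι, h⟩ := h
    obtain ⟨s, κ, h'⟩ := h'
    exact h.target_equiv h'
  · obtain ⟨d, r, ι, h⟩ := h
    obtain ⟨d', s, κ, h'⟩ := h'
    obtain ⟨φ, hr, hR, hL, hc, hl⟩ := h.target_iso h' hroot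
    exact ⟨φ, hR, hL, root_map_of_eq h.root h'.root hr, hc, hl⟩
  · obtain ⟨d, r, ι, h, hj⟩ := h
    obtain ⟨d', s, κ, h', hj'⟩ := h'
    obtain ⟨φ, hr, hR, hL, hc, hl⟩ := h.target_iso h' hroot
    refine ⟨φ, hR, hL, root_map_of_eq h.root h'.root hr, hc, forall₂_of_eraseIdx hl hj hj' ?_⟩
    exact ⟨(rep x).L r, rfl, by rw [hL, hr]⟩
  · exact Setoid.trans (SeqMap.equiv_empty h) (Setoid.symm (SeqMap.equiv_empty h'))

end Target

end FaceBipartite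

open FaceBipartite
theorem mainTheorem2 (g e w b n : ℕ) (D : List ℕ) (hD : ∀ d ∈ D, 1 ≤ d) (hn : 1 ≤ n ∨ e = 0) :
    ∃ Φ : F g e w b n D ≃
        (Σ i : SplitIndex g e w b n D,
          F i.g₁ i.e₁ i.w₁ i.b₁ i.n₁ i.D₁ × F i.g₂ i.e₂ i.w₂ i.b₂ i.n₂ i.D₂) ⊕
        (Σ p : {p : ℕ // 1 ≤ p ∧ (p : ℤ) ≤ (n : ℤ) - 2},
          F ((g : ℤ) - 1) ((e : ℤ) - 1) b w ((n : ℤ) - 1 - (p : ℕ)) ((p : ℕ) :: D) × Fin p) ⊕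
        (Σ p : {p : ℕ // n ≤ p ∧ (p : ℤ) ≤ (e : ℤ) - 1},
          F g ((e : ℤ) - 1) b w (p : ℕ) D) ⊕
        (Σ j : Fin D.length,
          F g ((e : ℤ) - 1) b w ((D.get j : ℤ) + n - 1) (D.eraseIdx j)) ⊕
        Delta ((g, e, w, b, n, D) = (0, 0, 1, 0, 0, [])),
      (∀ x i y₁ y₂, Φ x = .inl ⟨i, (y₁, y₂)⟩ →
        ∃ m m₁ m₂, Represents m x ∧ Represents m₁ y₁ ∧ Represents m₂ y₂ ∧
          LoopSplits m m₁ m₂ i.S) ∧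
      (∀ x p y k, Φ x = .inr (.inl ⟨p, (y, k)⟩) →
        ∃ m m', Represents m x ∧ Represents m' y ∧ LoopReduces m m') ∧
      (∀ x p y, Φ x = .inr (.inr (.inl ⟨p, y⟩)) →
        ∃ m m', Represents m x ∧ Represents m' y ∧ LinkReduces m m' m.marked ∧
          ∀ v ∈ m.marked, ¬ IsFarEnd m v) ∧
      (∀ x j y, Φ x = .inr (.inr (.inr (.inl ⟨j, y⟩))) →
        ∃ m m', Represents m x ∧ Represents m' y ∧ LinkReduces m m' (m.marked.eraseIdx j) ∧
          ∃ v, m.marked[(j : ℕ)]? = some v ∧ IsFarEnd m v) ∧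
      (∀ x y, Φ x = .inr (.inr (.inr (.inr y))) → Represents y.1 x) := by
  -- Any choice will do, because `Removes.target_eq` leaves only one; it also turns the preimages of
  -- `exists_removes_source` into preimages under `Φ`.
  choose Φ hΦ using exists_removes (g := g) (e := e) (w := w) (b := b) (n := n) (D := D)
  have hbij : Function.Bijective Φ := by
    refine ⟨fun x x' h => (hΦ x).source_eq (h ▸ hΦ x'), fun t => ?_⟩
    obtain ⟨x, hx⟩ := exists_removes_source hD hn t
    exact ⟨x, (hΦ x).target_eq hx⟩
  refine ⟨Equiv.ofBijective Φ hbij, fun x i y₁ y₂ h => ?_, fun x p y k h => ?_,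
    fun x p y h => ?_, fun x j y h => ?_, fun x y h => ?_⟩
  all_goals
    have hx := hΦ x
    rw [show Φ x = _ from h] at hx
  · obtain ⟨r, ι, hx⟩ := hx
    exact ⟨_, _, _, represents_rep x, represents_rep y₁, represents_rep y₂, hx.loopSplits⟩
  · obtain ⟨r, ι, hx⟩ := hx
    exact ⟨_, _, represents_rep x, represents_rep y, hx.loopReduces⟩
  · obtain ⟨d, r, ι, hx⟩ := hx
    refine ⟨_, _, represents_rep x, represents_rep y, hx.linkReduces, ?_⟩
    rintro _ hv ⟨s, hs, rfl⟩
    exact hx.far_notMem hs hv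
  · obtain ⟨d, r, ι, hx, hj⟩ := hx
    exact ⟨_, _, represents_rep x, represents_rep y, hx.linkReduces, _, hj, r, hx.root, rfl⟩
  · have hequiv := SeqMap.equiv_empty hx
    rw [y.2.1]
    refine ⟨(rep_params x).congr hequiv, ?_⟩
    obtain ⟨h1, hx'⟩ := represents_rep x
    exact hx'.trans (Quotient.sound hequiv)
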